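/- Let $\mathbb R((G))$ denote the field of Hahn series $\sum_{g\in G}a_gt^g$ with real coefficients and well-ordered support in an ordered abelian group $G$, ordered lexicographically (a nonzero series is positive if and only if the coefficient at the least element of its support is positive). A structure is $\aleph_1$-saturated if every set of first-order formulas in one free variable, with parameters from a countable subset, that is finitely satisfiable in the structure is realized in it; ordered abelian groups are regarded as structures in the language $\{0,-,+,<\}$ and ordered fields as structures in the language $\{0,1,-,+,\cdot,<\}$. An integer part of an ordered field $K$ is a subring $M\subseteq K$ that has no element $m$ with $0<m<1$ and such that for every $x\in K$ there is $m\in M$ with $x\le m<x+1$; $M$ is called a model of $\mathrm{PA}$ if its nonnegative elements, in the language $\{0,1,+,\cdot,<\}$, form a model of first-order Peano Arithmetic. **Corollary 1.4.** There is an $\aleph_1$-saturated real closed field none of whose integer parts is a model of $\mathrm{PA}$. More precisely, there is a nontrivial divisible ordered abelian group $G$ that is $\aleph_1$-saturated and such that $\mathbb R((G))$ is a real closed field, $\mathbb R((G))$ is $\aleph_1$-saturated, and no integer part of $\mathbb R((G))$ is a model of $\mathrm{PA}$. -/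

import Mathlib

open FirstOrder Cardinal HahnSeries

namespace PAIntegerPart

open FirstOrder.Language

/-! ### First-order languages -/

/-- The single binary relation symbol `<`. -/
inductive LtRel : ℕ → Type
  | lt : LtRel 2

/-- The function symbols `0, -, +` of ordered abelian groups. -/
inductive GroupFunc : ℕ → Type
  | zero : GroupFunc 0
  | neg : GroupFunc 1
  | add : GroupFunc 2

/-- The function symbols `0, 1, -, +, ·` of ordered rings. -/
inductive RingFunc : ℕ → Type
  | zero : RingFunc 0
  | one : RingFunc 0
  | neg : RingFunc 1
  | add : RingFunc 2
  | mul : RingFunc 2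

/-- The function symbols `0, 1, +, ·` of arithmetic. -/
inductive ArithFunc : ℕ → Type
  | zero : ArithFunc 0
  | one : ArithFunc 0
  | add : ArithFunc 2
  | mul : ArithFunc 2

/-- The language `{0, -, +, <}` of ordered abelian groups. -/
abbrev orderedGroup : FirstOrder.Language.{0, 0} := ⟨GroupFunc, LtRel⟩

/-- The language `{0, 1, -, +, ·, <}` of ordered rings. -/
abbrev orderedRing : FirstOrder.Language.{0, 0} := ⟨RingFunc, LtRel⟩

/-- The language `{0, 1, +, ·, <}` of arithmetic. -/
abbrev arith : FirstOrder.Language.{0, 0} := ⟨ArithFunc, LtRel⟩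

/-- The standard interpretation of the language of ordered abelian groups. -/
instance orderedGroupStructure (G : Type*) [Zero G] [Neg G] [Add G] [LT G] :
    orderedGroup.Structure G where
  funMap
    | .zero, _ => 0
    | .neg, v => -v 0
    | .add, v => v 0 + v 1
  RelMap
    | .lt, v => v 0 < v 1

/-- The standard interpretation of the language of ordered rings. -/
instance orderedRingStructure (K : Type*) [Zero K] [One K] [Neg K] [Add K] [Mul K] [LT K] :
    orderedRing.Structure K where
  funMap
    | .zero, _ => 0
    | .one, _ => 1
    | .neg, v => -v 0
    | .add, v => v 0 + v 1
    | .mul, v => v 0 * v 1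
  RelMap
    | .lt, v => v 0 < v 1

/-- The standard interpretation of the language of arithmetic. -/
instance arithStructure (N : Type*) [Zero N] [One N] [Add N] [Mul N] [LT N] :
    arith.Structure N where
  funMap
    | .zero, _ => 0
    | .one, _ => 1
    | .add, v => v 0 + v 1
    | .mul, v => v 0 * v 1
  RelMap
    | .lt, v => v 0 < v 1

/-! ### Saturation -/

/-- An `L`-structure `M` is `κ`-saturated if for every `A ⊆ M` of cardinality less than `κ`, every
set of formulas in one free variable with parameters from `A` that is finitely satisfiable in `M`
(equivalently, consistent with the elementary diagram of `M`) is realized in `M`. -/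
def IsSaturated (L : FirstOrder.Language.{0, 0}) (κ : Cardinal.{0}) (M : Type) [L.Structure M] : Prop :=
  ∀ A : Set M, #A < κ → ∀ p : Set (L[[A]].Formula Unit),
    (∀ q : Finset (L[[A]].Formula Unit), (q : Set (L[[A]].Formula Unit)) ⊆ p →
      ∃ x : M, ∀ φ ∈ q, φ.Realize (fun _ : Unit => x)) →
    ∃ x : M, ∀ φ ∈ p, φ.Realize (fun _ : Unit => x)

/-! ### Peano Arithmetic -/

section Terms

variable {α : Type*}

instance : Zero (arith.Term α) := ⟨Constants.term (L := arith) ArithFunc.zero⟩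

instance : One (arith.Term α) := ⟨Constants.term (L := arith) ArithFunc.one⟩

instance : Add (arith.Term α) := ⟨Functions.apply₂ (L := arith) ArithFunc.add⟩

instance : Mul (arith.Term α) := ⟨Functions.apply₂ (L := arith) ArithFunc.mul⟩

/-- The formula `s < t`. -/
def ltFormula {n : ℕ} (s t : arith.Term (α ⊕ Fin n)) : arith.BoundedFormula α n :=
  Relations.boundedFormula₂ (L := arith) LtRel.lt s t

end Terms

/-- The finitely many basic axioms of Peano Arithmetic, `x + 1` being the successor of `x`:
* `x + 1 ≠ 0`;
* `x + 1 = y + 1 → x = y`;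
* `x + 0 = x`;
* `x + (y + 1) = (x + y) + 1`;
* `x · 0 = 0`;
* `x · (y + 1) = x · y + x`;
* `x < y ↔ ∃ z, x + (z + 1) = y`. -/
def basicAxioms : arith.Theory :=
  { ∀' ∼((&0 + 1) =' 0),
    ∀' ∀' (((&0 + 1) =' (&1 + 1)) ⟹ (&0 =' &1)),
    ∀' ((&0 + 0) =' &0),
    ∀' ∀' ((&0 + (&1 + 1)) =' ((&0 + &1) + 1)),
    ∀' ((&0 * 0) =' 0),
    ∀' ∀' ((&0 * (&1 + 1)) =' (&0 * &1 + &0)),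
    ∀' ∀' ((ltFormula (&0) (&1)).iff (∃' ((&0 + (&2 + 1)) =' &1))) }

/-- The induction axiom of a formula `φ(w, v)` with parameter variables `w = (w₁, …, wₙ)`:
`∀ w, φ(w, 0) → (∀ v, φ(w, v) → φ(w, v + 1)) → ∀ v, φ(w, v)`. -/
noncomputable def inductionAxiom {n : ℕ} (φ : arith.Formula (Fin n ⊕ Unit)) : arith.Sentence :=
  let φZero : arith.Formula (Fin n) := φ.subst (Sum.elim Term.var fun _ => 0)
  let φSucc : arith.Formula (Fin n ⊕ Unit) :=
    φ.subst (Sum.elim (fun i => Term.var (Sum.inl i)) fun u => Term.var (Sum.inr u) + 1)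
  let χ : arith.Formula (Fin n) :=
    φZero ⟹ (Formula.iAlls Unit (φ ⟹ φSucc) ⟹ Formula.iAlls Unit φ)
  Formula.iAlls (Fin n) (χ.relabel Sum.inr : arith.Formula (Empty ⊕ Fin n))

/-- First-order Peano Arithmetic: the basic axioms and the full induction schema. -/
noncomputable def PA : arith.Theory :=
  basicAxioms ∪ {σ | ∃ (n : ℕ) (φ : arith.Formula (Fin n ⊕ Unit)), σ = inductionAxiom φ}

/-! ### Integer parts -/

section IntegerParts

variable {K : Type*} [Field K] [LinearOrder K] [IsStrictOrderedRing K]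

/-- A subring `M` of an ordered field `K` is an integer part of `K` if it is discretely ordered and
every `x ∈ K` satisfies `x ≤ m < x + 1` for some `m ∈ M`. -/
structure IsIntegerPart (M : Subring K) : Prop where
  discrete : ¬ ∃ m ∈ M, 0 < m ∧ m < 1
  exists_near : ∀ x : K, ∃ m ∈ M, x ≤ m ∧ m < x + 1

/-- An ordered ring is called a model of Peano Arithmetic if the semiring of its nonnegative
elements, in the language of arithmetic, is a model of `PA`. -/
def ModelsPA (M : Subring K) : Prop :=
  {m : M // 0 ≤ m} ⊨ PA

end IntegerParts

end PAIntegerPart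

/-! The exponent group `G` is the additive group of the hyperreals. It is divisible and, as an
order, η₁: between countable sets A < B there is always a point. Three facts are proved about
ℝ((G)).

No integer part models PA; this needs only that `G` is nontrivial and densely ordered. If an integer
part M is a model, overspill for a formula that codes powers of two by Gödel's β function gives an
infinite n in M and a function i ↦ 2^i for 0 ≤ i ≤ n in M (`exists_powers_of_modelsPA`). Two such
powers are archimedean equivalent exactly when their exponents differ by a finite amount, and an
element of ℝ((G)) taken up to finite error is its part with negative exponents. The logarithm of t^g
therefore gives an order-reversing map from an interval (gs, 0) of `G` into the series supported on
negative exponents, and its image is convex because M is an integer part.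
`not_exists_convex_embedding` excludes such a map: it would produce a strictly increasing sequence
in `G` indexed by all ordinals.

ℝ((G)) is real closed and has the intermediate value property for polynomials. For divisible `G` the
field ℂ((G)) is algebraically closed: extend its valuation to the algebraic closure. Divisibility
keeps the value group, algebraic closedness of ℂ keeps the residue field, and a Hahn field has no
proper extension of this kind because coherent truncations glue. As ℂ((G)) is ℝ((G)) with a square
root of -1 adjoined, polynomials over ℝ((G)) factor into linear and positive definite quadratic
ones.

ℝ((G)) and `G` are saturated. The η₁ property passes from `G` to ℝ((G)) (`IsEtaOne.hahnSeries`). A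
semantic quantifier elimination (`IsSignElimination`) shows that a formula in one variable with
parameters is constant on the cells cut out by finitely many points, so realizing a type over
countably many parameters amounts to filling a countable cut. For fields the elimination is the
Cohen–Hörmander method: up to an order automorphism, the signs of a polynomial are determined by its
signs at its critical points and at the roots of the other polynomials, where it has the signs of
remainders of lower degree. -/

namespace PAIntegerPart

open FirstOrder.Language

/-! ### Chains without convex embeddings into Hahn groups -/

/-- The Hahn series with coefficient `1` on `S` and `0` elsewhere. -/
noncomputable def hahnIndicator {G : Type*} [LinearOrder G] (S : Set G) (hS : S.IsPWO) :
    Lex (HahnSeries G ℝ) :=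
  toLex ⟨S.indicator 1, hS.mono Set.support_indicator_subset⟩

theorem coeff_hahnIndicator {G : Type*} [LinearOrder G] (S : Set G) (hS : S.IsPWO) (g : G) :
    (ofLex (hahnIndicator S hS)).coeff g = S.indicator 1 g := rfl

theorem support_hahnIndicator {G : Type*} [LinearOrder G] (S : Set G) (hS : S.IsPWO) :
    (ofLex (hahnIndicator S hS)).support ⊆ S := Set.support_indicator_subset

theorem hahnIndicator_lt {G : Type*} [LinearOrder G] {S T : Set G} (hS : S.IsPWO) (hT : T.IsPWO)
    {g : G} (hgS : g ∉ S) (hgT : g ∈ T) (h : ∀ j < g, j ∈ S ↔ j ∈ T) :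
    hahnIndicator S hS < hahnIndicator T hT := by
  classical
  rw [HahnSeries.lt_iff]
  refine ⟨g, fun j hj => ?_, ?_⟩
  · simp only [coeff_hahnIndicator, Set.indicator_apply, h j hj]
  · simp [coeff_hahnIndicator, hgS, hgT]

/-- There is no order embedding with convex image of a cofinal subset `P` of a chain `N` without
last element into the group of Hahn series with exponents in `N`. -/
theorem not_exists_convex_embedding {G : Type} [LinearOrder G] (N P : Set G)
    (hne : N.Nonempty) (hPN : P ⊆ N) (hcof : ∀ d ∈ N, ∃ g ∈ P, d < g)
    (f : G → Lex (HahnSeries G ℝ)) (hmono : StrictMonoOn f P)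
    (hsupp : ∀ g ∈ P, (ofLex (f g)).support ⊆ N)
    (hconv : ∀ g ∈ P, ∀ g' ∈ P, ∀ s : Lex (HahnSeries G ℝ), (ofLex s).support ⊆ N →
      f g ≤ s → s ≤ f g' → ∃ g'' ∈ P, f g'' = s) : False := by
  classical
  -- Let `d` be the exponent where `f g` and `f g'` first differ. A perturbation supported beyond
  -- `d` leaves the comparison unchanged, and `d` lies in `N` because both supports do.
  have step : ∀ g ∈ P, ∀ g' ∈ P, g < g' → ∃ d ∈ N, ∀ T : Lex (HahnSeries G ℝ),
      (∀ i ∈ (ofLex T).support, d < i) → f g + T < f g' := by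
    intro g hg g' hg' hlt
    obtain ⟨d, hd, hdlt⟩ := (HahnSeries.lt_iff _ _).1 (hmono hg hg' hlt)
    have hT : ∀ T : Lex (HahnSeries G ℝ), (∀ i ∈ (ofLex T).support, d < i) →
        ∀ j ≤ d, (ofLex T).coeff j = 0 := by
      intro T hT j hj
      by_contra h
      exact absurd (hT j h) (not_lt.2 hj)
    refine ⟨d, ?_, fun T h => (HahnSeries.lt_iff _ _).2 ⟨d, fun j hj => ?_, ?_⟩⟩
    · by_contra hdN
      have h1 : (ofLex (f g)).coeff d = 0 := by
        by_contra h; exact hdN (hsupp g hg h)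
      have h2 : (ofLex (f g')).coeff d = 0 := by
        by_contra h; exact hdN (hsupp g' hg' h)
      rw [h1, h2] at hdlt
      exact lt_irrefl _ hdlt
    · simp [hT T h j hj.le, hd j hj]
    · simpa [hT T h d le_rfl] using hdlt
  -- the two interleaved base sequences
  have step' : ∀ p : {p : G × G // p.1 ∈ P ∧ p.2 ∈ P ∧ p.1 < p.2},
      ∃ q : {p : G × G // p.1 ∈ P ∧ p.2 ∈ P ∧ p.1 < p.2}, ∀ T : Lex (HahnSeries G ℝ),
      (∀ i ∈ (ofLex T).support, q.1.1 ≤ i) → f p.1.1 + T < f p.1.2 := by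
    rintro ⟨⟨a, b⟩, ha, hb, hab⟩
    obtain ⟨d, hd, hT⟩ := step a ha b hb hab
    obtain ⟨a', ha', hda⟩ := hcof d hd
    obtain ⟨b', hb', hab'⟩ := hcof a' (hPN ha')
    exact ⟨⟨⟨a', b'⟩, ha', hb', hab'⟩, fun T h => hT T fun i hi => hda.trans_le (h i hi)⟩
  choose next hnext using step'
  obtain ⟨n0, hn0⟩ := hne
  obtain ⟨a0, ha0, -⟩ := hcof n0 hn0
  obtain ⟨b0, hb0, hab0⟩ := hcof a0 (hPN ha0)
  let p : ℕ → {p : G × G // p.1 ∈ P ∧ p.2 ∈ P ∧ p.1 < p.2} := fun n =>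
    next^[n] ⟨⟨a0, b0⟩, ha0, hb0, hab0⟩
  have hp : ∀ n, p (n + 1) = next (p n) := fun n => Function.iterate_succ_apply' _ _ _
  let base : ℕ → G := fun n => (p n).1.1
  have hbase : ∀ n, ∀ T : Lex (HahnSeries G ℝ),
      (∀ i ∈ (ofLex T).support, base (n + 1) ≤ i) → f (base n) + T < f (p n).1.2 := by
    intro n T hT
    exact hnext (p n) T (by simpa only [base, hp] using hT)
  -- the transfinite sequences
  let F : Ordinal.{0} → ℕ → G := WellFounded.fix (C := fun _ => ℕ → G) Ordinal.lt_wf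
    fun α rec n =>
      if h : ∃ g ∈ P, ∃ hS : (Set.range fun b : Set.Iio α => rec b.1 b.2 (n + 1)).IsPWO,
        f g = f (base n) + hahnIndicator _ hS then h.choose else base n
  let S : Ordinal.{0} → ℕ → Set G := fun α n => Set.range fun b : Set.Iio α => F b.1 n
  -- `F α n` is the point of `P` whose image is `f (base n)` plus the indicator of all `F β (n + 1)`
  -- with `β < α`. The recursion lowers the ordinal while raising `n`. The default value `base n` is
  -- never taken, as `key` below shows.
  have hF : ∀ α n, (∃ g ∈ P, ∃ hS : (S α (n + 1)).IsPWO,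
      f g = f (base n) + hahnIndicator _ hS) → F α n ∈ P ∧ ∃ hS : (S α (n + 1)).IsPWO,
      f (F α n) = f (base n) + hahnIndicator _ hS := by
    intro α n h
    have e : F α n = h.choose := by
      simp only [F]
      rw [WellFounded.fix_eq]
      exact dif_pos h
    rw [e]
    exact h.choose_spec
  have main : ∀ α : Ordinal.{0}, ∀ n, (F α n ∈ P ∧ base n ≤ F α n ∧
      ∃ hS : (S α (n + 1)).IsPWO, f (F α n) = f (base n) + hahnIndicator _ hS) ∧
      ∀ β < α, F β n < F α n := by
    intro α
    induction α using WellFoundedLT.induction with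
    | _ α ih =>
    have hPWO : ∀ n, (S α n).IsPWO := by
      intro n
      have hm : MonotoneOn (fun β => F β n) (Set.Iio α) := by
        intro β hβ γ hγ hβγ
        rcases hβγ.eq_or_lt with rfl | h
        · exact le_rfl
        · exact ((ih γ hγ n).2 β h).le
      have := (Set.IsWF.isPWO (s := Set.Iio α) (by exact Set.WellFoundedOn.subset (WellFounded.wellFoundedOn Ordinal.lt_wf) le_rfl)).image_of_monotoneOn hm
      refine this.mono ?_
      rintro _ ⟨b, rfl⟩
      exact ⟨b.1, b.2, rfl⟩
    have hbnd : ∀ n, ∀ i ∈ S α n, base n ≤ i ∧ i ∈ P := by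
      rintro n _ ⟨b, rfl⟩
      exact ⟨(ih b.1 b.2 n).1.2.1, (ih b.1 b.2 n).1.1⟩
    have key : ∀ n, F α n ∈ P ∧ ∃ hS : (S α (n + 1)).IsPWO,
        f (F α n) = f (base n) + hahnIndicator _ hS := by
      intro n
      apply hF
      -- The indicator is nonnegative and supported above `base (n + 1)`, so the target lies between
      -- two values of `f`; convexity then provides a preimage.
      have hlt := hbase n (hahnIndicator _ (hPWO (n + 1))) fun i hi =>
        (hbnd (n + 1) i (support_hahnIndicator _ _ hi)).1
      have hpos : 0 ≤ hahnIndicator _ (hPWO (n + 1)) := by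
        rw [← HahnSeries.leadingCoeff_nonneg_iff]
        by_cases h0 : ofLex (hahnIndicator _ (hPWO (n + 1))) = 0
        · simp [h0]
        · rw [HahnSeries.leadingCoeff_of_ne_zero h0, coeff_hahnIndicator]
          exact Set.indicator_nonneg (fun _ _ => zero_le_one) _
      obtain ⟨g, hg, hgs⟩ := hconv (base n) (p n).2.1 (p n).1.2 (p n).2.2.1
        (f (base n) + hahnIndicator _ (hPWO (n + 1))) (by
          intro i hi
          by_contra hiN
          apply hi
          have h1 : (ofLex (f (base n))).coeff i = 0 := by
            by_contra h; exact hiN (hsupp _ (p n).2.1 h)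
          have h2 : (ofLex (hahnIndicator _ (hPWO (n + 1)))).coeff i = 0 := by
            by_contra h
            exact hiN (hPN (hbnd (n + 1) i (support_hahnIndicator _ _ h)).2)
          simp [h1, h2]) (le_add_of_nonneg_right hpos) hlt.le
      exact ⟨g, hg, hPWO (n + 1), hgs⟩
    intro n
    obtain ⟨hFP, hS, hFe⟩ := key n
    have hmon : ∀ β < α, F β n < F α n := by
      intro β hβ
      obtain ⟨⟨hP', -, hS', he'⟩, -⟩ := ih β hβ n
      rw [← hmono.lt_iff_lt hP' hFP, hFe, he', add_lt_add_iff_left]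
      -- The indicator for `β` is an initial segment of the one for `α`, which next has the exponent
      -- `F β (n + 1)`, with coefficient 1.
      refine hahnIndicator_lt _ _ (g := F β (n + 1)) ?_ ⟨⟨β, hβ⟩, rfl⟩ ?_
      · rintro ⟨⟨γ, hγ⟩, hEq⟩
        exact absurd hEq ((ih β hβ (n + 1)).2 γ hγ).ne
      · rintro j hj
        constructor
        · rintro ⟨⟨γ, hγ⟩, rfl⟩
          exact ⟨⟨γ, lt_trans hγ hβ⟩, rfl⟩
        · rintro ⟨⟨γ, hγ⟩, rfl⟩
          refine ⟨⟨γ, ?_⟩, rfl⟩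
          by_contra hc
          rcases (not_lt.1 (show ¬ γ < β from hc)).eq_or_lt with h | h
          · subst h; exact lt_irrefl _ hj
          · exact lt_asymm hj ((ih γ hγ (n + 1)).2 β h)
    refine ⟨⟨hFP, ?_, hS, hFe⟩, hmon⟩
    by_contra hlt
    have h1 := hmono hFP (p n).2.1 (not_le.1 hlt)
    rw [hFe] at h1
    have hpos : 0 ≤ hahnIndicator _ hS := by
      rw [← HahnSeries.leadingCoeff_nonneg_iff]
      by_cases h0 : ofLex (hahnIndicator _ hS) = 0
      · simp [h0]
      · rw [HahnSeries.leadingCoeff_of_ne_zero h0, coeff_hahnIndicator]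
        exact Set.indicator_nonneg (fun _ _ => zero_le_one) _
    exact absurd h1 (not_lt.2 (le_add_of_nonneg_right hpos))
  refine not_injective_of_ordinal (fun α => F α 0) (StrictMono.injective ?_)
  intro β α h
  exact (main α 0).2 β h

/-! ### Peano Arithmetic: coded powers of two and overspill -/

section Realize

variable {N : Type*} [Zero N] [One N] [Add N] [Mul N] [LT N] {α : Type*}

@[simp]
theorem realize_arith_zero (v : α → N) : (0 : arith.Term α).realize v = 0 := rfl

@[simp]
theorem realize_arith_one (v : α → N) : (1 : arith.Term α).realize v = 1 := rfl

@[simp]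
theorem realize_arith_add (s t : arith.Term α) (v : α → N) :
    (s + t).realize v = s.realize v + t.realize v := rfl

@[simp]
theorem realize_arith_mul (s t : arith.Term α) (v : α → N) :
    (s * t).realize v = s.realize v * t.realize v := rfl

@[simp]
theorem realize_ltFormula {n : ℕ} (s t : arith.Term (α ⊕ Fin n)) (v : α → N) (xs : Fin n → N) :
    (ltFormula s t).Realize v xs ↔
      s.realize (Sum.elim v xs) < t.realize (Sum.elim v xs) := by
  rw [ltFormula, BoundedFormula.realize_rel₂]
  rfl

/-- Induction without parameters is the only consequence of the induction schema that the argument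
uses. -/
theorem induction_of_models_PA (hN : N ⊨ PA) (φ : arith.Formula (Fin 0 ⊕ Unit))
    (h0 : φ.Realize (Sum.elim Fin.elim0 fun _ => (0 : N)))
    (hs : ∀ x : N, φ.Realize (Sum.elim Fin.elim0 fun _ => x) →
      φ.Realize (Sum.elim Fin.elim0 fun _ => x + 1)) (x : N) :
    φ.Realize (Sum.elim Fin.elim0 fun _ => x) := by
  have h := hN.realize_of_mem (inductionAxiom φ) (Or.inr ⟨0, φ, rfl⟩)
  rw [inductionAxiom, Sentence.Realize, Formula.realize_iAlls] at h
  have h1 := h Fin.elim0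
  rw [Formula.realize_relabel, Formula.Realize, BoundedFormula.realize_imp,
    BoundedFormula.realize_imp, BoundedFormula.realize_subst, ← Formula.Realize,
    ← Formula.Realize, Formula.realize_iAlls, ← Formula.Realize, Formula.realize_iAlls] at h1
  have e : ∀ (w : Fin 0 → N) (y : N), (fun a => Sum.elim w (fun _ : Unit => y) a) =
      Sum.elim Fin.elim0 fun _ => y := by
    intro w y
    ext (i | i)
    · exact i.elim0
    · rfl
  have h2 := h1 (by
    convert h0 using 1
    ext (i | i)
    · exact i.elim0
    · rfl) (by
    intro i
    obtain ⟨y, rfl⟩ : ∃ y, i = fun _ => y := ⟨i (), rfl⟩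
    rw [e, Formula.Realize, BoundedFormula.realize_imp, BoundedFormula.realize_subst]
    refine fun hi => cast (congrArg (fun w => BoundedFormula.Realize φ w default) ?_) (hs y hi)
    ext (i | i)
    · exact i.elim0
    · rfl) (fun _ => x)
  rwa [e] at h2

end Realize

/-- The formula "`y` is the remainder of `a` modulo `1 + (i + 1) * b`". -/
def betaFormula {α : Type*} {n : ℕ} (a b i y : arith.Term (α ⊕ Fin n)) :
    arith.BoundedFormula α n :=
  let lift : arith.Term (α ⊕ Fin n) → arith.Term (α ⊕ Fin (n + 1)) :=
    Term.relabel (Sum.map id Fin.castSucc)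
  ltFormula y (1 + (i + 1) * b) ⊓ ∃' (lift a =' (&(Fin.last n) * lift (1 + (i + 1) * b) + lift y))

/-- `y` is the remainder of `a` modulo `1 + (i + 1) * b`. -/
def Beta {N : Type*} [One N] [Add N] [Mul N] [LT N] (a b i y : N) : Prop :=
  y < 1 + (i + 1) * b ∧ ∃ q, a = q * (1 + (i + 1) * b) + y

theorem realize_betaFormula {N : Type*} [Zero N] [One N] [Add N] [Mul N] [LT N] {α : Type*} {n : ℕ}
    (a b i y : arith.Term (α ⊕ Fin n)) (v : α → N) (xs : Fin n → N) :
    (betaFormula a b i y).Realize v xs ↔ Beta (a.realize (Sum.elim v xs))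
      (b.realize (Sum.elim v xs)) (i.realize (Sum.elim v xs)) (y.realize (Sum.elim v xs)) := by
  have e : ∀ x : N, (Sum.elim v (Fin.snoc xs x) : α ⊕ Fin (n + 1) → N) ∘ Sum.map id Fin.castSucc =
      Sum.elim v xs := by
    intro x
    ext (i | i) <;> simp
  simp only [betaFormula, BoundedFormula.realize_inf, BoundedFormula.realize_ex,
    BoundedFormula.realize_bdEqual, realize_ltFormula, Term.realize_relabel, e,
    realize_arith_add, realize_arith_mul, realize_arith_one, Beta]
  simp

/-- The code `(a, b)` codes the powers of two with exponents at most `n`. -/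
def CodesPowers {N : Type*} [Zero N] [One N] [Add N] [Mul N] [LT N] (n a b : N) : Prop :=
  Beta a b 0 1 ∧
  (∀ i y, i < n → Beta a b i y → Beta a b (i + 1) (y + y)) ∧
  (∀ i j y z, i < j → j < n + 1 → Beta a b i y → Beta a b j z → y < z) ∧
  (∀ x y, Beta a b n y → x < y → 0 < x → ∃ i z, i < n ∧ Beta a b i z ∧ z < x + 1 ∧ x < z + z)

/-- The formula defining `{n | ∃ a b, CodesPowers n a b}`. -/
def codesPowersFormula : arith.Formula (Fin 0 ⊕ Unit) :=
  ∃' ∃' ((betaFormula (&0) (&1) 0 1) ⊓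
    ((∀' ∀' ((ltFormula (&2) (Term.var (Sum.inl (Sum.inr ())))) ⟹ (betaFormula (&0) (&1) (&2) (&3)) ⟹
      (betaFormula (&0) (&1) (&2 + 1) (&3 + &3)))) ⊓
    ((∀' ∀' ∀' ∀' ((ltFormula (&2) (&3)) ⟹
      (ltFormula (&3) (Term.var (Sum.inl (Sum.inr ())) + 1)) ⟹
      (betaFormula (&0) (&1) (&2) (&4)) ⟹ (betaFormula (&0) (&1) (&3) (&5)) ⟹
      (ltFormula (&4) (&5)))) ⊓
    (∀' ∀' ((betaFormula (&0) (&1) (Term.var (Sum.inl (Sum.inr ()))) (&3)) ⟹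
      (ltFormula (&2) (&3)) ⟹ (ltFormula 0 (&2)) ⟹
      ∃' ∃' ((ltFormula (&4) (Term.var (Sum.inl (Sum.inr ())))) ⊓
        ((betaFormula (&0) (&1) (&4) (&5)) ⊓
        ((ltFormula (&5) (&2 + 1)) ⊓ (ltFormula (&2) (&5 + &5))))))))))

theorem realize_codesPowersFormula {N : Type*} [Zero N] [One N] [Add N] [Mul N] [LT N] (n : N) :
    codesPowersFormula.Realize (Sum.elim Fin.elim0 fun _ => n) ↔ ∃ a b, CodesPowers n a b := by
  simp only [codesPowersFormula, Formula.Realize, BoundedFormula.realize_ex,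
    BoundedFormula.realize_inf, BoundedFormula.realize_all, BoundedFormula.realize_imp,
    realize_betaFormula, realize_ltFormula, realize_arith_add, realize_arith_one,
    realize_arith_zero, Term.realize_var, Sum.elim_inl, Sum.elim_inr]
  rfl

section Discrete

variable {N : Type*} [CommSemiring N] [LinearOrder N] [IsStrictOrderedRing N]

theorem exists_natCast_eq_of_le (h0 : ∀ x : N, 0 ≤ x) (hd : ∀ x y : N, x < y + 1 → x ≤ y)
    {x : N} {n : ℕ} (h : x ≤ n) : ∃ k : ℕ, x = k := by
  induction n with
  | zero => exact ⟨0, le_antisymm h (by simpa using h0 x)⟩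
  | succ n ih =>
    rcases h.eq_or_lt with h | h
    · exact ⟨_, h⟩
    · exact ih (hd _ _ (by simpa using h))

/-- The quotient and the remainder are both at most `a`, hence standard, so division with remainder
takes place in ℕ. -/
theorem beta_natCast (h0 : ∀ x : N, 0 ≤ x) (hd : ∀ x y : N, x < y + 1 → x ≤ y) (a b i : ℕ)
    (y : N) : Beta (a : N) b i y ↔ y = ((a % (1 + (i + 1) * b) : ℕ) : N) := by
  constructor
  · rintro ⟨hy, q, hq⟩
    have hd1 : (1 : N) ≤ 1 + (i + 1) * b :=
      le_add_of_nonneg_right (h0 _)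
    have hya : y ≤ a := by rw [hq]; exact le_add_of_nonneg_left (h0 _)
    have hqa : q ≤ a := by
      rw [hq]
      exact (le_mul_of_one_le_right (h0 _) hd1).trans (le_add_of_nonneg_right (h0 _))
    obtain ⟨y, rfl⟩ := exists_natCast_eq_of_le h0 hd hya
    obtain ⟨q, rfl⟩ := exists_natCast_eq_of_le h0 hd hqa
    norm_cast at hy hq ⊢
    rw [hq, Nat.mul_add_mod_of_lt hy]
  · rintro rfl
    refine ⟨?_, ((a / (1 + (i + 1) * b) : ℕ) : N), ?_⟩
    · norm_cast
      exact Nat.mod_lt _ (by positivity)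
    · norm_cast
      rw [mul_comm, Nat.div_add_mod]

/-- Gödel's β lemma in ℕ codes the list 1, 2, …, 2^n. Since monotonicity and the existence of
integer logarithms are clauses of `CodesPowers`, they need checking only here, for standard `n`;
overspill carries them to an infinite exponent without any development of exponentiation inside PA.
-/
theorem exists_codesPowers_natCast (h0 : ∀ x : N, 0 ≤ x) (hd : ∀ x y : N, x < y + 1 → x ≤ y)
    (n : ℕ) : ∃ a b : N, CodesPowers (n : N) a b := by
  set l : List ℕ := (List.range (n + 1)).map fun i => 2 ^ i with hl
  have hlen : l.length = n + 1 := by simp [hl]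
  set a := (Nat.unbeta l).unpair.1
  set b := (Nat.unbeta l).unpair.2
  have hB : ∀ i ≤ n, ∀ y : N, Beta (a : N) b (i : ℕ) y ↔ y = ((2 ^ i : ℕ) : N) := by
    intro i hi y
    rw [beta_natCast h0 hd]
    have := Nat.beta_unbeta_coe l ⟨i, by omega⟩
    rw [Nat.beta] at this
    rw [add_comm 1, this]
    simp [hl]
  refine ⟨a, b, ?_, ?_, ?_, ?_⟩
  · have := (hB 0 (Nat.zero_le _) 1).2 (by simp)
    simpa using this
  · intro i y hi hy
    obtain ⟨i, rfl⟩ := exists_natCast_eq_of_le h0 hd hi.le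
    have hi' : i < n := by exact_mod_cast hi
    rw [hB i hi'.le] at hy
    have := (hB (i + 1) hi' (y + y)).2 (by rw [hy]; push_cast; ring)
    simpa using this
  · intro i j y z hij hj hy hz
    obtain ⟨j, rfl⟩ := exists_natCast_eq_of_le h0 hd (hd _ _ hj)
    obtain ⟨i, rfl⟩ := exists_natCast_eq_of_le h0 hd hij.le
    have hij' : i < j := by exact_mod_cast hij
    have hj' : j < n + 1 := by exact_mod_cast hj
    rw [hB i (by omega)] at hy
    rw [hB j (by omega)] at hz
    rw [hy, hz]
    exact_mod_cast Nat.pow_lt_pow_right one_lt_two hij'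
  · intro x y hy hx hx0
    rw [hB n le_rfl] at hy
    rw [hy] at hx
    obtain ⟨x, rfl⟩ := exists_natCast_eq_of_le h0 hd hx.le
    have hx' : x < 2 ^ n := by exact_mod_cast hx
    have hx0' : x ≠ 0 := by
      rintro rfl; simp at hx0
    have h1 := Nat.pow_log_le_self 2 hx0'
    have h2 := Nat.lt_pow_succ_log_self one_lt_two x
    have hlt : Nat.log 2 x < n := by
      rw [← Nat.pow_lt_pow_iff_right (a := 2) one_lt_two]
      exact h1.trans_lt hx'
    refine ⟨(Nat.log 2 x : ℕ), ((2 ^ Nat.log 2 x : ℕ) : N), by exact_mod_cast hlt,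
      (hB _ hlt.le _).2 rfl, ?_, ?_⟩
    · exact_mod_cast Nat.lt_succ_of_le h1
    · rw [pow_succ] at h2
      exact_mod_cast (by omega : x < 2 ^ Nat.log 2 x + 2 ^ Nat.log 2 x)

/-- Overspill: the powers of two are coded up to some infinite exponent. -/
theorem exists_codesPowers_infinite (hPA : N ⊨ PA) (h0 : ∀ x : N, 0 ≤ x)
    (hd : ∀ x y : N, x < y + 1 → x ≤ y) (hinf : ∃ x : N, ∀ k : ℕ, (k : N) < x) :
    ∃ n : N, (∀ k : ℕ, (k : N) < n) ∧ ∃ a b, CodesPowers n a b := by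
  by_contra hcon
  push Not at hcon
  obtain ⟨x, hx⟩ := hinf
  have h := induction_of_models_PA hPA codesPowersFormula
  simp only [realize_codesPowersFormula] at h
  obtain ⟨a, b, hab⟩ := h (by simpa using exists_codesPowers_natCast h0 hd 0) (by
    rintro y ⟨a, b, hab⟩
    obtain ⟨k, hk⟩ : ∃ k : ℕ, y ≤ k := by
      by_contra hc
      push Not at hc
      exact hcon y hc a b hab
    obtain ⟨k, rfl⟩ := exists_natCast_eq_of_le h0 hd hk
    simpa using exists_codesPowers_natCast h0 hd (k + 1)) x
  exact hcon x hx a b hab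

end Discrete

/-! ### Powers of two in an integer part -/

section IntegerPart

variable {K : Type*} [Field K] [LinearOrder K] [IsStrictOrderedRing K] {M : Subring K}

theorem IsIntegerPart.add_one_le (hM : IsIntegerPart M) {x y : K} (hx : x ∈ M) (hy : y ∈ M)
    (h : x < y) : x + 1 ≤ y := by
  by_contra hc
  exact hM.discrete ⟨y - x, M.sub_mem hy hx, by linarith, by linarith⟩

theorem IsIntegerPart.exists_floor (hM : IsIntegerPart M) (x : K) :
    ∃ m ∈ M, m ≤ x ∧ x < m + 1 := by
  obtain ⟨m, hm, h1, h2⟩ := hM.exists_near (-x)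
  exact ⟨-m, M.neg_mem hm, by linarith, by linarith⟩

theorem IsIntegerPart.beta_unique (hM : IsIntegerPart M) {a b i y z : {m : M // 0 ≤ m}}
    (hy : Beta a b i y) (hz : Beta a b i z) : y = z := by
  obtain ⟨hy, q, hq⟩ := hy
  obtain ⟨hz, r, hr⟩ := hz
  set d := 1 + (i + 1) * b
  have hd0 : (0 : K) < ((d : M) : K) :=
    lt_of_le_of_lt (show (0 : K) ≤ ((y : M) : K) from y.2) hy
  have hy' : ((y : M) : K) < ((d : M) : K) := hy
  have hz' : ((z : M) : K) < ((d : M) : K) := hz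
  have hy0 : (0 : K) ≤ ((y : M) : K) := y.2
  have hz0 : (0 : K) ≤ ((z : M) : K) := z.2
  have h2 : ((a : M) : K) = ((q : M) : K) * ((d : M) : K) + ((y : M) : K) := by
    rw [hq]; push_cast; rfl
  have h3 : ((a : M) : K) = ((r : M) : K) * ((d : M) : K) + ((z : M) : K) := by
    rw [hr]; push_cast; rfl
  have h4 : q = r := by
    rcases lt_trichotomy q r with h | h | h
    · have h1 : ((q : M) : K) + 1 ≤ ((r : M) : K) := hM.add_one_le q.1.2 r.1.2 h
      nlinarith [mul_le_mul_of_nonneg_right h1 hd0.le]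
    · exact h
    · have h1 : ((r : M) : K) + 1 ≤ ((q : M) : K) := hM.add_one_le r.1.2 q.1.2 h
      nlinarith [mul_le_mul_of_nonneg_right h1 hd0.le]
  subst h4
  exact Subtype.ext (Subtype.ext (by linarith))

/-- Division with remainder comes from the integer part itself: the quotient is the floor of `a / d`
taken in `K`. -/
theorem IsIntegerPart.exists_beta (hM : IsIntegerPart M) (a b i : {m : M // 0 ≤ m}) :
    ∃ y, Beta a b i y := by
  set d := 1 + (i + 1) * b with hd
  have hd0 : (0 : K) < ((d : M) : K) := by
    have hi : (0 : K) ≤ ((i : M) : K) := i.2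
    have hb : (0 : K) ≤ ((b : M) : K) := b.2
    have : ((d : M) : K) = 1 + (((i : M) : K) + 1) * ((b : M) : K) := by rw [hd]; push_cast; rfl
    rw [this]
    positivity
  have ha : (0 : K) ≤ ((a : M) : K) := a.2
  obtain ⟨q, hq, h1, h2⟩ := hM.exists_floor (((a : M) : K) / ((d : M) : K))
  rw [le_div_iff₀ hd0] at h1
  rw [div_lt_iff₀ hd0] at h2
  have hq0 : 0 ≤ q := by
    by_contra hc
    have := hM.add_one_le hq M.zero_mem (not_le.1 hc)
    nlinarith
  refine ⟨⟨⟨((a : M) : K) - q * ((d : M) : K), M.sub_mem a.1.2 (M.mul_mem hq d.1.2)⟩,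
    sub_nonneg.2 h1⟩, ?_, ⟨⟨q, hq⟩, hq0⟩, ?_⟩
  · change ((a : M) : K) - q * ((d : M) : K) < ((d : M) : K)
    linarith
  · apply Subtype.ext
    apply Subtype.ext
    change ((a : M) : K) = q * ((d : M) : K) + (((a : M) : K) - q * ((d : M) : K))
    ring

/-- Each exponent has a unique β value, so the code obtained by overspill becomes a function `E`. It
is extended by 0 off the nonnegative part of `M`, where nothing is claimed. The last clause concerns
arbitrary `x` in `K`, not only elements of `M`. -/
theorem exists_powers_of_modelsPA (hM : IsIntegerPart M) (hPA : ModelsPA M)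
    (hinf : ∃ x : K, ∀ k : ℕ, (k : K) < x) :
    ∃ (n : K) (E : K → K), n ∈ M ∧ (∀ k : ℕ, (k : K) < n) ∧ E 0 = 1 ∧
      (∀ i ∈ M, 0 ≤ i → i < n → E (i + 1) = 2 * E i) ∧
      (∀ i ∈ M, ∀ j ∈ M, 0 ≤ i → i < j → j ≤ n → E i < E j) ∧
      ∀ x, 1 ≤ x → x < E n → ∃ i ∈ M, 0 ≤ i ∧ i < n ∧ E i ≤ x ∧ x < 2 * E i := by
  classical
  obtain ⟨n, hn, a, b, hB1, hB2, hB3, hB4⟩ :=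
    exists_codesPowers_infinite (N := {m : M // 0 ≤ m}) hPA (fun x => x.2) (by
      intro x y h
      by_contra hc
      have := hM.add_one_le y.1.2 x.1.2 (not_le.1 hc)
      exact absurd h (not_lt.2 this)) (by
      obtain ⟨x, hx⟩ := hinf
      obtain ⟨m, hm, h1, h2⟩ := hM.exists_near x
      have h0 : 0 < m := by simpa using (hx 0).trans_le h1
      exact ⟨⟨⟨m, hm⟩, h0.le⟩, fun k => show ((k : M) : K) < m from
        by simpa using (hx k).trans_le h1⟩)
  choose B hB using hM.exists_beta a b
  have hBu : ∀ {i y}, Beta a b i y → B i = y := fun h => hM.beta_unique (hB _) h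
  let E : K → K := fun x => if h : ∃ hx : x ∈ M, 0 ≤ (⟨x, hx⟩ : M) then
    ((B ⟨⟨x, h.1⟩, h.2⟩ : M) : K) else 0
  have hE : ∀ i : {m : M // 0 ≤ m}, E ((i : M) : K) = ((B i : M) : K) := by
    rintro ⟨⟨x, hx⟩, h0⟩
    exact dif_pos ⟨hx, h0⟩
  refine ⟨((n : M) : K), E, n.1.2, ?_, ?_, ?_, ?_, ?_⟩
  · intro k
    have : (((k : {m : M // 0 ≤ m}) : M) : K) < ((n : M) : K) := hn k
    simpa using this
  · have := hE 0
    rw [hBu hB1] at this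
    exact this
  · intro i hi hi0 hin
    have h := hE (⟨⟨i, hi⟩, hi0⟩ + 1)
    have h' := hE ⟨⟨i, hi⟩, hi0⟩
    rw [hBu (hB2 ⟨⟨i, hi⟩, hi0⟩ _ hin (hB _))] at h
    change E (i + 1) = _ + _ at h
    change E i = _ at h'
    rw [h, ← h', two_mul]
  · intro i hi j hj hi0 hij hjn
    have h := hE ⟨⟨i, hi⟩, hi0⟩
    have h' := hE ⟨⟨j, hj⟩, hi0.trans hij.le⟩
    have := hB3 ⟨⟨i, hi⟩, hi0⟩ ⟨⟨j, hj⟩, hi0.trans hij.le⟩ _ _ hij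
      (show j < ((n : M) : K) + 1 by linarith) (hB _) (hB _)
    rw [show E i = _ from h, show E j = _ from h']
    exact this
  · intro x hx hxn
    -- The code speaks only about elements of `M`, so `x` is replaced by its floor `m`. Discreteness
    -- turns `m < z + z` into `m + 1 ≤ z + z`, which bounds `x` again.
    obtain ⟨m, hm, h1, h2⟩ := hM.exists_floor x
    have hm0 : 0 < m := by
      by_contra hc
      have := hM.add_one_le hm M.one_mem (by linarith)
      linarith
    have hlt : (⟨⟨m, hm⟩, hm0.le⟩ : {m : M // 0 ≤ m}) < B n := by
      change m < ((B n : M) : K)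
      rw [← hE]
      linarith
    obtain ⟨i, z, hin, hz, h3, h4⟩ := hB4 ⟨⟨m, hm⟩, hm0.le⟩ _ (hB n) hlt hm0
    have h3' : ((z : M) : K) < m + 1 := h3
    have h4' : m < ((z : M) : K) + ((z : M) : K) := h4
    have h5 := hM.add_one_le hm (M.add_mem z.1.2 z.1.2) h4'
    have h6 : ((z : M) : K) ≤ m := by
      by_contra hc
      have := hM.add_one_le hm z.1.2 (not_le.1 hc)
      linarith
    refine ⟨((i : M) : K), i.1.2, i.2, hin, ?_, ?_⟩ <;> rw [hE, hBu hz] <;> linarith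

end IntegerPart
-- Archimedean classes and negative parts of Hahn series
section HahnOrder

variable {G : Type*} [AddCommGroup G] [LinearOrder G] [IsOrderedAddMonoid G]

/-- Real coefficients are archimedean, so the archimedean class of a series depends only on its
least exponent. -/
theorem hahn_orderTop_le_iff (x y : Lex (HahnSeries G ℝ)) :
    (ofLex x).orderTop ≤ (ofLex y).orderTop ↔ ∃ n : ℕ, |y| ≤ n * |x| := by
  have h := archimedeanClassMk_le_archimedeanClassMk_iff (x := x) (y := y)
  rw [ArchimedeanClass.mk_le_mk] at h
  simp only [nsmul_eq_mul] at h
  rw [h, le_iff_lt_or_eq]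
  refine or_congr_right ⟨fun h => ⟨h, ?_⟩, fun h => h.1⟩
  by_cases hx : ofLex x = 0
  · have : ofLex y = 0 := by rwa [hx, orderTop_zero, eq_comm, orderTop_eq_top] at h
    rw [hx, this]
  · have hy : ofLex y ≠ 0 := by
      rintro hy; rw [hy, orderTop_zero, orderTop_eq_top] at h; exact hx h
    exact (ArchimedeanClass.mk_eq_mk_of_archimedean (leadingCoeff_ne_zero.2 hx)
      (leadingCoeff_ne_zero.2 hy)).le

theorem hahn_orderTop_lt_iff (x y : Lex (HahnSeries G ℝ)) :
    (ofLex x).orderTop < (ofLex y).orderTop ↔ ∀ n : ℕ, n * |y| < |x| := by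
  rw [← not_le, hahn_orderTop_le_iff]
  push Not
  rfl

theorem hahn_orderTop_one : (ofLex (1 : Lex (HahnSeries G ℝ))).orderTop = 0 :=
  HahnSeries.orderTop_one

theorem hahn_single_pos (g : G) {r : ℝ} (hr : 0 < r) :
    0 < (toLex (single g r) : Lex (HahnSeries G ℝ)) := by
  rw [← leadingCoeff_pos_iff]
  simpa using hr

/-- The part of a Hahn series with negative exponents. -/
noncomputable def negPart (x : Lex (HahnSeries G ℝ)) : Lex (HahnSeries G ℝ) :=
  toLex (truncLT 0 (ofLex x))

theorem coeff_negPart (x : Lex (HahnSeries G ℝ)) (i : G) :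
    (ofLex (negPart x)).coeff i = if i < 0 then (ofLex x).coeff i else 0 := rfl

theorem support_negPart (x : Lex (HahnSeries G ℝ)) : (ofLex (negPart x)).support ⊆ Set.Iio 0 := by
  intro i hi
  by_contra hc
  exact hi (by rw [coeff_negPart, if_neg (show ¬ i < 0 from hc)])

theorem negPart_eq_self {x : Lex (HahnSeries G ℝ)} (h : (ofLex x).support ⊆ Set.Iio 0) :
    negPart x = x := by
  apply ofLex.injective
  ext i
  rw [coeff_negPart]
  split_ifs with hi
  · rfl
  · by_contra hc
    exact hi (h (Ne.symm hc))

/-- A series is bounded by a natural number exactly when it has no negative exponents. Negative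
parts thus represent the classes modulo finite elements. -/
theorem negPart_eq_iff (x y : Lex (HahnSeries G ℝ)) :
    negPart x = negPart y ↔ ∃ n : ℕ, |x - y| ≤ n := by
  have h := hahn_orderTop_le_iff (1 : Lex (HahnSeries G ℝ)) (x - y)
  simp only [abs_one, mul_one] at h
  rw [← h, hahn_orderTop_one, ofLex_sub, le_orderTop_iff_forall]
  constructor
  · intro he i hi
    have hi' : i < 0 := by exact_mod_cast hi
    have := congrArg (fun z => (ofLex z).coeff i) he
    simp only [coeff_negPart, if_pos hi'] at this
    simp [this]
  · intro he
    apply ofLex.injective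
    ext i
    rw [coeff_negPart, coeff_negPart]
    split_ifs with hi
    · have := he i (by exact_mod_cast hi)
      rw [HahnSeries.coeff_sub] at this
      linarith
    · rfl

theorem lt_of_negPart_lt {x y : Lex (HahnSeries G ℝ)} (h : negPart x < negPart y) : x < y := by
  rw [HahnSeries.lt_iff] at h ⊢
  obtain ⟨i, h1, h2⟩ := h
  have hi : i < 0 := by
    by_contra hc
    rw [coeff_negPart, coeff_negPart, if_neg hc, if_neg hc] at h2
    exact lt_irrefl _ h2
  refine ⟨i, fun j hj => ?_, ?_⟩
  · have := h1 j hj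
    rwa [coeff_negPart, coeff_negPart, if_pos (hj.trans hi), if_pos (hj.trans hi)] at this
  · rwa [coeff_negPart, coeff_negPart, if_pos hi, if_pos hi] at h2

theorem negPart_le_iff (x y : Lex (HahnSeries G ℝ)) :
    negPart x ≤ negPart y ↔ ∃ k : ℕ, x ≤ y + k := by
  constructor
  · intro h
    rcases h.lt_or_eq with h | h
    · exact ⟨0, by simpa using (lt_of_negPart_lt h).le⟩
    · obtain ⟨n, hn⟩ := (negPart_eq_iff _ _).1 h
      exact ⟨n, by linarith [le_abs_self (x - y)]⟩
  · rintro ⟨k, hk⟩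
    have : negPart (y + (k : Lex (HahnSeries G ℝ))) = negPart y := (negPart_eq_iff _ _).2 ⟨k, by simp⟩
    rw [← this]
    by_contra hc
    exact absurd (lt_of_negPart_lt (not_le.1 hc)) (not_lt.2 hk)

end HahnOrder

/-! ### Integer parts of Hahn fields do not model PA -/

theorem IsIntegerPart.exists_natCast {K : Type*} [Field K] [LinearOrder K] [IsStrictOrderedRing K]
    {M : Subring K} (hM : IsIntegerPart M) {x : K} (hx : x ∈ M) (h0 : 0 ≤ x) {n : ℕ} (h : x ≤ n) :
    ∃ k : ℕ, x = k := by
  induction n with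
  | zero => exact ⟨0, le_antisymm h (by simpa using h0)⟩
  | succ n ih =>
    rcases h.eq_or_lt with h | h
    · exact ⟨_, h⟩
    · refine ih ?_
      have := hM.add_one_le hx (natCast_mem M (n + 1)) h
      push_cast at this
      linarith

/-- No integer part of a Hahn field with a nontrivial densely ordered group of exponents is a model
of Peano Arithmetic. -/
theorem not_modelsPA_of_isIntegerPart {G : Type} [AddCommGroup G] [LinearOrder G]
    [IsOrderedAddMonoid G] [Nontrivial G] [DenselyOrdered G] (M : Subring (Lex (HahnSeries G ℝ)))
    (hM : IsIntegerPart M) : ¬ ModelsPA M := by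
  intro hPA
  obtain ⟨g0, hg0⟩ := exists_lt (0 : G)
  have ht : ∀ g : G, (ofLex (toLex (single g (1 : ℝ)))).orderTop = g := fun g =>
    orderTop_single one_ne_zero
  have htpos : ∀ g : G, 0 < (toLex (single g (1 : ℝ)) : Lex (HahnSeries G ℝ)) := fun g =>
    hahn_single_pos g one_pos
  obtain ⟨n, E, hnM, hn, hE0, hE1, hE2, hE3⟩ := exists_powers_of_modelsPA hM hPA
    ⟨toLex (single g0 1), by
      have := (hahn_orderTop_lt_iff (toLex (single g0 (1 : ℝ))) 1).1 (by
        rw [ht, hahn_orderTop_one]; exact_mod_cast hg0)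
      simpa [abs_of_pos (htpos g0)] using this⟩
  have hn0 : 0 ≤ n := by simpa using (hn 0).le
  have hEmono : ∀ i ∈ M, ∀ j ∈ M, 0 ≤ i → i ≤ j → j ≤ n → E i ≤ E j := by
    intro i hi j hj h0 hij hjn
    rcases hij.eq_or_lt with rfl | h
    · exact le_rfl
    · exact (hE2 i hi j hj h0 h hjn).le
  have hEpos : ∀ i ∈ M, 0 ≤ i → i ≤ n → 0 < E i := fun i hi h0 hin =>
    lt_of_lt_of_le one_pos (hE0 ▸ hEmono 0 M.zero_mem i hi le_rfl h0 hin)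
  have hEpow : ∀ k : ℕ, ∀ i ∈ M, 0 ≤ i → i + k ≤ n → E (i + k) = 2 ^ k * E i := by
    intro k
    induction k with
    | zero => intro i _ _ _; simp
    | succ k ih =>
      intro i hi h0 hin
      push_cast at hin ⊢
      have hk : (0 : Lex (HahnSeries G ℝ)) ≤ k := Nat.cast_nonneg k
      rw [← add_assoc, hE1 _ (M.add_mem hi (natCast_mem M k)) (by linarith) (by linarith),
        ih i hi h0 (by linarith), pow_succ]
      ring
  -- If `i` exceeds `j` by every natural number, then `E i` exceeds every 2^N · `E j`. If `i - j` is
  -- finite and nonnegative, discreteness makes it a natural number k and `E i` = 2^k · `E j`. The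
  -- class of a power therefore encodes the negative part of its exponent.
  have hD : ∀ i ∈ M, ∀ j ∈ M, 0 ≤ i → i ≤ n → 0 ≤ j → j ≤ n →
      ((ofLex (E j)).orderTop ≤ (ofLex (E i)).orderTop ↔ negPart i ≤ negPart j) := by
    intro i hi j hj hi0 hin hj0 hjn
    rw [negPart_le_iff]
    constructor
    · contrapose!
      intro h
      rw [hahn_orderTop_lt_iff]
      intro N
      rw [abs_of_pos (hEpos i hi hi0 hin), abs_of_pos (hEpos j hj hj0 hjn)]
      have h1 := hE2 (j + N) (M.add_mem hj (natCast_mem M N)) i hi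
        (add_nonneg hj0 (Nat.cast_nonneg N)) (h N) hin
      rw [hEpow N j hj hj0 ((h N).le.trans hin)] at h1
      refine lt_of_le_of_lt (mul_le_mul_of_nonneg_right ?_ (hEpos j hj hj0 hjn).le) h1
      exact_mod_cast Nat.lt_two_pow_self.le
    · rintro ⟨k, hk⟩
      rw [hahn_orderTop_le_iff, abs_of_pos (hEpos i hi hi0 hin), abs_of_pos (hEpos j hj hj0 hjn)]
      rcases le_total i j with h | h
      · exact ⟨1, by simpa using hEmono i hi j hj hi0 h hjn⟩
      · obtain ⟨k', hk'⟩ := hM.exists_natCast (M.sub_mem hi hj) (sub_nonneg.2 h)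
          (show i - j ≤ k by linarith)
        obtain rfl : i = j + k' := by rw [← hk']; ring
        exact ⟨2 ^ k', by rw [hEpow k' j hj hj0 hin]; push_cast; exact le_rfl⟩
  have hEne : ∀ i ∈ M, 0 ≤ i → i ≤ n → ∃ g : G, (ofLex (E i)).orderTop = g := by
    intro i hi h0 hin
    have : (ofLex (E i)).orderTop ≠ ⊤ := orderTop_ne_top.2 (hEpos i hi h0 hin).ne'
    exact ⟨_, (WithTop.coe_untop _ this).symm⟩
  obtain ⟨gs, hgs⟩ := hEne n hnM hn0 le_rfl
  have h0n : negPart (0 : Lex (HahnSeries G ℝ)) < negPart n := by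
    by_contra hc
    obtain ⟨k, hk⟩ := (negPart_le_iff _ _).1 (not_lt.1 hc)
    have := hn k
    simp only [zero_add] at hk
    exact absurd hk (not_le.2 this)
  have hgs0 : gs < 0 := by
    have := (lt_iff_lt_of_le_iff_le (hD 0 M.zero_mem n hnM le_rfl hn0 hn0 le_rfl))
    have h1 : (ofLex (E n)).orderTop < (ofLex (E 0)).orderTop := by
      by_contra hc
      exact absurd ((hD n hnM 0 M.zero_mem hn0 le_rfl le_rfl hn0).1 (not_lt.1 hc)) (not_le.2 h0n)
    rw [hgs, hE0, hahn_orderTop_one] at h1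
    exact_mod_cast h1
  -- The monomial t^g lies between 1 and `E n`, so it has an integer logarithm: a power `E i` within
  -- a factor of two, hence of order `g`.
  have hlog : ∀ g ∈ Set.Ioo gs 0, ∃ i ∈ M, 0 ≤ i ∧ i ≤ n ∧ (ofLex (E i)).orderTop = g := by
    rintro g ⟨h1, h2⟩
    have h3 := (hahn_orderTop_lt_iff (toLex (single g (1 : ℝ))) 1).1 (by
      rw [ht, hahn_orderTop_one]; exact_mod_cast h2) 1
    have h4 := (hahn_orderTop_lt_iff (E n) (toLex (single g (1 : ℝ)))).1 (by
      rw [ht, hgs]; exact_mod_cast h1) 1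
    rw [abs_of_pos (htpos g)] at h3 h4
    rw [abs_of_pos (hEpos n hnM hn0 le_rfl)] at h4
    simp only [Nat.cast_one, one_mul, abs_one] at h3 h4
    obtain ⟨i, hi, hi0, hin, h5, h6⟩ := hE3 _ h3.le h4
    refine ⟨i, hi, hi0, hin.le, ?_⟩
    rw [← ht g]
    apply le_antisymm <;>
      rw [hahn_orderTop_le_iff, abs_of_pos (hEpos i hi hi0 hin.le), abs_of_pos (htpos g)]
    · exact ⟨2, by exact_mod_cast h6.le⟩
    · exact ⟨1, by simpa using h5⟩
  choose! l hlM hl0 hln hlg using hlog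
  have hlt : ∀ g ∈ Set.Ioo gs 0, ∀ g' ∈ Set.Ioo gs 0, g < g' → negPart (l g') < negPart (l g) := by
    intro g hg g' hg' h
    by_contra hc
    have := (hD _ (hlM g hg) _ (hlM g' hg') (hl0 g hg) (hln g hg) (hl0 g' hg') (hln g' hg')).2
      (not_lt.1 hc)
    rw [hlg g hg, hlg g' hg'] at this
    exact absurd (by exact_mod_cast this) (not_le.2 h)
  -- The map is minus the infinite part of the logarithm of t^g. The sign is there because t^g
  -- decreases as `g` grows. Density makes the interval cofinal in the negative exponents.
  refine not_exists_convex_embedding (Set.Iio (0 : G)) (Set.Ioo gs 0) ⟨g0, hg0⟩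
    (fun g hg => hg.2) ?_ (fun g => - negPart (l g)) ?_ ?_ ?_
  · intro d hd
    obtain ⟨g, h1, h2⟩ := exists_between (max_lt hd hgs0)
    exact ⟨g, ⟨(le_max_right _ _).trans_lt h1, h2⟩, (le_max_left _ _).trans_lt h1⟩
  · intro g hg g' hg' h
    exact neg_lt_neg (hlt g hg g' hg' h)
  · intro g _
    rw [ofLex_neg, HahnSeries.support_neg]
    exact support_negPart _
  · intro g hg g' hg' s hs h1 h2
    -- Convexity: a floor of `-s` differs from it by a finite amount, so the negative part of `p` is
    -- `-s`. The order of `E p` is then the exponent sought.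
    obtain ⟨p, hpM, hp1, hp2⟩ := hM.exists_floor (-s)
    have hps : negPart p = -s := by
      rw [← negPart_eq_self (x := -s) (by rwa [ofLex_neg, HahnSeries.support_neg]), negPart_eq_iff]
      exact ⟨1, by rw [abs_le]; constructor <;> push_cast <;> linarith⟩
    have h3 : negPart (l g') ≤ negPart p := by rw [hps]; linarith
    have h4 : negPart p ≤ negPart (l g) := by rw [hps]; linarith
    have hE00 : (ofLex (E 0)).orderTop = 0 := by rw [hE0, hahn_orderTop_one]
    have h5 : negPart 0 < negPart (l g') := by
      by_contra hc
      have := (hD _ (hlM g' hg') 0 M.zero_mem (hl0 g' hg') (hln g' hg') le_rfl hn0).2 (not_lt.1 hc)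
      rw [hE00, hlg g' hg'] at this
      exact absurd (by exact_mod_cast this) (not_le.2 hg'.2)
    have h6 : negPart (l g) < negPart n := by
      by_contra hc
      have := (hD n hnM _ (hlM g hg) hn0 le_rfl (hl0 g hg) (hln g hg)).2 (not_lt.1 hc)
      rw [hgs, hlg g hg] at this
      exact absurd (by exact_mod_cast this) (not_le.2 hg.1)
    have hp0 : 0 ≤ p := (lt_of_negPart_lt (h5.trans_le h3)).le
    have hpn : p ≤ n := (lt_of_negPart_lt (h4.trans_lt h6)).le
    obtain ⟨g'', hg''⟩ := hEne p hpM hp0 hpn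
    have h7 := (hD _ (hlM g' hg') p hpM (hl0 g' hg') (hln g' hg') hp0 hpn).2 h3
    have h8 := (hD p hpM _ (hlM g hg) hp0 hpn (hl0 g hg) (hln g hg)).2 h4
    rw [hlg g' hg', hg''] at h7
    rw [hlg g hg, hg''] at h8
    have h7' : g'' ≤ g' := by exact_mod_cast h7
    have h8' : g ≤ g'' := by exact_mod_cast h8
    have hP : g'' ∈ Set.Ioo gs 0 := ⟨hg.1.trans_le h8', h7'.trans_lt hg'.2⟩
    refine ⟨g'', hP, ?_⟩
    have h9 := (hD _ (hlM g'' hP) p hpM (hl0 g'' hP) (hln g'' hP) hp0 hpn).1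
      (by rw [hlg g'' hP, hg''])
    have h10 := (hD p hpM _ (hlM g'' hP) hp0 hpn (hl0 g'' hP) (hln g'' hP)).1
      (by rw [hlg g'' hP, hg''])
    change - negPart (l g'') = s
    rw [le_antisymm h9 h10, hps, neg_neg]

/-! ### Hahn fields over algebraically closed fields -/

section AlgClosed

variable {G : Type*} [AddCommGroup G] [LinearOrder G] [IsOrderedAddMonoid G]
  {k : Type*} [Field k]

theorem hahn_order_eq {x : HahnSeries G k} (hx : x ≠ 0) : (x.order : WithTop G) = x.orderTop :=
  order_eq_orderTop_of_ne_zero hx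

variable (G k) in
/-- The ring of Hahn series with nonnegative exponents. -/
def hahnIntegers : ValuationSubring (HahnSeries G k) where
  carrier := {x | 0 ≤ x.orderTop}
  mul_mem' {x y} hx hy := by
    change 0 ≤ (x * y).orderTop
    rw [orderTop_mul]
    exact add_nonneg hx hy
  one_mem' := by change 0 ≤ (1 : HahnSeries G k).orderTop; simp
  add_mem' {x y} hx hy := by
    change 0 ≤ (x + y).orderTop
    exact le_trans (le_min hx hy) min_orderTop_le_orderTop_add
  zero_mem' := by change 0 ≤ (0 : HahnSeries G k).orderTop; simp
  neg_mem' {x} hx := by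
    change 0 ≤ (-x).orderTop
    rwa [orderTop_neg]
  mem_or_inv_mem' x := by
    by_cases hx : x = 0
    · left; rw [hx]; change 0 ≤ (0 : HahnSeries G k).orderTop; simp
    · have h : x.orderTop + x⁻¹.orderTop = 0 := by
        rw [← orderTop_mul, mul_inv_cancel₀ hx, orderTop_one]
      change 0 ≤ x.orderTop ∨ 0 ≤ x⁻¹.orderTop
      rw [← hahn_order_eq hx, ← hahn_order_eq (inv_ne_zero hx)] at h ⊢
      norm_cast at h ⊢
      by_contra hc
      push Not at hc
      exact absurd h (ne_of_lt (add_neg hc.1 hc.2))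

/-- The valuation of the Hahn field extends to every field extension. -/
theorem exists_valuationSubring_hahn {L : Type*} [Field L] (j : HahnSeries G k →+* L) :
    ∃ V : ValuationSubring L, (∀ x : HahnSeries G k, 0 ≤ x.orderTop → V.valuation (j x) ≤ 1) ∧
      ∀ x : HahnSeries G k, 0 < x.orderTop → V.valuation (j x) < 1 := by
  obtain ⟨V, hV, hloc⟩ := IsLocalRing.exists_factor_valuationRing
    (j.comp (hahnIntegers G k).subtype)
  have h1 : ∀ x : HahnSeries G k, 0 ≤ x.orderTop → V.valuation (j x) ≤ 1 := fun x hx =>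
    (V.valuation_le_one_iff _).2 (hV ⟨x, hx⟩)
  refine ⟨V, h1, fun x hx => (h1 x hx.le).lt_of_ne fun h => ?_⟩
  have hu : IsUnit ((j.comp (hahnIntegers G k).subtype).codRestrict V.toSubring hV ⟨x, hx.le⟩) :=
    (V.valuation_eq_one_iff ⟨j x, hV ⟨x, hx.le⟩⟩).2 h
  obtain ⟨y, hy⟩ := isUnit_iff_exists_inv.1 (hloc.map_nonunit _ hu)
  have hy' : x * y.1 = 1 := congrArg Subtype.val hy
  have h2 := congrArg orderTop hy'
  rw [orderTop_mul, orderTop_one] at h2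
  have hy0 : 0 ≤ y.1.orderTop := y.2
  exact absurd h2 (add_pos_of_pos_of_nonneg hx hy0).ne'

/-- A descending sequence stays below its first term. This reduces well-foundedness of a glued
support to its initial segments. -/
theorem isWF_of_forall_inter_Iic {Γ : Type*} [LinearOrder Γ] {S : Set Γ}
    (h : ∀ i ∈ S, (S ∩ Set.Iic i).IsWF) : S.IsWF := by
  refine Set.wellFoundedOn_iff_no_descending_seq.2 fun f hf => ?_
  refine Set.wellFoundedOn_iff_no_descending_seq.1 (h (f 0) (hf 0)) f ?_
  intro n
  refine ⟨hf n, ?_⟩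
  rcases Nat.eq_zero_or_pos n with rfl | hn
  · exact le_rfl
  · exact (f.map_rel_iff.2 hn).le

/-- A coherent family of initial segments of Hahn series glues. -/
theorem exists_hahnSeries_glue {ι Γ R : Type*} [LinearOrder Γ] [Zero R] (x : ι → HahnSeries Γ R)
    (D : ι → Set Γ) (hD : ∀ a, IsLowerSet (D a))
    (hx : ∀ a b, ∀ i ∈ D a, i ∈ D b → (x a).coeff i = (x b).coeff i) :
    ∃ z : HahnSeries Γ R, (∀ a, ∀ i ∈ D a, z.coeff i = (x a).coeff i) ∧
      ∀ i, (∀ a, i ∉ D a) → z.coeff i = 0 := by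
  classical
  let c : Γ → R := fun i => if h : ∃ a, i ∈ D a then (x h.choose).coeff i else 0
  have hc : ∀ a, ∀ i ∈ D a, c i = (x a).coeff i := by
    intro a i hi
    have h : ∃ a, i ∈ D a := ⟨a, hi⟩
    exact (dif_pos h).trans (hx _ _ i h.choose_spec hi)
  have hc0 : ∀ i, (∀ a, i ∉ D a) → c i = 0 := fun i hi => dif_neg (by push Not; exact hi)
  refine ⟨⟨c, (isWF_of_forall_inter_Iic fun i hi => ?_).isPWO⟩, hc, hc0⟩
  obtain ⟨a, ha⟩ : ∃ a, i ∈ D a := by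
    by_contra h
    push Not at h
    exact hi (hc0 i h)
  refine (x a).isWF_support.mono ?_
  rintro l ⟨hl, hli⟩
  have := hc a l (hD a hli ha)
  rw [mem_support, ← this]
  exact hl

/-- The algebraic closure has the same value group and residue field, so any approximation from the
Hahn field to an element outside it can be improved. Gluing truncations of all approximations gives
one that cannot be. -/
theorem isAlgClosed_hahnSeries [IsAlgClosed k]
    (hdiv : ∀ n : ℕ, n ≠ 0 → ∀ g : G, ∃ h : G, n • h = g) : IsAlgClosed (HahnSeries G k) := by
  classical
  let L := AlgebraicClosure (HahnSeries G k)
  let j : HahnSeries G k →+* L := algebraMap _ _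
  obtain ⟨V, hV1, hV2⟩ := exists_valuationSubring_hahn j
  let v := V.valuation
  let t : G → HahnSeries G k := fun g => single g 1
  have ht0 : ∀ g, t g ≠ 0 := fun g => single_ne_zero one_ne_zero
  have hto : ∀ g, (t g).orderTop = g := fun g => orderTop_single one_ne_zero
  have hvt0 : ∀ g, v (j (t g)) ≠ 0 := fun g => (Valuation.ne_zero_iff _).2 (by simpa using ht0 g)
  have htmul : ∀ g h, t g * t h = t (g + h) := fun g h => by simp [t, single_mul_single]
  have htpow : ∀ g (n : ℕ), t g ^ n = t (n • g) := fun g n => by simp [t, single_pow]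
  -- the valuation of an element of the base field
  have hle : ∀ (x : HahnSeries G k) (g : G), (g : WithTop G) ≤ x.orderTop →
      v (j x) ≤ v (j (t g)) := by
    intro x g hg
    have h1 : x = x * t (-g) * t g := by
      rw [mul_assoc, htmul]; simp [t]
    have h2 : v (j (x * t (-g))) ≤ 1 := by
      refine hV1 _ ?_
      rw [orderTop_mul, hto]
      have := add_le_add_left hg ((-g : G) : WithTop G)
      rwa [← WithTop.coe_add, add_neg_cancel, WithTop.coe_zero] at this
    rw [h1, map_mul, map_mul]
    exact mul_le_of_le_one_left' h2
  have hlt : ∀ (x : HahnSeries G k) (g : G), (g : WithTop G) < x.orderTop →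
      v (j x) < v (j (t g)) := by
    intro x g hg
    have h1 : x = x * t (-g) * t g := by
      rw [mul_assoc, htmul]; simp [t]
    have h2 : v (j (x * t (-g))) < 1 := by
      refine hV2 _ ?_
      rw [orderTop_mul, hto]
      have := (WithTop.add_lt_add_iff_right (z := ((-g : G) : WithTop G)) WithTop.coe_ne_top).2 hg
      rwa [← WithTop.coe_add, add_neg_cancel, WithTop.coe_zero] at this
    rw [h1, map_mul, map_mul]
    exact mul_lt_of_lt_one_left (zero_lt_iff.2 (hvt0 g)) h2
  have hunit : ∀ r : k, r ≠ 0 → v (j (single 0 r)) = 1 := by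
    intro r hr
    refine le_antisymm (hV1 _ (by simp [orderTop_single hr])) ?_
    have h1 : v (j (single 0 r⁻¹)) ≤ 1 := hV1 _ (by simp [orderTop_single (inv_ne_zero hr)])
    have h2 : v (j (single 0 r)) * v (j (single 0 r⁻¹)) = 1 := by
      rw [← map_mul, ← map_mul, single_mul_single, mul_inv_cancel₀ hr]; simp
    calc (1 : V.ValueGroup) = _ := h2.symm
      _ ≤ v (j (single 0 r)) := mul_le_of_le_one_right' h1
  have heq : ∀ (x : HahnSeries G k) (g : G), x.orderTop = g → v (j x) = v (j (t g)) := by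
    intro x g hg
    have hx : x ≠ 0 := orderTop_ne_top.1 (by rw [hg]; exact WithTop.coe_ne_top)
    refine le_antisymm (hle x g hg.ge) ?_
    have h1 : x⁻¹.orderTop = ((-g : G) : WithTop G) := by
      have h : x.orderTop + x⁻¹.orderTop = 0 := by
        rw [← orderTop_mul, mul_inv_cancel₀ hx, orderTop_one]
      rw [← hahn_order_eq (inv_ne_zero hx), hg] at h
      rw [← hahn_order_eq (inv_ne_zero hx)]
      norm_cast at h ⊢
      exact eq_neg_of_add_eq_zero_right h
    have h2 := hle _ _ h1.ge
    have h3 : t (-g) = (t g)⁻¹ := eq_inv_of_mul_eq_one_left (by rw [htmul]; simp [t])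
    have hx0 : v (j x) ≠ 0 := (Valuation.ne_zero_iff _).2 (by simpa using hx)
    rw [h3, map_inv₀, map_inv₀, map_inv₀, map_inv₀,
      inv_le_inv₀ (zero_lt_iff.2 hx0) (zero_lt_iff.2 (hvt0 g))] at h2
    exact h2
  have hle' : ∀ (x : HahnSeries G k) (g : G), v (j x) ≤ v (j (t g)) →
      (g : WithTop G) ≤ x.orderTop := by
    intro x g h
    by_contra hc
    have hx : x ≠ 0 := orderTop_ne_top.1 (ne_top_of_lt (not_le.1 hc))
    rw [← hahn_order_eq hx] at hc
    rw [heq x _ (hahn_order_eq hx).symm] at h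
    exact absurd h (not_le.2 (hlt _ _ (by rw [hto]; exact not_le.1 hc)))
  have hlt' : ∀ (x : HahnSeries G k) (g : G), v (j x) < v (j (t g)) →
      (g : WithTop G) < x.orderTop := by
    intro x g h
    refine (hle' x g h.le).lt_of_ne fun h' => ?_
    rw [heq x g h'.symm] at h
    exact lt_irrefl _ h
  have ht1 : v (j (t 0)) = 1 := by simp [t]
  have halg : ∀ b : L, ∃ p : Polynomial (HahnSeries G k), p ≠ 0 ∧
      ∑ i ∈ p.support, j (p.coeff i) * b ^ i = 0 := by
    intro b
    obtain ⟨p, hp, hpb⟩ := Algebra.IsAlgebraic.isAlgebraic (R := HahnSeries G k) b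
    refine ⟨p, hp, ?_⟩
    rw [Polynomial.aeval_def, Polynomial.eval₂_eq_sum, Polynomial.sum_def] at hpb
    exact hpb
  -- the extension has the same value group
  have hval : ∀ b : L, b ≠ 0 → ∃ g : G, v b = v (j (t g)) := by
    intro b hb
    have hvb : v b ≠ 0 := (Valuation.ne_zero_iff _).2 hb
    obtain ⟨p, hp, hsum⟩ := halg b
    obtain ⟨i, hi, himax⟩ := Finset.exists_max_image p.support
      (fun i => v (j (p.coeff i) * b ^ i)) (Polynomial.support_nonempty.2 hp)
    have hne : ∀ i ∈ p.support, v (j (p.coeff i) * b ^ i) ≠ 0 := by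
      intro i hi
      refine (Valuation.ne_zero_iff _).2 (mul_ne_zero ?_ (pow_ne_zero _ hb))
      simpa using hi
    -- Since the sum vanishes, its largest value is attained at two different indices. Comparing
    -- these terms puts a positive multiple of the value of `b` in the value group.
    obtain ⟨l, hl, hli, hil⟩ : ∃ l ∈ p.support, l ≠ i ∧
        v (j (p.coeff l) * b ^ l) = v (j (p.coeff i) * b ^ i) := by
      by_contra hc
      push Not at hc
      have := Valuation.map_sum_eq_of_lt v (f := fun i => j (p.coeff i) * b ^ i) hi fun l hl => by
        rw [Finset.mem_sdiff, Finset.mem_singleton] at hl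
        exact (himax l hl.1).lt_of_ne (hc l hl.1 hl.2)
      rw [hsum, map_zero] at this
      exact hne i hi this.symm
    have key : ∀ i l : ℕ, i ∈ p.support → l ∈ p.support → i < l →
        v (j (p.coeff l) * b ^ l) = v (j (p.coeff i) * b ^ i) → ∃ g : G, v b = v (j (t g)) := by
      intro i l hi hl hil h
      obtain ⟨m, rfl⟩ := Nat.exists_eq_add_of_lt hil
      rw [map_mul, map_mul, heq _ _ (hahn_order_eq (Polynomial.mem_support_iff.1 hi)).symm,
        heq _ _ (hahn_order_eq (Polynomial.mem_support_iff.1 hl)).symm, map_pow, map_pow,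
        add_assoc, _root_.pow_add, mul_left_comm, mul_comm (v (j _)) (v b ^ i)] at h
      have h1 := mul_left_cancel₀ (pow_ne_zero i hvb) h
      obtain ⟨g, hg⟩ := hdiv (m + 1) m.succ_ne_zero
        ((p.coeff i).order - (p.coeff (i + (m + 1))).order)
      refine ⟨g, (pow_left_inj₀ zero_le zero_le m.succ_ne_zero).1
        (mul_left_cancel₀ (hvt0 (p.coeff (i + (m + 1))).order) ?_)⟩
      rw [h1, ← map_pow, ← map_pow, htpow, hg, ← map_mul, ← map_mul, htmul, add_sub_cancel]
    rcases lt_or_gt_of_ne hli with h | h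
    · exact key l i hl hi h hil.symm
    · exact key i l hi hl h hil
  -- the extension has the same residue field
  have hres : ∀ b : L, v b = 1 → ∃ r : k, v (b - j (single 0 r)) < 1 := by
    intro b hb
    by_contra hcon
    push Not at hcon
    let f : k →+* L := j.comp HahnSeries.C
    have hf : ∀ r, f r = j (single 0 r) := fun _ => rfl
    -- If no constant were residually equal to `b`, every linear factor would have value at least 1
    -- at `b`, and so would every nonzero polynomial over `k`. The reduction of an algebraic
    -- equation for `b` violates this.
    have hprod : ∀ s : Multiset k, 1 ≤ v (Polynomial.eval₂ f b
        (s.map fun a => Polynomial.X - Polynomial.C a).prod) := by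
      intro s
      induction s using Multiset.induction with
      | empty => simp
      | cons a s ih =>
        rw [Multiset.map_cons, Multiset.prod_cons, Polynomial.eval₂_mul, map_mul,
          Polynomial.eval₂_sub, Polynomial.eval₂_X, Polynomial.eval₂_C]
        exact one_le_mul (hcon a) ih
    have hq : ∀ q : Polynomial k, q ≠ 0 → 1 ≤ v (Polynomial.eval₂ f b q) := by
      intro q hq
      rw [(IsAlgClosed.splits q).eq_prod_roots, Polynomial.eval₂_mul, Polynomial.eval₂_C, map_mul,
        hf, hunit _ (Polynomial.leadingCoeff_ne_zero.2 hq), one_mul]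
      exact hprod _
    obtain ⟨p, hp, hsum⟩ := halg b
    obtain ⟨i, hi, himax⟩ := Finset.exists_max_image p.support
      (fun i => v (j (p.coeff i))) (Polynomial.support_nonempty.2 hp)
    have hd : p.coeff i ≠ 0 := Polynomial.mem_support_iff.1 hi
    have hvd : v (j (p.coeff i)) ≠ 0 := (Valuation.ne_zero_iff _).2 (by simpa using hd)
    -- Division by a coefficient of largest value makes all coefficients integral and one of them 1,
    -- so the reduction `q` is nonzero.
    let c : ℕ → HahnSeries G k := fun l => p.coeff l / p.coeff i
    have hc0 : ∀ l ∈ p.support, 0 ≤ (c l).orderTop := by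
      intro l hl
      refine hle' _ 0 ?_
      rw [ht1, map_div₀, map_div₀]
      exact div_le_one_of_le₀ (himax l hl) zero_le
    have hc : ∀ l ∈ p.support, v (j (c l - single 0 ((c l).coeff 0))) < 1 := by
      intro l hl
      refine hV2 _ (lt_of_le_of_ne ?_ (orderTop_ne_of_coeff_eq_zero (by simp)).symm)
      rw [le_orderTop_iff_forall]
      intro g hg
      have hg' : g ≠ 0 := by rintro rfl; exact lt_irrefl _ hg
      rw [HahnSeries.coeff_sub, coeff_single_of_ne hg', sub_zero]
      exact coeff_eq_zero_of_lt_orderTop (lt_of_lt_of_le hg (hc0 l hl))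
    have hsum' : ∑ l ∈ p.support, j (c l) * b ^ l = 0 := by
      have : ∀ l, j (c l) * b ^ l = (j (p.coeff i))⁻¹ * (j (p.coeff l) * b ^ l) := by
        intro l
        rw [map_div₀]; ring
      simp_rw [this]
      rw [← Finset.mul_sum, hsum, mul_zero]
    let q : Polynomial k := ∑ l ∈ p.support, Polynomial.monomial l ((c l).coeff 0)
    have hqi : q.coeff i = 1 := by
      simp only [q, Polynomial.finsetSum_coeff, Polynomial.coeff_monomial]
      rw [Finset.sum_ite_eq' , if_pos hi]
      simp [c, div_self hd]
    refine absurd (hq q (by rintro h; simp [h] at hqi)) (not_le.2 ?_)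
    have h1 : Polynomial.eval₂ f b q = - ∑ l ∈ p.support,
        j (c l - single 0 ((c l).coeff 0)) * b ^ l := by
      simp only [q, Polynomial.eval₂_finsetSum, Polynomial.eval₂_monomial, hf, map_sub, sub_mul,
        Finset.sum_sub_distrib, hsum']
      ring
    rw [h1, Valuation.map_neg]
    refine Valuation.map_sum_lt _ one_ne_zero fun l hl => ?_
    rw [map_mul, map_pow, hb, one_pow, mul_one]
    exact hc l hl
  -- The difference `a - j x` has the value of some monomial and its quotient by that monomial has a
  -- residue in `k`; adding this leading term to `x` improves the approximation.
  have himp : ∀ (a : L) (x : HahnSeries G k), a ≠ j x → ∃ y, v (a - j y) < v (a - j x) := by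
    intro a x hax
    obtain ⟨g, hg⟩ := hval _ (sub_ne_zero.2 hax)
    obtain ⟨r, hr⟩ := hres ((a - j x) / j (t g)) (by
      rw [map_div₀, hg, div_self (hvt0 g)])
    refine ⟨x + single 0 r * t g, ?_⟩
    have h0 : j (t g) ≠ 0 := by simpa using ht0 g
    have : a - j (x + single 0 r * t g) = ((a - j x) / j (t g) - j (single 0 r)) * j (t g) := by
      rw [map_add, map_mul, sub_mul, div_mul_cancel₀ _ h0]; ring
    rw [this, map_mul, hg]
    exact mul_lt_of_lt_one_left (zero_lt_iff.2 (hvt0 g)) hr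
  have hsurj : ∀ a : L, ∃ x, a = j x := by
    intro a
    by_contra hcon
    push Not at hcon
    choose γ hγ using fun x => hval _ (sub_ne_zero.2 (hcon x))
    have hcoeff : ∀ (x y : HahnSeries G k) (i : G), v (j (x - y)) < v (j (t i)) →
        x.coeff i = y.coeff i := by
      intro x y i h
      have := hlt' _ _ h
      simpa [sub_eq_zero] using coeff_eq_zero_of_lt_orderTop this
    -- `γ x` is the exponent up to which `x` approximates `a`. Two approximations agree below both
    -- their exponents, so the truncations glue to a series `z` at least as good as all of them.
    obtain ⟨z, hz, -⟩ := exists_hahnSeries_glue (fun x => x) (fun x => Set.Iio (γ x))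
      (fun x => isLowerSet_Iio _) (by
        intro x y i hix hiy
        refine hcoeff x y i ?_
        have : j (x - y) = (a - j y) - (a - j x) := by rw [map_sub]; ring
        rw [this]
        refine Valuation.map_sub_lt _ ?_ ?_
        · rw [hγ]; exact hlt _ _ (by rw [hto]; exact_mod_cast hiy)
        · rw [hγ]; exact hlt _ _ (by rw [hto]; exact_mod_cast hix))
    obtain ⟨y, hy⟩ := himp a z (hcon z)
    have h1 : v (j (z - y)) ≤ v (j (t (γ y))) := by
      refine hle _ _ (le_orderTop_iff_forall.2 fun i hi => ?_)
      rw [HahnSeries.coeff_sub, hz y i (by exact_mod_cast hi), sub_self]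
    have h2 : v (a - j z) ≤ v (a - j y) := by
      have : a - j z = (a - j y) - j (z - y) := by rw [map_sub]; ring
      rw [this]
      exact (Valuation.map_sub _ _ _).trans (max_le le_rfl (h1.trans (hγ y).ge))
    exact absurd hy (not_lt.2 h2)
  refine IsAlgClosed.of_exists_root _ fun p _ hp => ?_
  obtain ⟨a, ha⟩ := IsAlgClosed.exists_aeval_eq_zero L p hp.degree_pos.ne'
  obtain ⟨x, rfl⟩ := hsurj a
  refine ⟨x, (algebraMap (HahnSeries G k) L).injective ?_⟩
  rw [map_zero, ← ha, Polynomial.aeval_algebraMap_apply]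
  rfl

end AlgClosed
-- From algebraic closedness to real closedness
section RealClosed

open Polynomial

/-- Polynomials have the intermediate value property. -/
def PolynomialIVT (K : Type*) [Field K] [LinearOrder K] : Prop :=
  ∀ (p : K[X]) (a b : K), a ≤ b → p.eval a * p.eval b ≤ 0 → ∃ c, a ≤ c ∧ c ≤ b ∧ p.eval c = 0

variable {K F : Type*} [Field K] [LinearOrder K] [IsStrictOrderedRing K] [Field F] [IsAlgClosed F]

/-- Take a root `j a + I * j b` in `F`. If `b` is nonzero, the remainder modulo (X - a)² + b² is
linear and vanishes at the root. It is zero because 1 and `I` are independent over `K`, where -1 is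
not a square. -/
theorem exists_linear_or_quadratic_factor (j : K →+* F) (I : F) (hI : I * I = -1)
    (hK : ∀ z, ∃ p q, z = j p + I * j q) (p : K[X]) (hp : 0 < p.natDegree) :
    (∃ a g, p = (X - Polynomial.C a) * g) ∨ ∃ a b g, b ≠ 0 ∧ p = ((X - Polynomial.C a) ^ 2 + Polynomial.C (b ^ 2)) * g := by
  obtain ⟨z, hz⟩ := IsAlgClosed.exists_root (p.map j) (by
    rw [degree_map]; exact (natDegree_pos_iff_degree_pos.1 hp).ne')
  obtain ⟨a, b, rfl⟩ := hK z
  have hind : ∀ u w, j u + I * j w = 0 → w = 0 := by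
    intro u w h
    by_contra hw
    have h1 : j (-u / w) = I := by
      rw [map_div₀, map_neg, div_eq_iff (by simpa using hw)]
      linear_combination -h
    have h2 : j ((-u / w) * (-u / w)) = j (-1) := by rw [map_mul, h1, hI, map_neg, map_one]
    have h3 := j.injective h2
    nlinarith [mul_self_nonneg (-u / w)]
  rw [IsRoot, eval_map] at hz
  by_cases hb : b = 0
  · left
    rw [hb, map_zero, mul_zero, add_zero, eval₂_at_apply, map_eq_zero] at hz
    obtain ⟨g, hg⟩ := dvd_iff_isRoot.2 (show p.IsRoot a from hz)
    exact ⟨a, g, hg⟩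
  · right
    set D : K[X] := (X - Polynomial.C a) ^ 2 + Polynomial.C (b ^ 2) with hDdef
    have hD2 : D.natDegree = 2 := by
      rw [hDdef]; compute_degree!
    have hDm : D.Monic := by
      rw [hDdef]; monicity!
    have hr : (p %ₘ D).natDegree < 2 := by
      rw [← hD2]
      exact natDegree_modByMonic_lt _ hDm (by rintro h; simp [h] at hD2)
    have hDz : eval₂ j (j a + I * j b) D = 0 := by
      rw [hDdef, eval₂_add, eval₂_pow, eval₂_sub, eval₂_X, eval₂_C, eval₂_C, map_pow]
      linear_combination (j b) ^ 2 * hI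
    have hrz : eval₂ j (j a + I * j b) (p %ₘ D) = 0 := by
      have h := modByMonic_add_div p D
      have h2 := congrArg (eval₂ j (j a + I * j b)) h
      rw [eval₂_add, eval₂_mul, hDz, zero_mul, add_zero, hz] at h2
      exact h2
    obtain ⟨s, t, hst⟩ := exists_eq_X_add_C_of_natDegree_le_one (Nat.lt_succ_iff.1 hr)
    rw [hst, eval₂_add, eval₂_mul, eval₂_X, eval₂_C, eval₂_C] at hrz
    have hs : s = 0 := by
      have := hind (s * a + t) (s * b) (by simp only [map_add, map_mul]; linear_combination hrz)
      exact (mul_eq_zero.1 this).resolve_right hb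
    rw [hs, map_zero, zero_mul, zero_add, map_eq_zero] at hrz
    rw [hs, hrz, Polynomial.C_0, zero_mul, zero_add] at hst
    obtain ⟨g, hg⟩ := (modByMonic_eq_zero_iff_dvd hDm).1 hst
    exact ⟨a, b, g, hb, hg⟩

/-- Induction on the degree: a linear factor either has its root in the interval or keeps its sign
there, and a quadratic factor is positive. Either way a sign change passes to the cofactor. -/
theorem polynomialIVT_of_isAlgClosed (j : K →+* F) (I : F) (hI : I * I = -1)
    (hK : ∀ z, ∃ p q, z = j p + I * j q) : PolynomialIVT K := by
  intro p
  induction hn : p.natDegree using Nat.strong_induction_on generalizing p with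
  | _ n ih =>
  intro a b hab h
  by_cases hp0 : p = 0
  · exact ⟨a, le_rfl, hab, by simp [hp0]⟩
  rcases Nat.eq_zero_or_pos p.natDegree with h0 | hpos
  · rw [natDegree_eq_zero] at h0
    obtain ⟨c, rfl⟩ := h0
    rw [eval_C, eval_C] at h
    exact ⟨a, le_rfl, hab, by
      rw [eval_C]; exact mul_self_eq_zero.1 (le_antisymm h (mul_self_nonneg c))⟩
  rcases exists_linear_or_quadratic_factor j I hI hK p hpos with ⟨r, g, rfl⟩ | ⟨r, s, g, hs, rfl⟩
  · have hg0 : g ≠ 0 := right_ne_zero_of_mul hp0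
    rw [natDegree_mul (X_sub_C_ne_zero r) hg0, natDegree_X_sub_C] at hn
    simp only [eval_mul, eval_sub, eval_X, eval_C] at h ⊢
    by_cases hr : a ≤ r ∧ r ≤ b
    · exact ⟨r, hr.1, hr.2, by simp⟩
    · have hpos : 0 < (a - r) * (b - r) := by
        by_cases h1 : a ≤ r
        · have h2 : b < r := not_le.1 fun h2 => hr ⟨h1, h2⟩
          exact mul_pos_of_neg_of_neg (by linarith) (by linarith)
        · exact mul_pos (by linarith) (by linarith)
      have h' : g.eval a * g.eval b ≤ 0 := by
        by_contra hc
        have := mul_pos hpos (not_le.1 hc)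
        linarith
      obtain ⟨c, h1, h2, h3⟩ := ih g.natDegree (by omega) g rfl a b hab h'
      exact ⟨c, h1, h2, by rw [h3, mul_zero]⟩
  · have hg0 : g ≠ 0 := right_ne_zero_of_mul hp0
    have hD2 : ((X - Polynomial.C r) ^ 2 + Polynomial.C (s ^ 2) : K[X]).natDegree = 2 := by compute_degree!
    rw [natDegree_mul (left_ne_zero_of_mul hp0) hg0, hD2] at hn
    simp only [eval_mul, eval_add, eval_pow, eval_sub, eval_X, eval_C] at h ⊢
    have hs' := sq_pos_of_ne_zero hs
    have hpos : 0 < ((a - r) ^ 2 + s ^ 2) * ((b - r) ^ 2 + s ^ 2) := by positivity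
    have h' : g.eval a * g.eval b ≤ 0 := by
      by_contra hc
      have := mul_pos hpos (not_le.1 hc)
      linarith
    obtain ⟨c, h1, h2, h3⟩ := ih g.natDegree (by omega) g rfl a b hab h'
    exact ⟨c, h1, h2, by rw [h3, mul_zero]⟩

/-- Square roots come from the intermediate value property on [0, x + 1]. For odd degree, splitting
off quadratic factors preserves parity until a linear one appears. -/
theorem isRealClosed_of_isAlgClosed (j : K →+* F) (I : F) (hI : I * I = -1)
    (hK : ∀ z, ∃ p q, z = j p + I * j q) : IsRealClosed K := by
  refine IsRealClosed.of_linearOrderedField ?_ ?_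
  · intro x hx
    obtain ⟨c, -, -, hc⟩ := polynomialIVT_of_isAlgClosed j I hI hK (X ^ 2 - Polynomial.C x) 0 (x + 1)
      (by linarith) (by
        simp only [eval_sub, eval_pow, eval_X, eval_C]
        have : 0 ≤ x * ((x + 1) ^ 2 - x) := mul_nonneg hx (by nlinarith)
        linarith)
    simp only [eval_sub, eval_pow, eval_X, eval_C] at hc
    exact ⟨c, by linear_combination -hc⟩
  · intro p
    induction hn : p.natDegree using Nat.strong_induction_on generalizing p with
    | _ n ih =>
    intro hodd
    have hp0 : p ≠ 0 := by rintro rfl; subst hn; simp at hodd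
    rcases exists_linear_or_quadratic_factor j I hI hK p (hn ▸ hodd.pos) with
      ⟨r, g, rfl⟩ | ⟨r, s, g, hs, rfl⟩
    · exact ⟨r, by simp⟩
    · have hg0 : g ≠ 0 := right_ne_zero_of_mul hp0
      have hD2 : ((X - Polynomial.C r) ^ 2 + Polynomial.C (s ^ 2) : K[X]).natDegree = 2 := by compute_degree!
      rw [natDegree_mul (left_ne_zero_of_mul hp0) hg0, hD2] at hn
      obtain ⟨x, hx⟩ := ih g.natDegree (by omega) rfl (by
        rw [← hn] at hodd
        rcases hodd with ⟨m, hm⟩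
        exact ⟨m - 1, by omega⟩)
      exact ⟨x, by simp only [IsRoot] at hx ⊢; rw [eval_mul, hx, mul_zero]⟩

end RealClosed

/-! ### Real and complex Hahn series -/

section HahnReal

variable {G : Type*} [AddCommGroup G] [LinearOrder G] [IsOrderedAddMonoid G]

/-- The inclusion of the real into the complex Hahn series. -/
noncomputable def hahnComplexify : Lex (HahnSeries G ℝ) →+* HahnSeries G ℂ where
  toFun x := (ofLex x).map Complex.ofRealHom
  map_zero' := by ext; simp
  map_one' := by
    ext i
    simp only [ofLex_one, map_coeff, coeff_one]
    split_ifs <;> simp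
  map_add' x y := by ext; simp
  map_mul' x y := by
    rw [ofLex_mul]
    exact HahnSeries.map_mul (Complex.ofRealHom : ℝ →ₙ+* ℂ)

theorem hahnComplexify_decomp (z : HahnSeries G ℂ) : ∃ p q : Lex (HahnSeries G ℝ),
    z = hahnComplexify p + single 0 Complex.I * hahnComplexify q := by
  refine ⟨toLex (z.map Complex.reAddGroupHom), toLex (z.map Complex.imAddGroupHom), ?_⟩
  ext i
  rw [HahnSeries.coeff_add, coeff_single_zero_mul]
  change z.coeff i = ((z.coeff i).re : ℂ) + Complex.I * ((z.coeff i).im : ℂ)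
  rw [mul_comm, Complex.re_add_im]

theorem single_I_mul_self : (single (0 : G) Complex.I) * single 0 Complex.I = -1 := by
  rw [single_mul_single, Complex.I_mul_I, add_zero, single_neg]
  rfl

variable (hdiv : ∀ n : ℕ, n ≠ 0 → ∀ g : G, ∃ h : G, n • h = g)
include hdiv

theorem polynomialIVT_hahnSeries : PolynomialIVT (Lex (HahnSeries G ℝ)) :=
  haveI := isAlgClosed_hahnSeries (k := ℂ) hdiv
  polynomialIVT_of_isAlgClosed hahnComplexify _ single_I_mul_self hahnComplexify_decomp

theorem isRealClosed_hahnSeries : IsRealClosed (Lex (HahnSeries G ℝ)) :=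
  haveI := isAlgClosed_hahnSeries (k := ℂ) hdiv
  isRealClosed_of_isAlgClosed hahnComplexify _ single_I_mul_self hahnComplexify_decomp

end HahnReal
-- The η₁ property of the hyperreals
/-- Between any two countable sets `A < B` there is an element. -/
def IsEtaOne (X : Type*) [LinearOrder X] : Prop :=
  ∀ A B : Set X, A.Countable → B.Countable → (∀ a ∈ A, ∀ b ∈ B, a < b) →
    ∃ x, (∀ a ∈ A, a < x) ∧ ∀ b ∈ B, x < b

section Hyperreal

open Filter

/-- At coordinate `i` solve the longest initial list of conditions that is solvable there, of length
at most `i`. The bound is harmless because a nonprincipal ultrafilter ignores finite sets. -/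
theorem exists_diagonal {α : Type*} (P : ℕ → ℕ → α → Prop)
    (h : ∀ N, ∀ᶠ i in hyperfilter ℕ, ∃ x, ∀ n < N, P n i x) :
    ∃ f : ℕ → α, ∀ n, ∀ᶠ i in hyperfilter ℕ, P n i (f i) := by
  classical
  obtain ⟨-, x0, -⟩ := (h 0).exists
  let N : ℕ → ℕ := fun i => Nat.findGreatest (fun N => ∃ x, ∀ n < N, P n i x) i
  have hN : ∀ i, ∃ x, ∀ n < N i, P n i x := fun i =>
    Nat.findGreatest_spec (P := fun N => ∃ x, ∀ n < N, P n i x) (Nat.zero_le i) ⟨x0, by simp⟩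
  choose f hf using hN
  refine ⟨f, fun n => ?_⟩
  filter_upwards [h (n + 1), Nat.hyperfilter_le_atTop (eventually_ge_atTop (n + 1))] with i hi hni
  exact hf i n (Nat.le_findGreatest (P := fun N => ∃ x, ∀ n < N, P n i x) hni hi)

theorem isEtaOne_hyperreal : IsEtaOne Hyperreal := by
  classical
  intro A B hA hB hAB
  obtain ⟨eA, heA⟩ := Set.countable_iff_exists_injOn.1 hA
  obtain ⟨eB, heB⟩ := Set.countable_iff_exists_injOn.1 hB
  choose r hr using Hyperreal.ofSeq_surjective
  obtain ⟨f, hf⟩ := exists_diagonal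
    (fun n i x => (∀ a ∈ A, eA a = n → r a i < x) ∧ ∀ b ∈ B, eB b = n → x < r b i) (by
      intro N
      have hfA : {a ∈ A | eA a < N}.Finite :=
        Set.Finite.of_finite_image ((Set.finite_Iio N).subset (by rintro _ ⟨a, ha, rfl⟩; exact ha.2))
          (heA.mono fun a ha => ha.1)
      have hfB : {b ∈ B | eB b < N}.Finite :=
        Set.Finite.of_finite_image ((Set.finite_Iio N).subset (by rintro _ ⟨a, ha, rfl⟩; exact ha.2))
          (heB.mono fun a ha => ha.1)
      have : ∀ᶠ i in hyperfilter ℕ, ∀ a ∈ {a ∈ A | eA a < N}, ∀ b ∈ {b ∈ B | eB b < N},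
          r a i < r b i := by
        rw [Filter.eventually_all_finite hfA]
        intro a ha
        rw [Filter.eventually_all_finite hfB]
        intro b hb
        rw [← Hyperreal.ofSeq_lt_ofSeq, hr, hr]
        exact hAB a ha.1 b hb.1
      filter_upwards [this] with i hi
      obtain ⟨x, hx1, hx2⟩ := Order.exists_between_finsets
        (hfA.toFinset.image fun a => r a i) (hfB.toFinset.image fun b => r b i) (by
          intro y hy z hz
          rw [Finset.mem_image] at hy hz
          obtain ⟨a, ha, rfl⟩ := hy
          obtain ⟨b, hb, rfl⟩ := hz
          exact hi a (hfA.mem_toFinset.1 ha) b (hfB.mem_toFinset.1 hb))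
      refine ⟨x, fun n hn => ⟨fun a ha han => hx1 _ ?_, fun b hb hbn => hx2 _ ?_⟩⟩
      · exact Finset.mem_image_of_mem (fun a => r a i) (hfA.mem_toFinset.2 ⟨ha, han ▸ hn⟩)
      · exact Finset.mem_image_of_mem (fun a => r a i) (hfB.mem_toFinset.2 ⟨hb, hbn ▸ hn⟩))
  refine ⟨Hyperreal.ofSeq f, fun a ha => ?_, fun b hb => ?_⟩
  · rw [← hr a, Hyperreal.ofSeq_lt_ofSeq]
    filter_upwards [hf (eA a)] with i hi
    exact hi.1 a ha rfl
  · rw [← hr b, Hyperreal.ofSeq_lt_ofSeq]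
    filter_upwards [hf (eB b)] with i hi
    exact hi.2 b hb rfl

end Hyperreal

/-! ### The η₁ property of Hahn fields -/

section Hahn

variable {G : Type*} [AddCommGroup G] [LinearOrder G] [IsOrderedAddMonoid G]

theorem hahn_orderTop_le_of_abs_le {x y : Lex (HahnSeries G ℝ)} (h : |x| ≤ |y|) :
    (ofLex y).orderTop ≤ (ofLex x).orderTop :=
  (hahn_orderTop_le_iff _ _).2 ⟨1, by simpa using h⟩

theorem hahn_lt_of_coeff_lt {x y : Lex (HahnSeries G ℝ)} {g : G}
    (hx : (g : WithTop G) ≤ (ofLex x).orderTop) (hy : (g : WithTop G) ≤ (ofLex y).orderTop)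
    (h : (ofLex x).coeff g < (ofLex y).coeff g) : x < y := by
  refine (HahnSeries.lt_iff _ _).2 ⟨g, fun j hj => ?_, h⟩
  rw [coeff_eq_zero_of_lt_orderTop (lt_of_lt_of_le (WithTop.coe_lt_coe.2 hj) hx),
    coeff_eq_zero_of_lt_orderTop (lt_of_lt_of_le (WithTop.coe_lt_coe.2 hj) hy)]

theorem hahn_abs_lt_single {x : Lex (HahnSeries G ℝ)} {g : G}
    (h : (g : WithTop G) < (ofLex x).orderTop) : |x| < toLex (single g (1 : ℝ)) := by
  have := abs_lt_abs_of_orderTop_ofLex (x := x) (y := toLex (single g (1 : ℝ)))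
    (by rwa [ofLex_toLex, orderTop_single one_ne_zero])
  rwa [abs_of_pos (hahn_single_pos g one_pos)] at this

theorem single_lt_hahn_abs {x : Lex (HahnSeries G ℝ)} {g : G}
    (h : (ofLex x).orderTop < g) : toLex (single g (1 : ℝ)) < |x| := by
  have := abs_lt_abs_of_orderTop_ofLex (x := toLex (single g (1 : ℝ))) (y := x)
    (by rwa [ofLex_toLex, orderTop_single one_ne_zero])
  rwa [abs_of_pos (hahn_single_pos g one_pos)] at this

theorem countable_finite_orders {S : Set (Lex (HahnSeries G ℝ))} (hS : S.Countable)
    (f : Lex (HahnSeries G ℝ) → Lex (HahnSeries G ℝ)) :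
    {h : G | ∃ s ∈ S, (ofLex (f s)).orderTop = h}.Countable := by
  refine ((hS.image fun s => (ofLex (f s)).orderTop).preimage
    (WithTop.coe_injective (α := G))).mono ?_
  rintro h ⟨s, hs, hsh⟩
  exact ⟨s, hs, hsh⟩

variable (hG : IsEtaOne G)
include hG

/-- Countably many exponents above `g` have a common strict lower bound still above `g`; its
monomial dominates all the differences. -/
theorem IsEtaOne.exists_single_bound {S : Set (Lex (HahnSeries G ℝ))} (hS : S.Countable)
    (y : Lex (HahnSeries G ℝ)) (g : G) (h : ∀ s ∈ S, (g : WithTop G) < (ofLex (s - y)).orderTop) :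
    ∃ h, g < h ∧ ∀ s ∈ S, |s - y| < toLex (single h (1 : ℝ)) := by
  obtain ⟨h', h1, h2⟩ := hG {g} {h : G | ∃ s ∈ S, (ofLex (s - y)).orderTop = h}
    (Set.countable_singleton g) (countable_finite_orders hS fun s => s - y) (by
      rintro a rfl b ⟨s, hs, hsb⟩
      have := h s hs
      rw [hsb] at this
      exact_mod_cast this)
  refine ⟨h', h1 g rfl, fun s hs => hahn_abs_lt_single ?_⟩
  by_cases htop : (ofLex (s - y)).orderTop = ⊤
  · rw [htop]; exact WithTop.coe_lt_top _
  · obtain ⟨w, hw⟩ := WithTop.ne_top_iff_exists.1 htop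
    rw [← hw]
    exact_mod_cast h2 w ⟨s, hs, hw.symm⟩

/-- The hypothesis `hord` says that 0 approximates the cut as well as its members approximate each
other. Either both sides eventually have the same order, and the cut is decided by leading
coefficients in ℝ, or the orders are separated and a monomial of intermediate order fills it. -/
theorem IsEtaOne.exists_between_of_nonneg {A B : Set (Lex (HahnSeries G ℝ))} (hA : A.Countable)
    (hB : B.Countable) (hAB : ∀ a ∈ A, ∀ b ∈ B, a < b)
    (hord : ∀ a ∈ A, ∀ b ∈ B, (ofLex (b - a)).orderTop ≤ (ofLex a).orderTop)
    {a0 : Lex (HahnSeries G ℝ)} (ha0 : a0 ∈ A) (h0 : 0 ≤ a0) :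
    ∃ x, (∀ a ∈ A, a < x) ∧ ∀ b ∈ B, x < b := by
  have hle : ∀ {x y : Lex (HahnSeries G ℝ)}, 0 ≤ x → x ≤ y →
      (ofLex y).orderTop ≤ (ofLex x).orderTop := by
    intro x y hx hxy
    refine hahn_orderTop_le_of_abs_le ?_
    rwa [abs_of_nonneg hx, abs_of_nonneg (hx.trans hxy)]
  by_cases hcase : ∃ a ∈ A, a0 ≤ a ∧ ∃ b ∈ B, (ofLex a).orderTop = (ofLex b).orderTop
  · obtain ⟨a1, ha1, ha01, b1, hb1, hab1⟩ := hcase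
    have hb1pos : 0 < b1 := (h0.trans ha01).trans_lt (hAB a1 ha1 b1 hb1)
    obtain ⟨g, hg⟩ := WithTop.ne_top_iff_exists.1 (orderTop_ne_top.2 (show ofLex b1 ≠ 0 from hb1pos.ne'))
    have hgA : ∀ a ∈ A, a1 ≤ a → (ofLex a).orderTop = g := by
      intro a ha h
      refine le_antisymm ?_ ?_
      · rw [hg, ← hab1]; exact hle (h0.trans ha01) h
      · rw [hg]; exact hle ((h0.trans ha01).trans h) (hAB a ha b1 hb1).le
    have hgB : ∀ b ∈ B, b ≤ b1 → (ofLex b).orderTop = g := by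
      intro b hb h
      have hb0 := (h0.trans ha01).trans (hAB a1 ha1 b hb).le
      refine le_antisymm ?_ ?_
      · rw [hg, ← hab1]; exact hle (h0.trans ha01) (hAB a1 ha1 b hb).le
      · rw [hg]; exact hle hb0 h
    -- Equal leading coefficients would give `b - a` order above `g`, the order of `a`, against
    -- `hord`.
    have hc : ∀ a ∈ A, a1 ≤ a → ∀ b ∈ B, b ≤ b1 → (ofLex a).coeff g < (ofLex b).coeff g := by
      intro a ha h b hb h'
      by_contra hcon
      rcases (not_lt.1 hcon).eq_or_lt with h2 | h2
      · have h3 := hord a ha b hb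
        have h4 : (g : WithTop G) ≤ (ofLex (b - a)).orderTop := by
          rw [hg]; exact hle (sub_nonneg.2 (hAB a ha b hb).le) (by
            linarith [(h0.trans ha01).trans h])
        rw [hgA a ha h] at h3
        refine orderTop_ne_of_coeff_eq_zero ?_ (le_antisymm h3 h4)
        rw [ofLex_sub, HahnSeries.coeff_sub, h2, sub_self]
      · exact lt_asymm (hAB a ha b hb) (hahn_lt_of_coeff_lt (hgB b hb h').ge (hgA a ha h).ge h2)
    set C : Set ℝ := {c | ∃ a ∈ A, a1 ≤ a ∧ (ofLex a).coeff g = c}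
    have hCbdd : BddAbove C := ⟨(ofLex b1).coeff g, by
      rintro _ ⟨a, ha, h, rfl⟩
      exact (hc a ha h b1 hb1 le_rfl).le⟩
    -- Completeness of ℝ gives a separating coefficient. If it is attained on one side, the monomial
    -- is corrected by a much smaller one towards the other side; strictness excludes both sides
    -- attaining it.
    set r := sSup C
    have hrA : ∀ a ∈ A, a1 ≤ a → (ofLex a).coeff g ≤ r := fun a ha h =>
      le_csSup hCbdd ⟨a, ha, h, rfl⟩
    have hrB : ∀ b ∈ B, b ≤ b1 → r ≤ (ofLex b).coeff g := by
      intro b hb h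
      refine csSup_le ⟨_, a1, ha1, le_rfl, rfl⟩ ?_
      rintro _ ⟨a, ha, h', rfl⟩
      exact (hc a ha h' b hb h).le
    have red : ∀ x, (∃ a2 ∈ A, ∀ a ∈ A, a2 ≤ a → a < x) → (∃ b2 ∈ B, ∀ b ∈ B, b ≤ b2 → x < b) →
        ∃ x, (∀ a ∈ A, a < x) ∧ ∀ b ∈ B, x < b := by
      rintro x ⟨a2, ha2, h1⟩ ⟨b2, hb2, h2⟩
      refine ⟨x, fun a ha => ?_, fun b hb => ?_⟩
      · rcases le_total a2 a with h | h
        · exact h1 a ha h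
        · exact h.trans_lt (h1 a2 ha2 le_rfl)
      · rcases le_total b b2 with h | h
        · exact h2 b hb h
        · exact (h2 b2 hb2 le_rfl).trans_le h
    set y : Lex (HahnSeries G ℝ) := toLex (single g r) with hy
    have hyg : (g : WithTop G) ≤ (ofLex y).orderTop := orderTop_single_le
    have hyc : (ofLex y).coeff g = r := coeff_single_same g r
    have hsub : ∀ s : Lex (HahnSeries G ℝ), (ofLex s).orderTop = g → (ofLex s).coeff g = r →
        (g : WithTop G) < (ofLex (s - y)).orderTop := by
      intro s hs hsr
      refine lt_of_le_of_ne ?_ (orderTop_ne_of_coeff_eq_zero ?_).symm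
      · exact le_trans (le_min hs.ge hyg) min_orderTop_le_orderTop_sub
      · rw [ofLex_sub, HahnSeries.coeff_sub, hsr, hyc, sub_self]
    by_cases hmaxA : ∃ a2 ∈ A, a1 ≤ a2 ∧ (ofLex a2).coeff g = r
    · obtain ⟨a2, ha2, ha12, har⟩ := hmaxA
      have hmono : ∀ a ∈ A, a2 ≤ a → (ofLex a).coeff g = r := by
        intro a ha h
        refine le_antisymm (hrA a ha (ha12.trans h)) ?_
        rw [← har]
        by_contra hcon
        exact absurd h (not_le.2 (hahn_lt_of_coeff_lt (hgA a ha (ha12.trans h)).ge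
          (hgA a2 ha2 ha12).ge (not_le.1 hcon)))
      obtain ⟨h, hgh, hbd⟩ := hG.exists_single_bound (S := {a ∈ A | a2 ≤ a})
        (hA.mono fun _ h => h.1) y g fun s hs => hsub s (hgA s hs.1 (ha12.trans hs.2))
          (hmono s hs.1 hs.2)
      refine red (y + toLex (single h (1 : ℝ))) ⟨a2, ha2, fun a ha h2 => ?_⟩
        ⟨b1, hb1, fun b hb h2 => ?_⟩
      · linarith [hbd a ⟨ha, h2⟩, le_abs_self (a - y)]
      · refine hahn_lt_of_coeff_lt (g := g) ?_ (hgB b hb h2).ge ?_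
        · refine le_trans (le_min hyg ?_) min_orderTop_le_orderTop_add
          refine le_trans ?_ orderTop_single_le
          exact_mod_cast hgh.le
        · rw [ofLex_add, HahnSeries.coeff_add, hyc, ofLex_toLex, coeff_single_of_ne hgh.ne,
            add_zero, ← har]
          exact hc a2 ha2 ha12 b hb h2
    · by_cases hminB : ∃ b2 ∈ B, b2 ≤ b1 ∧ (ofLex b2).coeff g = r
      · obtain ⟨b2, hb2, hb12, hbr⟩ := hminB
        have hmono : ∀ b ∈ B, b ≤ b2 → (ofLex b).coeff g = r := by
          intro b hb h
          refine le_antisymm ?_ (hrB b hb (h.trans hb12))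
          rw [← hbr]
          by_contra hcon
          exact absurd h (not_le.2 (hahn_lt_of_coeff_lt (hgB b2 hb2 hb12).ge
            (hgB b hb (h.trans hb12)).ge (not_le.1 hcon)))
        obtain ⟨h, hgh, hbd⟩ := hG.exists_single_bound (S := {b ∈ B | b ≤ b2})
          (hB.mono fun _ h => h.1) y g fun s hs => hsub s (hgB s hs.1 (hs.2.trans hb12))
            (hmono s hs.1 hs.2)
        refine red (y - toLex (single h (1 : ℝ))) ⟨a1, ha1, fun a ha h2 => ?_⟩
          ⟨b2, hb2, fun b hb h2 => ?_⟩
        · refine hahn_lt_of_coeff_lt (g := g) (hgA a ha h2).ge ?_ ?_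
          · refine le_trans (le_min hyg ?_) min_orderTop_le_orderTop_sub
            refine le_trans ?_ orderTop_single_le
            exact_mod_cast hgh.le
          · rw [ofLex_sub, HahnSeries.coeff_sub, hyc, ofLex_toLex, coeff_single_of_ne hgh.ne,
              sub_zero]
            exact (hrA a ha h2).lt_of_ne fun h3 => hmaxA ⟨a, ha, h2, h3⟩
        · linarith [hbd b ⟨hb, h2⟩, neg_abs_le (b - y)]
      · refine red y ⟨a1, ha1, fun a ha h => ?_⟩ ⟨b1, hb1, fun b hb h => ?_⟩
        · refine hahn_lt_of_coeff_lt (hgA a ha h).ge hyg ?_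
          rw [hyc]
          exact (hrA a ha h).lt_of_ne fun h3 => hmaxA ⟨a, ha, h, h3⟩
        · refine hahn_lt_of_coeff_lt hyg (hgB b hb h).ge ?_
          rw [hyc]
          exact (hrB b hb h).lt_of_ne fun h3 => hminB ⟨b, hb, h, h3.symm⟩
  · push Not at hcase
    obtain ⟨h, h1, h2⟩ := hG {h : G | ∃ b ∈ B, (ofLex b).orderTop = h}
      {h : G | ∃ a ∈ {a ∈ A | a0 ≤ a}, (ofLex a).orderTop = h} (countable_finite_orders hB id)
      (countable_finite_orders (hA.mono fun _ h => h.1) id) (by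
        rintro u ⟨b, hb, hbu⟩ w ⟨a, ⟨ha, h⟩, haw⟩
        have h3 := (hle (h0.trans h) (hAB a ha b hb).le).lt_of_ne (hcase a ha h b hb).symm
        rw [hbu, haw] at h3
        exact_mod_cast h3)
    have key : ∀ a ∈ A, a0 ≤ a → a < toLex (single h (1 : ℝ)) := by
      intro a ha ha'
      refine (le_abs_self a).trans_lt (hahn_abs_lt_single ?_)
      by_cases htop : (ofLex a).orderTop = ⊤
      · rw [htop]; exact WithTop.coe_lt_top _
      · obtain ⟨w, hw⟩ := WithTop.ne_top_iff_exists.1 htop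
        rw [← hw]
        exact_mod_cast h2 w ⟨a, ⟨ha, ha'⟩, hw.symm⟩
    refine ⟨toLex (single h 1), fun a ha => ?_, fun b hb => ?_⟩
    · rcases le_total a0 a with h3 | h3
      · exact key a ha h3
      · exact h3.trans_lt (key a0 ha0 le_rfl)
    · have hb0 : 0 < b := h0.trans_lt (hAB a0 ha0 b hb)
      rw [← abs_of_pos hb0]
      apply single_lt_hahn_abs
      obtain ⟨w, hw⟩ := WithTop.ne_top_iff_exists.1
        (orderTop_ne_top.2 (show ofLex b ≠ 0 from hb0.ne'))
      rw [← hw]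
      exact_mod_cast h1 w ⟨b, hb, hw.symm⟩

/-- Glue the members of `A`, each up to the order of its difference from members of `B`, to a
pseudo-limit `z`. If `z` does not fill the cut, translating it to 0, with a reflection when `z` is
too large, reaches the previous situation. -/
theorem IsEtaOne.hahnSeries : IsEtaOne (Lex (HahnSeries G ℝ)) := by
  intro A B hA hB hAB
  -- the pseudo-limit of the cut
  have hmono : ∀ {x y : Lex (HahnSeries G ℝ)}, 0 ≤ x → x ≤ y →
      (ofLex y).orderTop ≤ (ofLex x).orderTop := by
    intro x y hx hxy
    refine hahn_orderTop_le_of_abs_le ?_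
    rwa [abs_of_nonneg hx, abs_of_nonneg (hx.trans hxy)]
  have hcoeff : ∀ {x y : Lex (HahnSeries G ℝ)} {i : G}, (i : WithTop G) < (ofLex (y - x)).orderTop →
      (ofLex x).coeff i = (ofLex y).coeff i := by
    intro x y i h
    have := coeff_eq_zero_of_lt_orderTop h
    rw [ofLex_sub, HahnSeries.coeff_sub] at this
    linarith
  -- From `a ≤ a' < b` it follows that `a' - a` is at most `b - a`, so `a` and `a'` agree below the
  -- order of `b - a`.
  have hcoh : ∀ a ∈ A, ∀ b ∈ B, ∀ a' ∈ A, a ≤ a' → ∀ i : G,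
      (i : WithTop G) < (ofLex (b - a)).orderTop → (ofLex a).coeff i = (ofLex a').coeff i := by
    intro a ha b hb a' ha' h i hi
    refine hcoeff (hi.trans_le (hmono (sub_nonneg.2 h) ?_))
    linarith [hAB a' ha' b hb]
  obtain ⟨z, hz, -⟩ := exists_hahnSeries_glue (fun p : A × B => ofLex p.1.1)
    (fun p => {i | (i : WithTop G) < (ofLex (p.2.1 - p.1.1)).orderTop})
    (fun p i j hij hi => lt_of_le_of_lt (WithTop.coe_le_coe.2 hij) hi) (by
      rintro ⟨⟨a, ha⟩, ⟨b, hb⟩⟩ ⟨⟨a', ha'⟩, ⟨b', hb'⟩⟩ i hi hi'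
      rcases le_total a a' with h | h
      · exact hcoh a ha b hb a' ha' h i hi
      · exact (hcoh a' ha' b' hb' a ha h i hi').symm)
  have hza : ∀ a ∈ A, ∀ b ∈ B, (ofLex (b - a)).orderTop ≤ (ofLex (a - toLex z)).orderTop := by
    intro a ha b hb
    refine le_orderTop_iff_forall.2 fun i hi => ?_
    rw [ofLex_sub, HahnSeries.coeff_sub, ofLex_toLex, hz ⟨⟨a, ha⟩, ⟨b, hb⟩⟩ i hi, sub_self]
  have hzb : ∀ a ∈ A, ∀ b ∈ B, (ofLex (b - a)).orderTop ≤ (ofLex (b - toLex z)).orderTop := by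
    intro a ha b hb
    refine le_orderTop_iff_forall.2 fun i hi => ?_
    rw [ofLex_sub, HahnSeries.coeff_sub, ofLex_toLex, hz ⟨⟨a, ha⟩, ⟨b, hb⟩⟩ i hi, hcoeff hi,
      sub_self]
  by_cases hA0 : ∃ a ∈ A, toLex z ≤ a
  · obtain ⟨a0, ha0, h0⟩ := hA0
    obtain ⟨x, h1, h2⟩ := hG.exists_between_of_nonneg (hA.image fun a => a - toLex z)
      (hB.image fun a => a - toLex z) (by
        rintro _ ⟨a, ha, rfl⟩ _ ⟨b, hb, rfl⟩
        exact sub_lt_sub_right (hAB a ha b hb) _) (by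
        rintro _ ⟨a, ha, rfl⟩ _ ⟨b, hb, rfl⟩
        rw [sub_sub_sub_cancel_right]
        exact hza a ha b hb) ⟨a0, ha0, rfl⟩ (sub_nonneg.2 h0)
    exact ⟨x + toLex z, fun a ha => sub_lt_iff_lt_add.1 (h1 _ ⟨a, ha, rfl⟩),
      fun b hb => lt_sub_iff_add_lt.1 (h2 _ ⟨b, hb, rfl⟩)⟩
  by_cases hB0 : ∃ b ∈ B, b ≤ toLex z
  · obtain ⟨b0, hb0, h0⟩ := hB0
    obtain ⟨x, h1, h2⟩ := hG.exists_between_of_nonneg (hB.image fun a => toLex z - a)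
      (hA.image fun a => toLex z - a) (by
        rintro _ ⟨b, hb, rfl⟩ _ ⟨a, ha, rfl⟩
        exact sub_lt_sub_left (hAB a ha b hb) _) (by
        rintro _ ⟨b, hb, rfl⟩ _ ⟨a, ha, rfl⟩
        change _ ≤ (ofLex (toLex z - b)).orderTop
        rw [sub_sub_sub_cancel_left, ← neg_sub b (toLex z), ofLex_neg, orderTop_neg]
        exact hzb a ha b hb) ⟨b0, hb0, rfl⟩ (sub_nonneg.2 h0)
    refine ⟨toLex z - x, fun a ha => ?_, fun b hb => ?_⟩
    · linarith [h2 _ ⟨a, ha, rfl⟩]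
    · linarith [h1 _ ⟨b, hb, rfl⟩]
  push Not at hA0 hB0
  exact ⟨toLex z, hA0, hB0⟩

end Hahn
-- Piecewise linear order automorphisms
section OrderAutomorphisms

/-- The pointwise maximum of two order automorphisms. -/
def orderIsoMax {α : Type*} [LinearOrder α] (f g : α ≃o α) : α ≃o α where
  toFun x := max (f x) (g x)
  invFun x := min (f.symm x) (g.symm x)
  left_inv x := by
    rcases le_total (f x) (g x) with h | h
    · simp only [max_eq_right h, g.symm_apply_apply]
      refine min_eq_right ?_
      rw [← f.le_iff_le]; simpa using h
    · simp only [max_eq_left h, f.symm_apply_apply]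
      refine min_eq_left ?_
      rw [← g.le_iff_le]; simpa using h
  right_inv x := by
    rcases le_total (f.symm x) (g.symm x) with h | h
    · simp only [min_eq_left h, f.apply_symm_apply]
      refine max_eq_left ?_
      have := g.monotone h; simpa using this
    · simp only [min_eq_right h, g.apply_symm_apply]
      refine max_eq_right ?_
      have := f.monotone h; simpa using this
  map_rel_iff' {x y} := by
    have h : StrictMono fun x => max (f x) (g x) := fun a b hab =>
      max_lt_max (f.strictMono hab) (g.strictMono hab)
    exact h.le_iff_le

/-- The pointwise minimum of two order automorphisms. -/
def orderIsoMin {α : Type*} [LinearOrder α] (f g : α ≃o α) : α ≃o α :=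
  (orderIsoMax f.symm g.symm).symm

theorem orderIsoMin_apply {α : Type*} [LinearOrder α] (f g : α ≃o α) (x : α) :
    orderIsoMin f g x = min (f x) (g x) := rfl

theorem orderIsoMax_apply {α : Type*} [LinearOrder α] (f g : α ≃o α) (x : α) :
    orderIsoMax f g x = max (f x) (g x) := rfl

variable {K : Type*} [Field K] [LinearOrder K] [IsStrictOrderedRing K]

/-- The affine automorphism `w ↦ y + m * (w - x)`. -/
def affineOrderIso (x y m : K) (hm : 0 < m) : K ≃o K where
  toFun w := y + m * (w - x)
  invFun w := x + m⁻¹ * (w - y)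
  left_inv w := by field_simp; ring
  right_inv w := by field_simp; ring
  map_rel_iff' {a b} := by
    change y + m * (a - x) ≤ y + m * (b - x) ↔ a ≤ b
    rw [add_le_add_iff_left, mul_le_mul_iff_right₀ hm, sub_le_sub_iff_right]

theorem affineOrderIso_apply (x y m : K) (hm : 0 < m) (w : K) :
    affineOrderIso x y m hm w = y + m * (w - x) := rfl

theorem exists_orderIso_move_interval {a x y b : K} (hax : a < x) (hxy : x < y) (hyb : y < b) :
    ∃ τ : K ≃o K, τ x = y ∧ ∀ w, (w ≤ a ∨ b ≤ w) → τ w = w := by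
  have h1 : 0 < (y - a) / (x - a) := div_pos (by linarith) (by linarith)
  have h2 : 0 < (b - y) / (b - x) := div_pos (by linarith) (by linarith)
  -- The two lines run from (a, a) to (x, y) and from (x, y) to (b, b). Their minimum lies below the
  -- identity outside (a, b), so the maximum with the identity is a bump supported there.
  refine ⟨orderIsoMax (OrderIso.refl K)
    (orderIsoMin (affineOrderIso x y _ h1) (affineOrderIso x y _ h2)), ?_, ?_⟩
  · rw [orderIsoMax_apply, orderIsoMin_apply, affineOrderIso_apply, affineOrderIso_apply]
    simp [hxy.le]
  · intro w hw
    rw [orderIsoMax_apply, orderIsoMin_apply, affineOrderIso_apply, affineOrderIso_apply]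
    refine max_eq_left ?_
    change _ ≤ w
    rcases hw with hw | hw
    · refine (min_le_left _ _).trans ?_
      have hxa : 0 < x - a := by linarith
      rw [← sub_nonneg, show w - (y + (y - a) / (x - a) * (w - x)) =
        (a - w) * (y - x) / (x - a) by field_simp; ring]
      exact div_nonneg (mul_nonneg (by linarith) (by linarith)) hxa.le
    · refine (min_le_right _ _).trans ?_
      have hxa : 0 < b - x := by linarith
      rw [← sub_nonneg, show w - (y + (b - y) / (b - x) * (w - x)) =
        (w - b) * (y - x) / (b - x) by field_simp; ring]
      exact div_nonneg (mul_nonneg (by linarith) (by linarith)) hxa.le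

theorem exists_lt_forall_lt_le (S : Finset K) (x : K) :
    ∃ a < x, ∀ w ∈ S, w < x → w ≤ a := by
  by_cases hne : (S.filter (· < x)).Nonempty
  · refine ⟨(S.filter (· < x)).max' hne, ?_, fun w hw hwx => ?_⟩
    · exact (Finset.mem_filter.1 (Finset.max'_mem _ hne)).2
    · exact Finset.le_max' _ _ (Finset.mem_filter.2 ⟨hw, hwx⟩)
  · refine ⟨x - 1, by linarith, fun w hw hwx => ?_⟩
    exact absurd ⟨w, Finset.mem_filter.2 ⟨hw, hwx⟩⟩ hne

theorem exists_gt_forall_gt_le (S : Finset K) (x : K) :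
    ∃ a, x < a ∧ ∀ w ∈ S, x < w → a ≤ w := by
  by_cases hne : (S.filter (x < ·)).Nonempty
  · refine ⟨(S.filter (x < ·)).min' hne, ?_, fun w hw hwx => ?_⟩
    · exact (Finset.mem_filter.1 (Finset.min'_mem _ hne)).2
    · exact Finset.min'_le _ _ (Finset.mem_filter.2 ⟨hw, hwx⟩)
  · refine ⟨x + 1, by linarith, fun w hw hwx => ?_⟩
    exact absurd ⟨w, Finset.mem_filter.2 ⟨hw, hwx⟩⟩ hne

theorem exists_orderIso_move (S : Finset K) (x y : K)
    (h : ∀ w ∈ S, (w < x ∧ w < y) ∨ (x < w ∧ y < w)) :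
    ∃ τ : K ≃o K, τ x = y ∧ ∀ w ∈ S, τ w = w := by
  have key : ∀ x y : K, x < y → (∀ w ∈ S, (w < x ∧ w < y) ∨ (x < w ∧ y < w)) →
      ∃ τ : K ≃o K, τ x = y ∧ ∀ w ∈ S, τ w = w := by
    intro x y hxy h
    obtain ⟨a, ha, ha'⟩ := exists_lt_forall_lt_le S x
    obtain ⟨b, hb, hb'⟩ := exists_gt_forall_gt_le S y
    obtain ⟨τ, h1, h2⟩ := exists_orderIso_move_interval ha hxy hb
    refine ⟨τ, h1, fun w hw => h2 w ?_⟩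
    rcases h w hw with h | h
    · exact Or.inl (ha' w hw h.1)
    · exact Or.inr (hb' w hw h.2)
  rcases lt_trichotomy x y with hxy | rfl | hxy
  · exact key x y hxy h
  · exact ⟨OrderIso.refl K, rfl, fun _ _ => rfl⟩
  · obtain ⟨τ, h1, h2⟩ := key y x hxy fun w hw => (h w hw).imp And.symm And.symm
    refine ⟨τ.symm, by rw [← h1, τ.symm_apply_apply], fun w hw => ?_⟩
    conv_lhs => rw [← h2 w hw]
    exact τ.symm_apply_apply w

/-- A strictly monotone map on a finite subset of an ordered field extends to an order
automorphism. -/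
theorem exists_orderIso_extending (s : Finset K) (e : K → K) (he : StrictMonoOn e s) :
    ∃ σ : K ≃o K, ∀ z ∈ s, σ z = e z := by
  classical
  induction s using Finset.induction_on with
  | empty => exact ⟨OrderIso.refl K, by simp⟩
  | insert z s hz ih =>
    obtain ⟨σ, hσ⟩ := ih (he.mono (by simp))
    obtain ⟨τ, h1, h2⟩ := exists_orderIso_move (s.image e) (σ z) (e z) (by
      intro w hw
      obtain ⟨x, hx, rfl⟩ := Finset.mem_image.1 hw
      have hzm : z ∈ ((insert z s : Finset K) : Set K) := by simp
      have hxm : x ∈ ((insert z s : Finset K) : Set K) := by simp [hx]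
      rcases lt_trichotomy x z with h | rfl | h
      · exact Or.inl ⟨by rw [← hσ x hx]; exact σ.strictMono h, he hxm hzm h⟩
      · exact absurd hx hz
      · exact Or.inr ⟨by rw [← hσ x hx]; exact σ.strictMono h, he hzm hxm h⟩)
    refine ⟨σ.trans τ, fun x hx => ?_⟩
    rw [OrderIso.trans_apply]
    rcases Finset.mem_insert.1 hx with rfl | hx
    · exact h1
    · rw [hσ x hx]
      exact h2 _ (Finset.mem_image_of_mem e hx)

end OrderAutomorphisms

/-! ### Signs of polynomials and Rolle's theorem -/

section PolynomialSigns

open Polynomial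

variable {K : Type*} [Field K] [LinearOrder K] [IsStrictOrderedRing K]

theorem exists_eventually_le_of_leadingCoeff_pos (p : K[X]) (hp : 0 < p.leadingCoeff) :
    ∃ ε > 0, ∃ M, ∀ x ≥ M, ε ≤ p.eval x := by
  induction hn : p.natDegree generalizing p with
  | zero =>
    obtain ⟨c, rfl⟩ := natDegree_eq_zero.1 hn
    rw [leadingCoeff_C] at hp
    exact ⟨c, hp, 0, fun x _ => by simp⟩
  | succ n ih =>
    have hd : p.divX.natDegree = n := by rw [natDegree_divX_eq_natDegree_tsub_one, hn]; rfl
    have hl : p.divX.leadingCoeff = p.leadingCoeff := by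
      rw [Polynomial.leadingCoeff, hd, coeff_divX, Polynomial.leadingCoeff, hn]
    obtain ⟨ε, hε, M, hM⟩ := ih p.divX (hl ▸ hp) hd
    refine ⟨1, one_pos, max (max M 0) ((1 + |p.coeff 0|) / ε), fun x hx => ?_⟩
    have hx1 : M ≤ x := (le_max_left _ _).trans ((le_max_left _ _).trans hx)
    have hx2 : 0 ≤ x := (le_max_right _ _).trans ((le_max_left _ _).trans hx)
    have hx3 : (1 + |p.coeff 0|) / ε ≤ x := (le_max_right _ _).trans hx
    rw [div_le_iff₀ hε] at hx3
    have h1 := congrArg (eval x) (divX_mul_X_add p)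
    rw [eval_add, eval_mul, eval_X, eval_C] at h1
    rw [← h1]
    have := mul_le_mul_of_nonneg_right (hM x hx1) hx2
    linarith [neg_abs_le (p.coeff 0)]

variable (hK : PolynomialIVT K)
include hK

theorem sign_eval_eq_of_no_root (p : K[X]) (a c : K) (h : ∀ x ∈ Set.uIcc a c, p.eval x ≠ 0) :
    SignType.sign (p.eval a) = SignType.sign (p.eval c) := by
  have hpos : 0 < p.eval a * p.eval c := by
    by_contra hc
    rcases le_total a c with hac | hac
    · obtain ⟨x, h1, h2, h3⟩ := hK p a c hac (not_lt.1 hc)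
      exact h x (by rw [Set.uIcc_of_le hac]; exact ⟨h1, h2⟩) h3
    · obtain ⟨x, h1, h2, h3⟩ := hK p c a hac (by rw [mul_comm]; exact not_lt.1 hc)
      exact h x (by rw [Set.uIcc_of_ge hac]; exact ⟨h1, h2⟩) h3
  rcases pos_and_pos_or_neg_and_neg_of_mul_pos hpos with ⟨h1, h2⟩ | ⟨h1, h2⟩
  · rw [sign_pos h1, sign_pos h2]
  · rw [sign_neg h1, sign_neg h2]

theorem sign_eval_eq_sign_leadingCoeff (p : K[X]) (b : K) (h : ∀ x ≥ b, p.eval x ≠ 0) :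
    SignType.sign (p.eval b) = SignType.sign p.leadingCoeff := by
  have key : ∀ p : K[X], (∀ x ≥ b, p.eval x ≠ 0) → 0 < p.leadingCoeff →
      SignType.sign (p.eval b) = 1 := by
    intro p h hp
    obtain ⟨ε, hε, M, hM⟩ := exists_eventually_le_of_leadingCoeff_pos p hp
    rw [sign_eval_eq_of_no_root hK p b (max b M) (by
      intro x hx
      rw [Set.uIcc_of_le (le_max_left _ _)] at hx
      exact h x hx.1)]
    exact sign_pos (hε.trans_le (hM _ (le_max_right _ _)))
  rcases lt_trichotomy p.leadingCoeff 0 with hp | hp | hp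
  · have := key (-p) (by simpa using h) (by simpa using hp)
    rw [eval_neg, Left.sign_neg] at this
    rw [sign_neg hp]
    exact neg_eq_iff_eq_neg.1 this
  · rw [Polynomial.leadingCoeff_eq_zero] at hp
    exact absurd (by simp [hp]) (h b le_rfl)
  · rw [key p h hp, sign_pos hp]

theorem sign_eval_eq_sign_leadingCoeff_bot (p : K[X]) (b : K) (h : ∀ x ≤ b, p.eval x ≠ 0) :
    SignType.sign (p.eval b) = SignType.sign ((-1) ^ p.natDegree * p.leadingCoeff) := by
  have := sign_eval_eq_sign_leadingCoeff hK (p.comp (-X)) (-b) (by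
    intro x hx
    rw [eval_comp, eval_neg, eval_X]
    exact h _ (by linarith))
  rw [eval_comp, eval_neg, eval_X, neg_neg] at this
  rw [this, leadingCoeff_comp (by simp)]
  simp [mul_comm]

/-- Rolle's theorem for polynomials. -/
theorem exists_derivative_root (p : K[X]) (hp : p ≠ 0) {a b : K} (hab : a < b) (ha : p.eval a = 0)
    (hb : p.eval b = 0) : ∃ c, a < c ∧ c < b ∧ p.derivative.eval c = 0 := by
  classical
  -- replace `b` by the next root after `a`
  obtain ⟨b', hb', hmin⟩ := (p.roots.toFinset.filter (a < ·)).exists_minimal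
    ⟨b, by simp [hp, hb, hab]⟩
  simp only [Finset.mem_filter, Multiset.mem_toFinset, mem_roots hp, IsRoot] at hb' hmin
  obtain ⟨hb'0, hab'⟩ := hb'
  have hb'b : b' ≤ b := by
    by_contra hc
    exact hc (hmin ⟨hb, hab⟩ (not_le.1 hc).le)
  have hnr : ∀ x, a < x → x < b' → p.eval x ≠ 0 := fun x h1 h2 h3 =>
    absurd (hmin ⟨h3, h1⟩ h2.le) (not_le.2 h2)
  suffices h : ∃ c, a < c ∧ c < b' ∧ p.derivative.eval c = 0 by
    obtain ⟨c, h1, h2, h3⟩ := h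
    exact ⟨c, h1, h2.trans_le hb'b, h3⟩
  obtain ⟨q, hq, hqa⟩ := exists_eq_pow_rootMultiplicity_mul_and_not_dvd p hp a
  have hq0 : q ≠ 0 := by rintro rfl; simp at hqa
  obtain ⟨s, hs, hsb⟩ := exists_eq_pow_rootMultiplicity_mul_and_not_dvd q hq0 b'
  have hm : 0 < p.rootMultiplicity a := (rootMultiplicity_pos hp).2 ha
  have hqb : q.eval b' = 0 := by
    rw [hq, eval_mul, eval_pow, eval_sub, eval_X, eval_C] at hb'0
    exact (mul_eq_zero.1 hb'0).resolve_left (pow_ne_zero _ (sub_pos.2 hab').ne')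
  have hn : 0 < q.rootMultiplicity b' := (rootMultiplicity_pos hq0).2 hqb
  obtain ⟨m, hm'⟩ := Nat.exists_eq_succ_of_ne_zero hm.ne'
  obtain ⟨n, hn'⟩ := Nat.exists_eq_succ_of_ne_zero hn.ne'
  rw [hm'] at hq
  rw [hn'] at hs
  have hsb0 : s.eval b' ≠ 0 := fun h => hsb (dvd_iff_isRoot.2 h)
  have hsa0 : s.eval a ≠ 0 := fun h => hqa (dvd_iff_isRoot.2 (by
    rw [IsRoot, hs, eval_mul, h, mul_zero]))
  have hps : p = (X - Polynomial.C a) ^ (m + 1) * ((X - Polynomial.C b') ^ (n + 1) * s) := by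
    rw [← hs, ← hq]
  have hss : 0 < s.eval a * s.eval b' := by
    have := sign_eval_eq_of_no_root hK s a b' (by
      intro x hx h0
      rw [Set.uIcc_of_le hab'.le] at hx
      rcases hx.1.eq_or_lt with rfl | h1
      · exact hsa0 h0
      rcases hx.2.eq_or_lt with rfl | h2
      · exact hsb0 h0
      exact hnr x h1 h2 (by rw [hps]; simp [h0]))
    rcases lt_or_gt_of_ne hsa0 with h | h
    · rw [sign_neg h, eq_comm, sign_eq_neg_one_iff] at this
      exact mul_pos_of_neg_of_neg h this
    · rw [sign_pos h, eq_comm, sign_eq_one_iff] at this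
      exact mul_pos h this
  -- Differentiating (X - a)^(m+1) (X - b')^(n+1) s leaves the cofactor `t`, whose values at `a` and
  -- `b'` have opposite signs since `s` keeps its sign on [a, b'].
  let t : K[X] := Polynomial.C (m + 1 : K) * ((X - Polynomial.C b') * s) + Polynomial.C (n + 1 : K) * ((X - Polynomial.C a) * s) +
    (X - Polynomial.C a) * (X - Polynomial.C b') * s.derivative
  have hder : p.derivative = (X - Polynomial.C a) ^ m * (X - Polynomial.C b') ^ n * t := by
    rw [hps]
    simp only [derivative_mul, derivative_pow, derivative_sub, derivative_X, derivative_C, t,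
      Nat.add_sub_cancel, sub_zero, mul_one, Nat.cast_add, Nat.cast_one, map_add, map_natCast,
      map_one]
    ring
  have hta : t.eval a = (m + 1 : K) * ((a - b') * s.eval a) := by simp [t]
  have htb : t.eval b' = (n + 1 : K) * ((b' - a) * s.eval b') := by simp [t]
  have hm1 : (0 : K) < m + 1 := by positivity
  have hn1 : (0 : K) < n + 1 := by positivity
  have htab : t.eval a * t.eval b' < 0 := by
    have : t.eval a * t.eval b' =
        -((m + 1 : K) * (n + 1) * ((b' - a) * (b' - a)) * (s.eval a * s.eval b')) := by
      rw [hta, htb]; ring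
    rw [this, neg_lt_zero]
    have := sub_pos.2 hab'
    positivity
  obtain ⟨c, h1, h2, h3⟩ := hK t a b' hab'.le htab.le
  refine ⟨c, h1.lt_of_ne ?_, h2.lt_of_ne ?_, by rw [hder, eval_mul, h3, mul_zero]⟩
  · rintro rfl
    rw [h3, zero_mul] at htab
    exact lt_irrefl _ htab
  · rintro rfl
    rw [h3, mul_zero] at htab
    exact lt_irrefl _ htab

end PolynomialSigns
-- Sign patterns up to order automorphism
section SignPatterns

/-- `s` behaves like the sign of a function that is continuous and strictly monotone on each of the
intervals cut out by the finite set `Z`, and that has no zeros outside the convex hull of `Z`. -/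
structure IsSignPattern {K : Type*} [LinearOrder K] (s : K → SignType) (Z : Finset K) : Prop where
  exists_zero : ∀ a b, a < b → (∀ z ∈ Z, ¬ (a < z ∧ z < b)) → s a ≠ 0 → s b ≠ 0 → s a ≠ s b →
    ∃ c, a < c ∧ c < b ∧ s c = 0
  ne_of_zero : ∀ a c b, a < c → c < b → (∀ z ∈ Z, ¬ (a < z ∧ z < b)) → s c = 0 → s a ≠ s b
  not_zero_zero : ∀ a b, a < b → (∀ z ∈ Z, ¬ (a < z ∧ z < b)) → s a = 0 → s b ≠ 0
  eq_bot : ∀ c, ∀ z ∈ Z, c ≤ z → (∀ w ∈ Z, z ≤ w) → s c = s z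
  eq_top : ∀ c, ∀ z ∈ Z, z ≤ c → (∀ w ∈ Z, w ≤ z) → s c = s z
  finite_zeros : {c | s c = 0}.Finite
  nonempty : Z.Nonempty

theorem Finset.exists_gap {K : Type*} [LinearOrder K] (Z : Finset K) (hZ : Z.Nonempty) (c : K)
    (hc : c ∉ Z) :
    (∃ z ∈ Z, c < z ∧ ∀ w ∈ Z, z ≤ w) ∨ (∃ z ∈ Z, z < c ∧ ∀ w ∈ Z, w ≤ z) ∨
      ∃ a ∈ Z, ∃ b ∈ Z, a < c ∧ c < b ∧ ∀ z ∈ Z, ¬ (a < z ∧ z < b) := by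
  by_cases h1 : (Z.filter (· < c)).Nonempty
  · by_cases h2 : (Z.filter (c < ·)).Nonempty
    · obtain ⟨a, ha⟩ := (Z.filter (· < c)).exists_maximal h1
      obtain ⟨b, hb⟩ := (Z.filter (c < ·)).exists_minimal h2
      have ha' := Finset.mem_filter.1 ha.1
      have hb' := Finset.mem_filter.1 hb.1
      refine Or.inr (Or.inr ⟨a, ha'.1, b, hb'.1, ha'.2, hb'.2, fun z hz h => ?_⟩)
      rcases lt_or_gt_of_ne (show z ≠ c from fun h => hc (h ▸ hz)) with h3 | h3
      · exact absurd (ha.2 (Finset.mem_filter.2 ⟨hz, h3⟩) h.1.le) (not_le.2 h.1)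
      · exact absurd (hb.2 (Finset.mem_filter.2 ⟨hz, h3⟩) h.2.le) (not_le.2 h.2)
    · have h3 : ∀ z ∈ Z, z < c := fun z hz => by
        refine lt_of_le_of_ne (not_lt.1 fun h => h2 ⟨z, Finset.mem_filter.2 ⟨hz, h⟩⟩) ?_
        rintro rfl
        exact hc hz
      exact Or.inr (Or.inl ⟨Z.max' hZ, Z.max'_mem hZ, h3 _ (Z.max'_mem hZ), fun w hw =>
        Z.le_max' w hw⟩)
  · have h3 : ∀ z ∈ Z, c < z := fun z hz => by
      refine lt_of_le_of_ne (not_lt.1 fun h => h1 ⟨z, Finset.mem_filter.2 ⟨hz, h⟩⟩) ?_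
      rintro rfl
      exact hc hz
    exact Or.inl ⟨Z.min' hZ, Z.min'_mem hZ, h3 _ (Z.min'_mem hZ), fun w hw => Z.min'_le w hw⟩

namespace IsSignPattern

variable {K : Type*} [LinearOrder K] {s t : K → SignType} {Z : Finset K}

theorem ne_zero_right (hs : IsSignPattern s Z) {a c b : K} (hac : a < c) (hcb : c < b)
    (hf : ∀ z ∈ Z, ¬ (a < z ∧ z < b)) (hc : s c = 0) : s b ≠ 0 :=
  hs.not_zero_zero c b hcb (fun z hz h => hf z hz ⟨hac.trans h.1, h.2⟩) hc

theorem ne_zero_left (hs : IsSignPattern s Z) {a c b : K} (hac : a < c) (hcb : c < b)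
    (hf : ∀ z ∈ Z, ¬ (a < z ∧ z < b)) (hc : s c = 0) : s a ≠ 0 := fun ha =>
  hs.not_zero_zero a c hac (fun z hz h => hf z hz ⟨h.1, h.2.trans hcb⟩) ha hc

/-- A zero not in `Z` of one pattern corresponds to a zero in the same gap of the other one. -/
theorem exists_zero_same_gap (hs : IsSignPattern s Z) (ht : IsSignPattern t Z)
    (hst : ∀ z ∈ Z, s z = t z) (c : K) (hc : c ∉ Z) (h0 : s c = 0) :
    ∃ d, t d = 0 ∧ ∀ z ∈ Z, (z < c → z < d) ∧ (c < z → d < z) := by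
  rcases Finset.exists_gap Z hs.nonempty c hc with ⟨z, hz, hcz, hmin⟩ | ⟨z, hz, hzc, hmax⟩ |
    ⟨a, ha, b, hb, hac, hcb, hf⟩
  · refine absurd ?_ (hs.not_zero_zero c z hcz (fun w hw h => not_le.2 h.2 (hmin w hw)) h0)
    rw [← hs.eq_bot c z hz hcz.le hmin, h0]
  · refine absurd h0 (hs.not_zero_zero z c hzc (fun w hw h => not_le.2 h.1 (hmax w hw)) ?_)
    rw [← hs.eq_top c z hz hzc.le hmax, h0]
  · have h1 := hs.ne_zero_left hac hcb hf h0
    have h2 := hs.ne_zero_right hac hcb hf h0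
    have h3 := hs.ne_of_zero a c b hac hcb hf h0
    rw [hst a ha] at h1 h3
    rw [hst b hb] at h2 h3
    obtain ⟨d, had, hdb, hd⟩ := ht.exists_zero a b (hac.trans hcb) hf h1 h2 h3
    refine ⟨d, hd, fun z hz => ⟨fun h => ?_, fun h => ?_⟩⟩
    · exact lt_of_le_of_lt (not_lt.1 fun h' => hf z hz ⟨h', h.trans hcb⟩) had
    · exact lt_of_lt_of_le hdb (not_lt.1 fun h' => hf z hz ⟨hac.trans h, h'⟩)

/-- A sign different from the one at `a` would force a second zero before `d`, but a gap has at most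
one zero. -/
theorem eq_left_of_zero (hs : IsSignPattern s Z) {a c d b : K} (hac : a < c) (hcd : c < d)
    (hdb : d < b) (hf : ∀ z ∈ Z, ¬ (a < z ∧ z < b)) (hd : s d = 0) : s c = s a := by
  by_contra hne
  have h1 := hs.ne_zero_left (hac.trans hcd) hdb hf hd
  have h2 : s c ≠ 0 := fun h =>
    hs.not_zero_zero c d hcd (fun z hz h => hf z hz ⟨hac.trans h.1, h.2.trans hdb⟩) h hd
  obtain ⟨x, hax, hxc, hx⟩ := hs.exists_zero a c hac
    (fun z hz h => hf z hz ⟨h.1, h.2.trans (hcd.trans hdb)⟩) h1 h2 (Ne.symm hne)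
  exact hs.not_zero_zero x d (hxc.trans hcd)
    (fun z hz h => hf z hz ⟨hax.trans h.1, h.2.trans hdb⟩) hx hd

theorem eq_right_of_zero (hs : IsSignPattern s Z) {a c d b : K} (had : a < d) (hdc : d < c)
    (hcb : c < b) (hf : ∀ z ∈ Z, ¬ (a < z ∧ z < b)) (hd : s d = 0) : s c = s b := by
  by_contra hne
  have h1 := hs.ne_zero_right had (hdc.trans hcb) hf hd
  have h2 : s c ≠ 0 :=
    hs.not_zero_zero d c hdc (fun z hz h => hf z hz ⟨had.trans h.1, h.2.trans hcb⟩) hd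
  obtain ⟨x, hcx, hxb, hx⟩ := hs.exists_zero c b hcb
    (fun z hz h => hf z hz ⟨had.trans (hdc.trans h.1), h.2⟩) h2 h1 hne
  exact hs.not_zero_zero d x (hdc.trans hcx)
    (fun z hz h => hf z hz ⟨had.trans h.1, h.2.trans hxb⟩) hd hx

theorem eq_of_no_zero (hs : IsSignPattern s Z) {a c b : K} (hac : a < c) (hcb : c < b)
    (hf : ∀ z ∈ Z, ¬ (a < z ∧ z < b)) (h : ∀ d, a < d → d < b → s d ≠ 0) :
    (s a ≠ 0 → s c = s a) ∧ (s b ≠ 0 → s c = s b) := by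
  refine ⟨fun ha => by_contra fun hne => ?_, fun hb => by_contra fun hne => ?_⟩
  · obtain ⟨x, h1, h2, h3⟩ := hs.exists_zero a c hac (fun z hz h => hf z hz ⟨h.1, h.2.trans hcb⟩)
      ha (h c hac hcb) (Ne.symm hne)
    exact h x h1 (h2.trans hcb) h3
  · obtain ⟨x, h1, h2, h3⟩ := hs.exists_zero c b hcb (fun z hz h => hf z hz ⟨hac.trans h.1, h.2⟩)
      (h c hac hcb) hb hne
    exact h x (hac.trans h1) h2 h3

/-- Sign patterns that agree on `Z` are equal up to an order automorphism that fixes `Z`. -/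
theorem exists_orderIso {K : Type*} [Field K] [LinearOrder K] [IsStrictOrderedRing K]
    {s t : K → SignType} {Z : Finset K} (hs : IsSignPattern s Z) (ht : IsSignPattern t Z)
    (hst : ∀ z ∈ Z, s z = t z) :
    ∃ σ : K ≃o K, (∀ z ∈ Z, σ z = z) ∧ ∀ c, s c = t (σ c) := by
  classical
  have hex := hs.exists_zero_same_gap ht hst
  choose f hf0 hf using hex
  let e : K → K := fun c => if h : c ∉ Z ∧ s c = 0 then f c h.1 h.2 else c
  have he1 : ∀ z ∈ Z, e z = z := fun z hz => dif_neg fun h => h.1 hz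
  have he2 : ∀ c, c ∉ Z → s c = 0 → t (e c) = 0 ∧ ∀ z ∈ Z, (z < c → z < e c) ∧ (c < z → e c < z) :=
    fun c h1 h2 => by
      simp only [e, dif_pos (And.intro h1 h2)]
      exact ⟨hf0 c h1 h2, hf c h1 h2⟩
  -- Two zeros of `s` outside `Z` are separated by a point of `Z`, and `e` keeps each zero in its
  -- gap.
  have hmono : StrictMonoOn e ((Z ∪ hs.finite_zeros.toFinset : Finset K) : Set K) := by
    intro x hx y hy hxy
    have hx' : x ∈ Z ∨ s x = 0 := by simpa using hx
    have hy' : y ∈ Z ∨ s y = 0 := by simpa using hy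
    by_cases hxZ : x ∈ Z
    · by_cases hyZ : y ∈ Z
      · rwa [he1 x hxZ, he1 y hyZ]
      · rw [he1 x hxZ]
        exact ((he2 y hyZ (hy'.resolve_left hyZ)).2 x hxZ).1 hxy
    · have hx0 := hx'.resolve_left hxZ
      by_cases hyZ : y ∈ Z
      · rw [he1 y hyZ]
        exact ((he2 x hxZ hx0).2 y hyZ).2 hxy
      · have hy0 := hy'.resolve_left hyZ
        have : ∃ z ∈ Z, x < z ∧ z < y := by
          by_contra hno
          push Not at hno
          exact hs.not_zero_zero x y hxy (fun z hz h => not_lt.2 (hno z hz h.1) h.2) hx0 hy0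
        obtain ⟨z, hz, h1, h2⟩ := this
        exact (((he2 x hxZ hx0).2 z hz).2 h1).trans (((he2 y hyZ hy0).2 z hz).1 h2)
  obtain ⟨σ, hσ⟩ := exists_orderIso_extending _ e hmono
  have hσZ : ∀ z ∈ Z, σ z = z := fun z hz => by
    rw [hσ z (by simp [hz]), he1 z hz]
  have hσ0 : ∀ c, s c = 0 → t (σ c) = 0 := fun c hc => by
    rw [hσ c (by simp [hc])]
    by_cases hcZ : c ∈ Z
    · rw [he1 c hcZ, ← hst c hcZ, hc]
    · exact (he2 c hcZ hc).1
  refine ⟨σ, hσZ, fun c => ?_⟩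
  by_cases hcZ : c ∈ Z
  · rw [hσZ c hcZ, hst c hcZ]
  by_cases hc0 : s c = 0
  · rw [hc0, hσ0 c hc0]
  have hlt : ∀ {x y : K}, x < y → σ x < σ y := fun h => σ.strictMono h
  rcases Finset.exists_gap Z hs.nonempty c hcZ with ⟨z, hz, hcz, hmin⟩ | ⟨z, hz, hzc, hmax⟩ |
    ⟨a, ha, b, hb, hac, hcb, hfr⟩
  · rw [hs.eq_bot c z hz hcz.le hmin, hst z hz]
    exact (ht.eq_bot _ z hz (by have := (hlt hcz).le; rwa [hσZ z hz] at this) hmin).symm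
  · rw [hs.eq_top c z hz hzc.le hmax, hst z hz]
    exact (ht.eq_top _ z hz (by have := (hlt hzc).le; rwa [hσZ z hz] at this) hmax).symm
  have hac' : a < σ c := by have := hlt hac; rwa [hσZ a ha] at this
  have hcb' : σ c < b := by have := hlt hcb; rwa [hσZ b hb] at this
  by_cases hz : ∃ d, a < d ∧ d < b ∧ s d = 0
  · obtain ⟨d, had, hdb, hd⟩ := hz
    have had' : a < σ d := by have := hlt had; rwa [hσZ a ha] at this
    have hdb' : σ d < b := by have := hlt hdb; rwa [hσZ b hb] at this
    rcases lt_trichotomy c d with hcd | rfl | hdc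
    · rw [hs.eq_left_of_zero hac hcd hdb hfr hd, hst a ha,
        ht.eq_left_of_zero hac' (hlt hcd) hdb' hfr (hσ0 d hd)]
    · exact absurd hd hc0
    · rw [hs.eq_right_of_zero had hdc hcb hfr hd, hst b hb,
        ht.eq_right_of_zero had' (hlt hdc) hcb' hfr (hσ0 d hd)]
  · push Not at hz
    have hz' : ∀ d, a < d → d < b → t d ≠ 0 := by
      intro d h1 h2 h3
      have hdZ : d ∉ Z := fun h => hfr d h ⟨h1, h2⟩
      obtain ⟨x, hx, hx'⟩ := ht.exists_zero_same_gap hs (fun z hz => (hst z hz).symm) d hdZ h3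
      exact hz x ((hx' a ha).1 h1) ((hx' b hb).2 h2) hx
    have hS := hs.eq_of_no_zero hac hcb hfr hz
    have hT := ht.eq_of_no_zero hac' hcb' hfr hz'
    by_cases h : s a = 0
    · have hb0 := hs.not_zero_zero a b (hac.trans hcb) hfr h
      rw [hS.2 hb0, hst b hb, hT.2 (hst b hb ▸ hb0)]
    · rw [hS.1 h, hst a ha, hT.1 (hst a ha ▸ h)]

end IsSignPattern

open Polynomial

variable {K : Type*} [Field K] [LinearOrder K] [IsStrictOrderedRing K]

/-- By Rolle's theorem a gap without critical points contains at most one root, and that root is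
simple. The cofactor keeps its sign across the gap, so the polynomial changes sign. Outside [A, B]
there are no roots. -/
theorem IsSignPattern.of_polynomial (hK : PolynomialIVT K) (p : K[X]) (hp : p ≠ 0) (σ : K ≃o K)
    (Z : Finset K) (hd : ∀ c, p.derivative.eval (σ c) = 0 → c ∈ Z) {A B : K} (hA : A ∈ Z)
    (hB : B ∈ Z) (hA' : ∀ c, p.eval (σ c) = 0 → A < c) (hB' : ∀ c, p.eval (σ c) = 0 → c < B)
    (hAZ : ∀ z ∈ Z, A ≤ z) (hBZ : ∀ z ∈ Z, z ≤ B) :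
    IsSignPattern (fun c => SignType.sign (p.eval (σ c))) Z := by
  have hfree : ∀ {a b : K}, (∀ z ∈ Z, ¬ (a < z ∧ z < b)) →
      ∀ x, σ a < x → x < σ b → p.derivative.eval x ≠ 0 := fun {a b} hf x h1 h2 h3 => by
    refine hf (σ.symm x) (hd _ (by simpa using h3)) ⟨?_, ?_⟩
    · rw [← σ.lt_iff_lt]; simpa using h1
    · rw [← σ.lt_iff_lt]; simpa using h2
  refine ⟨?_, ?_, ?_, ?_, ?_, ?_, ⟨A, hA⟩⟩
  · intro a b hab _ ha hb hne
    by_contra hno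
    push Not at hno
    refine hne (sign_eval_eq_of_no_root hK p _ _ fun x hx h0 => ?_)
    rw [Set.uIcc_of_le (σ.strictMono hab).le] at hx
    rcases hx.1.eq_or_lt with rfl | h1
    · exact ha (by simp [h0])
    rcases hx.2.eq_or_lt with rfl | h2
    · exact hb (by simp [h0])
    refine hno (σ.symm x) ?_ ?_ (by simp [h0])
    · rw [← σ.lt_iff_lt]; simpa using h1
    · rw [← σ.lt_iff_lt]; simpa using h2
  · intro a c b hac hcb hf hc
    have hc0 : p.eval (σ c) = 0 := sign_eq_zero_iff.1 hc
    obtain ⟨g, hg⟩ := dvd_iff_isRoot.2 hc0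
    have hlt1 := σ.strictMono hac
    have hlt2 := σ.strictMono hcb
    have hgs := sign_eval_eq_of_no_root hK g (σ a) (σ b) (by
      intro x hx h0
      rw [Set.uIcc_of_le (hlt1.trans hlt2).le] at hx
      have hpx : p.eval x = 0 := by rw [hg, eval_mul, h0, mul_zero]
      rcases lt_trichotomy x (σ c) with h | rfl | h
      · obtain ⟨y, h1, h2, h3⟩ := exists_derivative_root hK p hp h hpx hc0
        exact hfree hf y (hx.1.trans_lt h1) (h2.trans hlt2) h3
      · refine hfree hf _ hlt1 hlt2 ?_
        rw [hg]; simp [derivative_mul, h0]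
      · obtain ⟨y, h1, h2, h3⟩ := exists_derivative_root hK p hp h hc0 hpx
        exact hfree hf y (hlt1.trans h1) (h2.trans_le hx.2) h3)
    have hga : g.eval (σ a) ≠ 0 := by
      intro h0
      have hpx : p.eval (σ a) = 0 := by rw [hg, eval_mul, h0, mul_zero]
      obtain ⟨y, h1, h2, h3⟩ := exists_derivative_root hK p hp hlt1 hpx hc0
      exact hfree hf y h1 (h2.trans hlt2) h3
    have e1 : SignType.sign (σ a - σ c) = -1 := sign_neg (sub_neg.2 hlt1)
    have e2 : SignType.sign (σ b - σ c) = 1 := sign_pos (sub_pos.2 hlt2)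
    have hga' : SignType.sign (g.eval (σ a)) ≠ 0 := fun h => hga (sign_eq_zero_iff.1 h)
    simp only [hg, eval_mul, eval_sub, eval_X, eval_C, sign_mul, ← hgs, e1, e2]
    revert hga'
    generalize SignType.sign (g.eval (σ a)) = x
    revert x
    decide
  · intro a b hab hf ha hb
    obtain ⟨y, h1, h2, h3⟩ := exists_derivative_root hK p hp (σ.strictMono hab)
      (sign_eq_zero_iff.1 ha) (sign_eq_zero_iff.1 hb)
    exact hfree hf y h1 h2 h3
  · intro c z hz hcz hmin
    have hzA : z = A := le_antisymm (hmin A hA) (hAZ z hz)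
    subst hzA
    have key : ∀ c ≤ z, SignType.sign (p.eval (σ c)) =
        SignType.sign ((-1) ^ p.natDegree * p.leadingCoeff) := fun c hc => by
      refine sign_eval_eq_sign_leadingCoeff_bot hK p _ fun x hx h0 => ?_
      have := hA' (σ.symm x) (by simpa using h0)
      rw [← σ.lt_iff_lt, σ.apply_symm_apply] at this
      exact absurd (hx.trans (σ.monotone hc)) (not_le.2 this)
    simp only [key c hcz, key z le_rfl]
  · intro c z hz hcz hmax
    have hzB : z = B := le_antisymm (hBZ z hz) (hmax B hB)
    subst hzB
    have key : ∀ c ≥ z, SignType.sign (p.eval (σ c)) =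
        SignType.sign p.leadingCoeff := fun c hc => by
      refine sign_eval_eq_sign_leadingCoeff hK p _ fun x hx h0 => ?_
      have := hB' (σ.symm x) (by simpa using h0)
      rw [← σ.lt_iff_lt, σ.apply_symm_apply] at this
      exact absurd ((σ.monotone hc).trans hx) (not_le.2 this)
    simp only [key c hcz, key z le_rfl]
  · have : {c | SignType.sign (p.eval (σ c)) = 0} ⊆ σ ⁻¹' (p.roots.toFinset : Set K) := by
      intro c hc
      simpa [hp] using hc
    exact ((p.roots.toFinset.finite_toSet).preimage σ.injective.injOn).subset this

/-- Two polynomials of the same degree, with leading coefficients of the same sign, whose signs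
agree at a finite set containing the critical points have the same sign up to an order
automorphism. -/
theorem exists_orderIso_sign_eval_eq (hK : PolynomialIVT K) (p q : K[X]) (hp : p ≠ 0) (hq : q ≠ 0)
    (hdeg : p.natDegree = q.natDegree)
    (hlead : SignType.sign p.leadingCoeff = SignType.sign q.leadingCoeff)
    (σ : K ≃o K) (Z : Finset K) (hdp : ∀ c, p.derivative.eval c = 0 → c ∈ Z)
    (hdq : ∀ c, q.derivative.eval (σ c) = 0 → c ∈ Z)
    (hZ : ∀ z ∈ Z, SignType.sign (p.eval z) = SignType.sign (q.eval (σ z))) :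
    ∃ τ : K ≃o K, (∀ z ∈ Z, τ z = z) ∧
      ∀ c, SignType.sign (p.eval c) = SignType.sign (q.eval (σ (τ c))) := by
  classical
  let F : Finset K := Z ∪ p.roots.toFinset ∪ q.roots.toFinset.image σ.symm
  obtain ⟨A, hA⟩ := F.finite_toSet.bddBelow
  obtain ⟨B, hB⟩ := F.finite_toSet.bddAbove
  have hA : ∀ c ∈ F, A - 1 < c := fun c hc => by linarith [hA (Finset.mem_coe.2 hc)]
  have hB : ∀ c ∈ F, c < max A B + 1 := fun c hc => by
    linarith [hB (Finset.mem_coe.2 hc), le_max_right A B]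
  have hAB : A - 1 ≤ max A B + 1 := by linarith [le_max_left A B]
  have hFZ : ∀ c ∈ Z, c ∈ F := fun c hc => by simp [F, hc]
  have hFp : ∀ c, p.eval c = 0 → c ∈ F := fun c hc => by simp [F, hc, hp]
  have hFq : ∀ c, q.eval (σ c) = 0 → c ∈ F := fun c hc => by
    simp only [F, Finset.mem_union, Finset.mem_image]
    exact Or.inr ⟨σ c, by simp [hq, hc], by simp⟩
  -- Two points beyond all roots are adjoined. The signs there agree by the hypotheses on degrees
  -- and leading coefficients.
  let Z' : Finset K := insert (A - 1) (insert (max A B + 1) Z)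
  have hAZ : ∀ z ∈ Z', A - 1 ≤ z := by
    intro z hz
    simp only [Z', Finset.mem_insert] at hz
    rcases hz with rfl | rfl | hz
    · exact le_rfl
    · exact hAB
    · exact (hA z (hFZ z hz)).le
  have hBZ : ∀ z ∈ Z', z ≤ max A B + 1 := by
    intro z hz
    simp only [Z', Finset.mem_insert] at hz
    rcases hz with rfl | rfl | hz
    · exact hAB
    · exact le_rfl
    · exact (hB z (hFZ z hz)).le
  have hs := IsSignPattern.of_polynomial hK p hp (OrderIso.refl K) Z'
    (fun c hc => by simp [Z', hdp c hc]) (A := A - 1) (B := max A B + 1) (by simp [Z'])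
    (by simp [Z']) (fun c hc => hA c (hFp c hc)) (fun c hc => hB c (hFp c hc)) hAZ hBZ
  have ht := IsSignPattern.of_polynomial hK q hq σ Z'
    (fun c hc => by simp [Z', hdq c hc]) (A := A - 1) (B := max A B + 1) (by simp [Z'])
    (by simp [Z']) (fun c hc => hA c (hFq c hc)) (fun c hc => hB c (hFq c hc)) hAZ hBZ
  obtain ⟨τ, h1, h2⟩ := hs.exists_orderIso ht (by
    intro z hz
    simp only [Z', Finset.mem_insert] at hz
    rcases hz with rfl | rfl | hz
    · change SignType.sign (p.eval (A - 1)) = _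
      rw [sign_eval_eq_sign_leadingCoeff_bot hK p _ fun x hx h0 =>
          absurd hx (not_le.2 (hA x (hFp x h0))),
        sign_eval_eq_sign_leadingCoeff_bot hK q _ fun x hx h0 => by
          refine absurd (hA (σ.symm x) (hFq _ (by simpa using h0))) (not_lt.2 ?_)
          rw [← σ.le_iff_le]; simpa using hx, sign_mul, sign_mul, hlead, hdeg]
    · change SignType.sign (p.eval (max A B + 1)) = _
      rw [sign_eval_eq_sign_leadingCoeff hK p _ fun x hx h0 =>
          absurd hx (not_le.2 (hB x (hFp x h0))),
        sign_eval_eq_sign_leadingCoeff hK q _ fun x hx h0 => by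
          refine absurd (hB (σ.symm x) (hFq _ (by simpa using h0))) (not_lt.2 ?_)
          rw [← σ.le_iff_le]; simpa using hx, hlead]
    · exact hZ z hz)
  exact ⟨τ, fun z hz => h1 z (by simp [Z', hz]), h2⟩

end SignPatterns
-- Elimination by the Cohen–Hörmander method
section SignElimination

open Polynomial

/-- Repeated cancellation of leading terms, with a second factor of the leading coefficient at each
step. The power is kept even so that multiplying by it does not alter signs. -/
theorem exists_pseudo_rem {R : Type*} [CommRing R] (q : R[X]) (hq : 1 ≤ q.natDegree) (p : R[X]) :
    ∃ (k : ℕ) (s r : R[X]), r.natDegree < q.natDegree ∧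
      Polynomial.C q.leadingCoeff ^ (2 * k) * p = q * s + r := by
  induction hn : p.natDegree using Nat.strong_induction_on generalizing p with
  | _ n ih =>
    by_cases hlt : p.natDegree < q.natDegree
    · exact ⟨0, 0, p, hlt, by simp⟩
    rw [not_lt] at hlt
    let p₁ := Polynomial.C q.leadingCoeff * p -
      Polynomial.C p.leadingCoeff * (X ^ (p.natDegree - q.natDegree) * q)
    have h1 : p₁.natDegree ≤ p.natDegree := by
      refine (natDegree_sub_le _ _).trans (max_le (natDegree_C_mul_le _ _) ?_)
      refine (natDegree_C_mul_le _ _).trans (natDegree_mul_le.trans ?_)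
      have := natDegree_X_pow_le (R := R) (p.natDegree - q.natDegree)
      omega
    have h2 : p₁.coeff p.natDegree = 0 := by
      have : (X ^ (p.natDegree - q.natDegree) * q).coeff p.natDegree = q.leadingCoeff := by
        conv_lhs => rw [← Nat.add_sub_cancel' hlt]
        rw [Nat.add_sub_cancel' hlt, coeff_X_pow_mul', if_pos (Nat.sub_le _ _),
          Nat.sub_sub_self hlt]
        rfl
      simp only [p₁, Polynomial.coeff_sub, coeff_C_mul, this, coeff_natDegree]
      ring
    have h3 : p₁.natDegree < n := by
      refine hn ▸ lt_of_le_of_ne h1 fun h => ?_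
      rw [← h, coeff_natDegree, Polynomial.leadingCoeff_eq_zero] at h2
      rw [h2, natDegree_zero] at h
      omega
    obtain ⟨k, s, r, hr, h⟩ := ih _ h3 p₁ rfl
    refine ⟨k + 1, Polynomial.C q.leadingCoeff * s + Polynomial.C q.leadingCoeff ^ (2 * k + 1) *
      (Polynomial.C p.leadingCoeff * X ^ (p.natDegree - q.natDegree)),
      Polynomial.C q.leadingCoeff * r, (natDegree_C_mul_le _ _).trans_lt hr, ?_⟩
    have h' : Polynomial.C q.leadingCoeff ^ (2 * k) * (Polynomial.C q.leadingCoeff * p) = q * s + r +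
        Polynomial.C q.leadingCoeff ^ (2 * k) *
          (Polynomial.C p.leadingCoeff * (X ^ (p.natDegree - q.natDegree) * q)) := by
      rw [← h]; ring
    calc _ = Polynomial.C q.leadingCoeff *
        (Polynomial.C q.leadingCoeff ^ (2 * k) * (Polynomial.C q.leadingCoeff * p)) := by ring
      _ = _ := by rw [h']; ring

/-- The part of a polynomial of degree at most `j`. -/
noncomputable def truncDegree {R : Type*} [CommRing R] (p : R[X]) (j : ℕ) : R[X] :=
  ∑ i ∈ Finset.range (j + 1), monomial i (p.coeff i)

theorem coeff_truncDegree {R : Type*} [CommRing R] (p : R[X]) (j i : ℕ) :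
    (truncDegree p j).coeff i = if i ≤ j then p.coeff i else 0 := by
  simp only [truncDegree, finsetSum_coeff, coeff_monomial]
  rw [Finset.sum_ite_eq' (Finset.range (j + 1)) i]
  simp

theorem natDegree_truncDegree_le {R : Type*} [CommRing R] (p : R[X]) (j : ℕ) :
    (truncDegree p j).natDegree ≤ j := by
  rw [natDegree_le_iff_coeff_eq_zero]
  intro i hi
  rw [coeff_truncDegree, if_neg (not_le.2 hi)]

/-- Specialization may kill top coefficients. Truncation at the surviving degree gives a polynomial
over `R` with nonvanishing specialized leading coefficient, so pseudo-division over `R` can be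
specialized. -/
theorem map_truncDegree {R S : Type*} [CommRing R] [CommRing S] (p : R[X]) (j : ℕ) (u : R →+* S)
    (h : ∀ i, j < i → u (p.coeff i) = 0) : (truncDegree p j).map u = p.map u := by
  ext i
  rw [coeff_map, coeff_map, coeff_truncDegree]
  split_ifs with hi
  · rfl
  · rw [h i (not_le.1 hi), map_zero]

variable {R K : Type*} [CommRing R] [Field K] [LinearOrder K] [IsStrictOrderedRing K]

/-- An automorphism fixing the roots cannot move a point across one. -/
theorem sign_eval_eq_of_fixes_roots (hK : PolynomialIVT K) (w : K[X]) (τ : K ≃o K)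
    (hτ : ∀ z, w ≠ 0 → w.eval z = 0 → τ z = z) (c : K) :
    SignType.sign (w.eval (τ c)) = SignType.sign (w.eval c) := by
  by_cases hw : w = 0
  · simp [hw]
  by_cases hc : w.eval c = 0
  · rw [hτ c hw hc]
  refine (sign_eval_eq_of_no_root hK w _ _ fun x hx h0 => ?_).symm
  have hx0 := hτ x hw h0
  refine hc ?_
  rcases Set.mem_uIcc.1 hx with ⟨h1, h2⟩ | ⟨h1, h2⟩
  · have := τ.injective (le_antisymm (τ.monotone h1) (hx0.le.trans h2))
    rwa [this]
  · have := τ.injective (le_antisymm (τ.monotone h2) (h1.trans hx0.ge))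
    rwa [← this]

/-- The sign patterns of the polynomials in `Q`, with coefficients specialized to `K`, are
determined up to an order automorphism of `K` by the signs of finitely many elements of `R`. -/
def SignsDetermined (K : Type*) [Field K] [LinearOrder K] (Q : Finset R[X]) : Prop :=
  ∃ S : Finset R, ∀ u v : R →+* K, (∀ r ∈ S, SignType.sign (u r) = SignType.sign (v r)) →
    ∃ σ : K ≃o K, ∀ P ∈ Q, ∀ c,
      SignType.sign ((P.map u).eval c) = SignType.sign ((P.map v).eval (σ c))

theorem exists_truncDegree_pseudo_rem (P W : R[X]) (j : ℕ) : ∃ r : R[X],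
    r.natDegree < max 1 j ∧ (1 ≤ (truncDegree W j).natDegree → ∃ (k : ℕ) (s : R[X]),
      Polynomial.C (truncDegree W j).leadingCoeff ^ (2 * k) * P = truncDegree W j * s + r) := by
  by_cases h : 1 ≤ (truncDegree W j).natDegree
  · obtain ⟨k, s, r, h1, h2⟩ := exists_pseudo_rem _ h P
    exact ⟨r, lt_max_of_lt_right (h1.trans_le (natDegree_truncDegree_le W j)), fun _ => ⟨k, s, h2⟩⟩
  · exact ⟨0, by simp, fun h' => absurd h' h⟩

theorem sign_eq_of_mul_even_pow {x a b : K} (hx : x ≠ 0) (k : ℕ) (h : x ^ (2 * k) * a = b) :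
    SignType.sign a = SignType.sign b := by
  have : 0 < x ^ (2 * k) := by
    rw [pow_mul]; exact pow_pos (by positivity) k
  rw [← h, sign_mul, sign_pos this, one_mul]

-- One step of the elimination adds `P` of degree at most `d`. If its coefficient at `d` specializes
-- to 0, a truncation of smaller degree replaces it. Otherwise adjoin its derivative and its
-- remainders modulo all truncations of the other polynomials, which have degree below `d`; they fix
-- the signs of `P` at every relevant root.
open Classical in
theorem SignsDetermined.union_insert (hK : PolynomialIVT K) {d : ℕ} (hd : 1 ≤ d) (Q₀ T : Finset R[X])
    (hQ₀ : ∀ W ∈ Q₀, W.natDegree < d) (hT : ∀ W ∈ T, W.natDegree ≤ d) (P : R[X])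
    (hP : P.natDegree ≤ d)
    (ih : ∀ Q : Finset R[X], (∀ W ∈ Q, W.natDegree < d) → SignsDetermined K (Q ∪ T)) :
    SignsDetermined K (Q₀ ∪ insert P T) := by
  choose rem hrem1 hrem2 using exists_truncDegree_pseudo_rem P
  let U : Finset R[X] := insert P.derivative (Q₀ ∪ T)
  have hU : ∀ W ∈ U, W.natDegree ≤ d := by
    intro W hW
    simp only [U, Finset.mem_insert, Finset.mem_union] at hW
    rcases hW with rfl | hW | hW
    · exact (natDegree_derivative_le P).trans (by omega)
    · exact (hQ₀ W hW).le
    · exact hT W hW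
  let Q₂ : Finset R[X] := insert P.derivative Q₀ ∪
    (U ×ˢ Finset.range (d + 1)).image fun w => rem w.1 w.2
  obtain ⟨S₁, hS₁⟩ := ih (insert (truncDegree P (d - 1)) Q₀) (by
    intro W hW
    rcases Finset.mem_insert.1 hW with rfl | hW
    · exact (natDegree_truncDegree_le _ _).trans_lt (by omega)
    · exact hQ₀ W hW)
  obtain ⟨S₂, hS₂⟩ := ih Q₂ (by
    intro W hW
    simp only [Q₂, Finset.mem_union, Finset.mem_insert, Finset.mem_image, Finset.mem_product,
      Finset.mem_range] at hW
    rcases hW with (rfl | hW) | ⟨⟨W', j⟩, ⟨_, hj⟩, rfl⟩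
    · exact (natDegree_derivative_le P).trans_lt (by omega)
    · exact hQ₀ W hW
    · exact (hrem1 W' j).trans_le (max_le hd (Nat.lt_succ_iff.1 hj)))
  refine ⟨S₁ ∪ S₂ ∪ insert (P.coeff d)
    ((U ×ˢ Finset.range (d + 1)).image fun w => w.1.coeff w.2), fun u v huv => ?_⟩
  have huv1 : ∀ r ∈ S₁, SignType.sign (u r) = SignType.sign (v r) := fun r hr =>
    huv r (by simp [hr])
  have huv2 : ∀ r ∈ S₂, SignType.sign (u r) = SignType.sign (v r) := fun r hr =>
    huv r (by simp [hr])
  have huvP : SignType.sign (u (P.coeff d)) = SignType.sign (v (P.coeff d)) := huv _ (by simp)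
  -- The signs of all coefficients are among the data, so both specializations of `W` have the same
  -- degree and one truncation serves both.
  have huvW : ∀ W ∈ U, ∀ j, SignType.sign (u (W.coeff j)) = SignType.sign (v (W.coeff j)) := by
    intro W hW j
    by_cases hj : j ≤ d
    · refine huv _ (Finset.mem_union_right _ (Finset.mem_insert_of_mem
        (Finset.mem_image.2 ⟨(W, j), ?_, rfl⟩)))
      simp [hW, hj]
    · rw [coeff_eq_zero_of_natDegree_lt ((hU W hW).trans_lt (not_le.1 hj)), map_zero u, map_zero v]
  by_cases hP0 : u (P.coeff d) = 0
  · have hP0' : v (P.coeff d) = 0 := by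
      rw [hP0, sign_zero, eq_comm, sign_eq_zero_iff] at huvP
      exact huvP
    have htr : ∀ w : R →+* K, w (P.coeff d) = 0 → (truncDegree P (d - 1)).map w = P.map w := by
      intro w hw
      refine map_truncDegree P (d - 1) w fun i hi => ?_
      rcases (show d ≤ i by omega).eq_or_lt with rfl | hi
      · exact hw
      · rw [coeff_eq_zero_of_natDegree_lt (hP.trans_lt hi), map_zero]
    obtain ⟨σ, hσ⟩ := hS₁ u v huv1
    refine ⟨σ, fun W hW c => ?_⟩
    simp only [Finset.mem_union, Finset.mem_insert] at hW hσ
    rcases hW with hW | rfl | hW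
    · exact hσ W (Or.inl (Or.inr hW)) c
    · rw [← htr u hP0, ← htr v hP0']
      exact hσ _ (Or.inl (Or.inl rfl)) c
    · exact hσ W (Or.inr hW) c
  · have hP0' : v (P.coeff d) ≠ 0 := fun h => by
      rw [h, sign_zero, sign_eq_zero_iff] at huvP
      exact hP0 huvP
    have hnd : ∀ w : R →+* K, w (P.coeff d) ≠ 0 → (P.map w).natDegree = d := fun w hw =>
      le_antisymm (natDegree_map_le.trans hP) (le_natDegree_of_ne_zero (by rwa [coeff_map]))
    have hlc : ∀ w : R →+* K, w (P.coeff d) ≠ 0 → (P.map w).leadingCoeff = w (P.coeff d) :=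
      fun w hw => by rw [Polynomial.leadingCoeff, hnd w hw, coeff_map]
    have hne : ∀ w : R →+* K, w (P.coeff d) ≠ 0 → P.map w ≠ 0 := fun w hw h => by
      have := hnd w hw
      rw [h, natDegree_zero] at this
      omega
    have hder : (P.derivative).map u ≠ 0 := fun h => by
      rw [← derivative_map] at h
      have := Polynomial.derivative_eq_zero.1 h
      rw [hnd u hP0] at this
      omega
    obtain ⟨σ, hσ⟩ := hS₂ u v huv2
    have hσU : ∀ W ∈ U, ∀ c,
        SignType.sign ((W.map u).eval c) = SignType.sign ((W.map v).eval (σ c)) := by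
      intro W hW
      refine hσ W ?_
      simp only [U, Finset.mem_insert, Finset.mem_union] at hW
      simp only [Q₂, Finset.mem_insert, Finset.mem_union]
      tauto
    -- All roots of the specialized lower polynomials, including the critical points of `P`. The
    -- automorphism `τ` fixes them, so it corrects the signs of `P` without disturbing the others.
    let Z : Finset K := U.biUnion fun W => (W.map u).roots.toFinset
    have hZroot : ∀ W ∈ U, W.map u ≠ 0 → ∀ c, (W.map u).eval c = 0 → c ∈ Z := by
      intro W hW h0 c hc
      refine Finset.mem_biUnion.2 ⟨W, hW, ?_⟩
      simp [h0, hc]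
    have hPU : P.derivative ∈ U := Finset.mem_insert_self _ _
    obtain ⟨τ, hτ1, hτ2⟩ := exists_orderIso_sign_eval_eq hK (P.map u) (P.map v) (hne u hP0)
      (hne v hP0') (by rw [hnd u hP0, hnd v hP0']) (by rw [hlc u hP0, hlc v hP0', huvP]) σ Z
      (fun c hc => hZroot _ hPU hder c (by rwa [← derivative_map]))
      (fun c hc => by
        refine hZroot _ hPU hder c ?_
        have := hσU _ hPU c
        rw [derivative_map] at hc
        rw [hc, sign_zero, sign_eq_zero_iff] at this
        exact this)
      (by
        intro z hz
        obtain ⟨W, hW, hz⟩ := Finset.mem_biUnion.1 hz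
        rw [Multiset.mem_toFinset] at hz
        have hW0 : W.map u ≠ 0 := fun h => by simp [h] at hz
        have hz0 : (W.map u).eval z = 0 := (mem_roots hW0).1 hz
        set j := (W.map u).natDegree with hj
        have hj1 : 1 ≤ j := Nat.one_le_iff_ne_zero.2 fun h => by
          rw [h] at hj
          obtain ⟨c, hc⟩ := natDegree_eq_zero.1 hj.symm
          rw [← hc, eval_C] at hz0
          exact hW0 (by rw [← hc, hz0, map_zero])
        have hjd : j ≤ d := natDegree_map_le.trans (hU W hW)
        have hcu : u (W.coeff j) ≠ 0 := by
          rw [← coeff_map, hj, coeff_natDegree]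
          exact Polynomial.leadingCoeff_ne_zero.2 hW0
        have hcv : v (W.coeff j) ≠ 0 := fun h => by
          have := huvW W hW j
          rw [h, sign_zero, sign_eq_zero_iff] at this
          exact hcu this
        have hcu0 : ∀ i, j < i → u (W.coeff i) = 0 := fun i hi => by
          rw [← coeff_map]; exact coeff_eq_zero_of_natDegree_lt hi
        have hcv0 : ∀ i, j < i → v (W.coeff i) = 0 := fun i hi => by
          have := huvW W hW i
          rw [hcu0 i hi, sign_zero, eq_comm, sign_eq_zero_iff] at this
          exact this
        have htd : (truncDegree W j).natDegree = j := by
          refine le_antisymm (natDegree_truncDegree_le _ _) (le_natDegree_of_ne_zero ?_)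
          rw [coeff_truncDegree, if_pos le_rfl]
          exact fun h => hcu (by rw [h, map_zero])
        have htl : (truncDegree W j).leadingCoeff = W.coeff j := by
          rw [Polynomial.leadingCoeff, htd, coeff_truncDegree, if_pos le_rfl]
        obtain ⟨k, s, hks⟩ := hrem2 W j (by rw [htd]; exact hj1)
        rw [htl] at hks
        have key : ∀ (w : R →+* K) (x : K), w (W.coeff j) ≠ 0 →
            (∀ i, j < i → w (W.coeff i) = 0) → (W.map w).eval x = 0 →
            SignType.sign ((P.map w).eval x) = SignType.sign (((rem W j).map w).eval x) := by
          intro w x h1 h2 h3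
          have := congrArg (fun f => (f.map w).eval x) hks
          simp only [Polynomial.map_mul, Polynomial.map_add, Polynomial.map_pow, Polynomial.map_C, eval_mul,
            eval_add, eval_pow, eval_C, map_truncDegree W j w h2, h3, zero_mul, zero_add] at this
          exact sign_eq_of_mul_even_pow h1 k this
        have hWz := hσU W hW z
        rw [hz0, sign_zero, eq_comm, sign_eq_zero_iff] at hWz
        rw [key u z hcu hcu0 hz0, key v (σ z) hcv hcv0 hWz]
        refine hσ _ (Finset.mem_union_left _ (Finset.mem_union_right _
          (Finset.mem_image.2 ⟨(W, j), ?_, rfl⟩))) z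
        simp [hW, hjd])
    have hσW : ∀ W ∈ U, ∀ c,
        SignType.sign ((W.map u).eval c) = SignType.sign ((W.map v).eval (σ (τ c))) := by
      intro W hW c
      rw [← hσU W hW, sign_eval_eq_of_fixes_roots hK (W.map u) τ fun z h0 hz =>
        hτ1 z (hZroot W hW h0 z hz)]
    refine ⟨τ.trans σ, fun W hW c => ?_⟩
    rw [OrderIso.trans_apply]
    simp only [Finset.mem_union, Finset.mem_insert] at hW
    rcases hW with hW | rfl | hW
    · exact hσW W (by simp [U, hW]) c
    · exact hτ2 c
    · exact hσW W (by simp [U, hW]) c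

/-- A uniform form of quantifier elimination for real closed fields. -/
theorem signsDetermined (hK : PolynomialIVT K) (Q : Finset R[X]) : SignsDetermined K Q := by
  classical
  have key : ∀ d : ℕ, ∀ Q : Finset R[X], (∀ W ∈ Q, W.natDegree < d) → SignsDetermined K Q := by
    intro d
    induction d with
    | zero =>
      intro Q hQ
      exact ⟨∅, fun u v _ => ⟨OrderIso.refl K, fun P hP => absurd (hQ P hP) (Nat.not_lt_zero _)⟩⟩
    | succ d ih =>
      have aux : ∀ T : Finset R[X], (∀ W ∈ T, W.natDegree ≤ d) → ∀ Q₀ : Finset R[X],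
          (∀ W ∈ Q₀, W.natDegree < d) → SignsDetermined K (Q₀ ∪ T) := by
        intro T
        induction T using Finset.induction_on with
        | empty => exact fun _ Q₀ h => by rw [Finset.union_empty]; exact ih Q₀ h
        | insert P T hPT ihT =>
          intro hT Q₀ hQ₀
          have hP := hT P (Finset.mem_insert_self _ _)
          have hT' : ∀ W ∈ T, W.natDegree ≤ d := fun W hW => hT W (Finset.mem_insert_of_mem hW)
          rcases Nat.eq_zero_or_pos d with rfl | hd
          · obtain ⟨S, hS⟩ := ihT hT' Q₀ hQ₀
            refine ⟨insert (P.coeff 0) S, fun u v huv => ?_⟩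
            obtain ⟨σ, hσ⟩ := hS u v fun r hr => huv r (Finset.mem_insert_of_mem hr)
            refine ⟨σ, fun W hW c => ?_⟩
            simp only [Finset.mem_union, Finset.mem_insert] at hW hσ
            rcases hW with hW | rfl | hW
            · exact hσ W (Or.inl hW) c
            · rw [eq_C_of_natDegree_le_zero hP]
              simpa using huv _ (Finset.mem_insert_self _ _)
            · exact hσ W (Or.inr hW) c
          · exact SignsDetermined.union_insert hK hd Q₀ T hQ₀ hT' P hP (ihT hT')
      intro Q hQ
      have := aux Q (fun W hW => Nat.lt_succ_iff.1 (hQ W hW)) ∅ (by simp)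
      rwa [Finset.empty_union] at this
  exact key (Q.sup natDegree + 1) Q fun W hW => Nat.lt_succ_iff.2 (Finset.le_sup hW)

end SignElimination
-- From sign elimination to saturation
section SignTests

/-- Two assignments agree if the functions in `Q` have the same signs at them. -/
def SignAgree {M : Type} [LinearOrder M] [Zero M] {ι : Type} (Q : Set ((ι → M) → M))
    (x y : ι → M) : Prop :=
  ∀ f ∈ Q, SignType.sign (f x) = SignType.sign (f y)

/-- The map `E` adjoins one new coordinate to an assignment: each coordinate of `E x c` is a
coordinate of `x` or is `c`. -/
def IsAdjoin {M ι κ : Type} (E : (ι → M) → M → κ → M) : Prop :=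
  ∀ k, (∃ i, ∀ x c, E x c k = x i) ∨ ∀ x c, E x c k = c

theorem isAdjoin_snoc {M : Type} (α : Type) (n : ℕ) : IsAdjoin fun (x : α ⊕ Fin n → M) (c : M) =>
    (Sum.elim (x ∘ Sum.inl) (Fin.snoc (x ∘ Sum.inr) c : Fin (n + 1) → M)) := by
  rintro (a | i)
  · exact Or.inl ⟨Sum.inl a, fun x c => rfl⟩
  · refine Fin.lastCases ?_ (fun i => ?_) i
    · exact Or.inr fun x c => by simp
    · exact Or.inl ⟨Sum.inr i, fun x c => by simp⟩

/-- Families of test functions whose signs determine the truth of first-order formulas. -/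
structure IsSignElimination (L : FirstOrder.Language.{0, 0}) {M : Type} [L.Structure M]
    [LinearOrder M] [Zero M] (Tst : ∀ ι : Type, Set ((ι → M) → M)) : Prop where
  equal : ∀ (ι : Type) (s t : L.Term ι), ∃ Q : Set ((ι → M) → M), Q.Finite ∧ Q ⊆ Tst ι ∧
    ∀ x y, SignAgree Q x y → (s.realize x = t.realize x ↔ s.realize y = t.realize y)
  rel : ∀ (ι : Type) (n : ℕ) (R : L.Relations n) (ts : Fin n → L.Term ι),
    ∃ Q : Set ((ι → M) → M), Q.Finite ∧ Q ⊆ Tst ι ∧ ∀ x y, SignAgree Q x y →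
      (Structure.RelMap R (fun i => (ts i).realize x) ↔
        Structure.RelMap R fun i => (ts i).realize y)
  exists_extend : ∀ (ι κ : Type) (E : (ι → M) → M → κ → M), IsAdjoin E →
    ∀ Q : Set ((κ → M) → M), Q.Finite → Q ⊆ Tst κ →
    ∃ Q' : Set ((ι → M) → M), Q'.Finite ∧ Q' ⊆ Tst ι ∧
      ∀ x y, SignAgree Q' x y → ∀ c, ∃ d, SignAgree Q (E x c) (E y d)
  exists_cells : ∀ (ι κ : Type) (E : (ι → M) → M → κ → M), IsAdjoin E → ∀ f ∈ Tst κ, ∀ x,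
    ∃ Z : Set M, Z.Finite ∧ ∀ c d, (∀ z ∈ Z, (z < c ↔ z < d) ∧ (c < z ↔ d < z)) →
      SignType.sign (f (E x c)) = SignType.sign (f (E x d))

variable {L : FirstOrder.Language.{0, 0}} {M : Type} [L.Structure M] [LinearOrder M] [Zero M]
  {Tst : ∀ ι : Type, Set ((ι → M) → M)}

theorem SignAgree.symm {ι : Type} {Q : Set ((ι → M) → M)} {x y : ι → M} (h : SignAgree Q x y) :
    SignAgree Q y x := fun f hf => (h f hf).symm

/-- The truth of a formula is determined by the signs of finitely many test functions. -/
theorem IsSignElimination.realize_iff (h : IsSignElimination L Tst) {α : Type} {n : ℕ}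
    (φ : L.BoundedFormula α n) : ∃ Q : Set ((α ⊕ Fin n → M) → M), Q.Finite ∧ Q ⊆ Tst (α ⊕ Fin n) ∧
      ∀ x y, SignAgree Q x y →
        (φ.Realize (x ∘ Sum.inl) (x ∘ Sum.inr) ↔ φ.Realize (y ∘ Sum.inl) (y ∘ Sum.inr)) := by
  induction φ with
  | falsum => exact ⟨∅, Set.finite_empty, Set.empty_subset _, fun _ _ _ => Iff.rfl⟩
  | equal s t =>
    obtain ⟨Q, h1, h2, h3⟩ := h.equal _ s t
    refine ⟨Q, h1, h2, fun x y hxy => ?_⟩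
    simpa [BoundedFormula.Realize] using h3 x y hxy
  | rel R ts =>
    obtain ⟨Q, h1, h2, h3⟩ := h.rel _ _ R ts
    refine ⟨Q, h1, h2, fun x y hxy => ?_⟩
    simpa [BoundedFormula.Realize] using h3 x y hxy
  | imp φ ψ ih₁ ih₂ =>
    obtain ⟨Q₁, h1, h2, h3⟩ := ih₁
    obtain ⟨Q₂, k1, k2, k3⟩ := ih₂
    refine ⟨Q₁ ∪ Q₂, h1.union k1, Set.union_subset h2 k2, fun x y hxy => ?_⟩
    rw [BoundedFormula.realize_imp, BoundedFormula.realize_imp,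
      h3 x y fun f hf => hxy f (Or.inl hf), k3 x y fun f hf => hxy f (Or.inr hf)]
  | @all n φ ih =>
    obtain ⟨Q, h1, h2, h3⟩ := ih
    obtain ⟨Q', k1, k2, k3⟩ := h.exists_extend _ _ _ (isAdjoin_snoc α n) Q h1 h2
    have key : ∀ x y : α ⊕ Fin n → M, SignAgree Q' x y →
        φ.all.Realize (x ∘ Sum.inl) (x ∘ Sum.inr) → φ.all.Realize (y ∘ Sum.inl) (y ∘ Sum.inr) := by
      intro x y hxy hx c
      obtain ⟨d, hd⟩ := k3 y x hxy.symm c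
      have := (h3 _ _ hd).2
      rw [Sum.elim_comp_inl, Sum.elim_comp_inr, Sum.elim_comp_inl, Sum.elim_comp_inr] at this
      exact this (hx d)
    exact ⟨Q', k1, k2, fun x y hxy => ⟨key x y hxy, key y x hxy.symm⟩⟩

/-- A formula with parameters is constant on the cells of a finite set. -/
theorem IsSignElimination.exists_cells_formula (h : IsSignElimination L Tst) (A : Set M)
    (φ : L[[A]].Formula Unit) : ∃ Z : Set M, Z.Finite ∧
      ∀ c d, (∀ z ∈ Z, (z < c ↔ z < d) ∧ (c < z ↔ d < z)) →
        (φ.Realize (fun _ : Unit => c) ↔ φ.Realize fun _ : Unit => d) := by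
  let ψ : L.BoundedFormula (A ⊕ Unit) 0 := BoundedFormula.constantsVarsEquiv φ
  obtain ⟨Q, h1, h2, h3⟩ := h.realize_iff ψ
  let E : (A → M) → M → ((A ⊕ Unit) ⊕ Fin 0) → M := fun x c =>
    Sum.elim (Sum.elim x fun _ => c) default
  have hE : IsAdjoin E := by
    rintro ((a | u) | i)
    · exact Or.inl ⟨a, fun x c => rfl⟩
    · exact Or.inr fun x c => rfl
    · exact i.elim0
  choose! Z hZ1 hZ2 using fun f hf => h.exists_cells _ _ E hE f hf
    fun a => ((L.con a : L[[A]].Constants) : M)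
  refine ⟨⋃ f ∈ Q, Z f, h1.biUnion fun f hf => hZ1 f (h2 hf), fun c d hcd => ?_⟩
  have := h3 (E (fun a => ((L.con a : L[[A]].Constants) : M)) c)
    (E (fun a => ((L.con a : L[[A]].Constants) : M)) d) fun f hf =>
      hZ2 f (h2 hf) c d fun z hz => hcd z (Set.mem_biUnion hf hz)
  simp only [E, Sum.elim_comp_inl, Sum.elim_comp_inr] at this
  rwa [BoundedFormula.realize_constantsVarsEquiv, BoundedFormula.realize_constantsVarsEquiv] at this

/-- An `η₁`-ordered structure with sign elimination is `ℵ₁`-saturated. -/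
theorem IsSignElimination.isSaturated [Countable L.Symbols] (h : IsSignElimination L Tst)
    (hM : IsEtaOne M) : IsSaturated L ℵ₁ M := by
  intro A hA p hp
  have hAc : Countable A := by
    rw [← Cardinal.mk_le_aleph0_iff]
    rw [← Cardinal.succ_aleph0, Order.lt_succ_iff] at hA
    exact hA
  choose Z hZ1 hZ2 using h.exists_cells_formula A
  -- Extend the type to an ultrafilter. Unless it contains a boundary point as a singleton, it lies
  -- strictly on one side of each boundary point. These choices form a countable cut, and a point
  -- filling it lies in the same cells as `U`-many points.
  obtain ⟨U, hU⟩ := Ultrafilter.exists_ultrafilter_of_finite_inter_nonempty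
    ((fun φ : L[[A]].Formula Unit => {x : M | φ.Realize fun _ : Unit => x}) '' p) (by
      classical
      intro T hT
      obtain ⟨q, hq, rfl⟩ := Finset.subset_set_image_iff.1 hT
      obtain ⟨x, hx⟩ := hp q hq
      exact ⟨x, by simpa using hx⟩)
  have hUp : ∀ φ ∈ p, {x : M | φ.Realize fun _ : Unit => x} ∈ U := fun φ hφ =>
    hU (Set.mem_image_of_mem _ hφ)
  let W : Set M := ⋃ φ, Z φ
  have hW : W.Countable := Set.countable_iUnion fun φ => (hZ1 φ).countable
  by_cases hz : ∃ z ∈ W, {z} ∈ U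
  · obtain ⟨z, _, hz⟩ := hz
    refine ⟨z, fun φ hφ => ?_⟩
    obtain ⟨x, hx1, hx2⟩ := U.nonempty_of_mem (Filter.inter_mem (hUp φ hφ) hz)
    rw [Set.mem_singleton_iff] at hx2
    exact hx2 ▸ hx1
  push Not at hz
  have hside : ∀ z ∈ W, Set.Ioi z ∉ U → Set.Iio z ∈ U := by
    intro z hzW h1
    have h2 := Filter.inter_mem (Ultrafilter.compl_mem_iff_notMem.2 h1)
      (Ultrafilter.compl_mem_iff_notMem.2 (hz z hzW))
    refine Filter.mem_of_superset h2 fun x hx => ?_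
    exact lt_of_le_of_ne (not_lt.1 hx.1) hx.2
  obtain ⟨x, hx1, hx2⟩ := hM {z ∈ W | Set.Ioi z ∈ U} {z ∈ W | Set.Iio z ∈ U}
    (hW.mono fun z hz => hz.1) (hW.mono fun z hz => hz.1) (by
      intro a ha b hb
      obtain ⟨y, hy1, hy2⟩ := U.nonempty_of_mem (Filter.inter_mem ha.2 hb.2)
      exact lt_trans hy1 hy2)
  refine ⟨x, fun φ hφ => ?_⟩
  have hcell : ∀ z ∈ Z φ, {y : M | (z < y ↔ z < x) ∧ (y < z ↔ x < z)} ∈ U := by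
    intro z hz
    have hzW : z ∈ W := Set.mem_iUnion.2 ⟨φ, hz⟩
    by_cases h1 : Set.Ioi z ∈ U
    · have h2 := hx1 z ⟨hzW, h1⟩
      refine Filter.mem_of_superset h1 fun y hy => ?_
      exact ⟨iff_of_true hy h2, iff_of_false (lt_asymm hy) (lt_asymm h2)⟩
    · have h1 := hside z hzW h1
      have h2 := hx2 z ⟨hzW, h1⟩
      refine Filter.mem_of_superset h1 fun y hy => ?_
      exact ⟨iff_of_false (lt_asymm hy) (lt_asymm h2), iff_of_true hy h2⟩
  obtain ⟨y, hy1, hy2⟩ := U.nonempty_of_mem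
    (Filter.inter_mem (hUp φ hφ) ((Filter.biInter_mem (hZ1 φ)).2 hcell))
  exact (hZ2 φ y x fun z hz => Set.mem_iInter₂.1 hy2 z hz).1 hy1

end SignTests
-- Sign elimination for ordered fields and ordered groups
theorem sign_sub_eq_iff {M : Type*} [AddCommGroup M] [LinearOrder M] [IsOrderedAddMonoid M]
    {a b c d : M} (h : SignType.sign (a - b) = SignType.sign (c - d)) :
    (a = b ↔ c = d) ∧ (a < b ↔ c < d) := by
  constructor
  · rw [← sub_eq_zero, ← sign_eq_zero_iff, h, sign_eq_zero_iff, sub_eq_zero]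
  · rw [← sub_neg, ← sign_eq_neg_one_iff, h, sign_eq_neg_one_iff, sub_neg]

theorem eq_of_same_cell {M : Type*} [LinearOrder M] {z c d : M}
    (h : (z < c ↔ z < d) ∧ (c < z ↔ d < z)) (hz : z ∈ Set.uIcc c d) : c = d := by
  rcases Set.mem_uIcc.1 hz with ⟨h1, h2⟩ | ⟨h1, h2⟩
  · exact le_antisymm (h1.trans h2)
      ((not_lt.1 fun hd => not_lt.2 h1 (h.1.2 hd)).trans (not_lt.1 fun hc => not_lt.2 h2 (h.2.1 hc)))
  · exact le_antisymm
      ((not_lt.1 fun hc => not_lt.2 h1 (h.1.1 hc)).trans (not_lt.1 fun hd => not_lt.2 h2 (h.2.2 hd)))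
      (h1.trans h2)

section Field

open Polynomial

variable {K : Type} [Field K]

/-- The ring of integral polynomial functions. -/
def polyFunctions (K : Type) [Field K] (ι : Type) : Subring ((ι → K) → K) :=
  Subring.closure (Set.range fun (i : ι) (x : ι → K) => x i)

/-- Evaluation of polynomial functions at a point. -/
def polyFunctionsEval {ι : Type} (x : ι → K) : polyFunctions K ι →+* K :=
  (Pi.evalRingHom (fun _ => K) x).comp (polyFunctions K ι).subtype

/-- Sorting by powers of the adjoined coordinate leaves coefficients that are polynomial functions
of the old assignment. The elimination thus applies over `polyFunctions K ι`, two assignments being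
two specializations. -/
theorem exists_polynomial_of_mem_polyFunctions {ι κ : Type} (E : (ι → K) → K → κ → K)
    (hE : IsAdjoin E) (f : (κ → K) → K) (hf : f ∈ polyFunctions K κ) :
    ∃ P : (polyFunctions K ι)[X], ∀ x c, f (E x c) = (P.map (polyFunctionsEval x)).eval c := by
  induction hf using Subring.closure_induction with
  | mem f hf =>
    obtain ⟨k, rfl⟩ := hf
    rcases hE k with ⟨i, hi⟩ | hk
    · refine ⟨Polynomial.C ⟨fun x => x i, Subring.subset_closure ⟨i, rfl⟩⟩, fun x c => ?_⟩
      rw [Polynomial.map_C, eval_C]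
      exact hi x c
    · exact ⟨X, fun x c => by rw [Polynomial.map_X, eval_X]; exact hk x c⟩
  | zero => exact ⟨0, fun x c => by simp⟩
  | one => exact ⟨1, fun x c => by simp⟩
  | add f g _ _ hf hg =>
    obtain ⟨P, hP⟩ := hf
    obtain ⟨Q, hQ⟩ := hg
    exact ⟨P + Q, fun x c => by rw [Polynomial.map_add, eval_add, ← hP, ← hQ, Pi.add_apply]⟩
  | mul f g _ _ hf hg =>
    obtain ⟨P, hP⟩ := hf
    obtain ⟨Q, hQ⟩ := hg
    exact ⟨P * Q, fun x c => by rw [Polynomial.map_mul, eval_mul, ← hP, ← hQ, Pi.mul_apply]⟩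
  | neg f _ hf =>
    obtain ⟨P, hP⟩ := hf
    exact ⟨-P, fun x c => by rw [Polynomial.map_neg, eval_neg, ← hP, Pi.neg_apply]⟩

variable [LinearOrder K]

theorem realize_mem_polyFunctions {ι : Type} (t : orderedRing.Term ι) :
    (fun x : ι → K => t.realize x) ∈ polyFunctions K ι := by
  induction t with
  | var i => exact Subring.subset_closure ⟨i, rfl⟩
  | func f ts ih =>
    cases f with
    | zero => exact (polyFunctions K ι).zero_mem
    | one => exact (polyFunctions K ι).one_mem
    | neg => exact (polyFunctions K ι).neg_mem (ih 0)
    | add => exact (polyFunctions K ι).add_mem (ih 0) (ih 1)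
    | mul => exact (polyFunctions K ι).mul_mem (ih 0) (ih 1)

variable [IsStrictOrderedRing K]

theorem isSignElimination_orderedRing (hK : PolynomialIVT K) :
    IsSignElimination orderedRing (M := K) fun ι => (polyFunctions K ι : Set ((ι → K) → K)) where
  equal ι s t := by
    refine ⟨{fun x => s.realize x - t.realize x}, Set.finite_singleton _,
      Set.singleton_subset_iff.2 ((polyFunctions K ι).sub_mem (realize_mem_polyFunctions s)
        (realize_mem_polyFunctions t)), fun x y h => (sign_sub_eq_iff (h _ rfl)).1⟩
  rel ι n R ts := by
    cases R
    refine ⟨{fun x => (ts 0).realize x - (ts 1).realize x}, Set.finite_singleton _,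
      Set.singleton_subset_iff.2 ((polyFunctions K ι).sub_mem (realize_mem_polyFunctions _)
        (realize_mem_polyFunctions _)), fun x y h => (sign_sub_eq_iff (h _ rfl)).2⟩
  exists_extend ι κ E hE Q hQ hQT := by
    classical
    choose! P hP using fun f hf => exists_polynomial_of_mem_polyFunctions E hE f hf
    obtain ⟨S, hS⟩ := signsDetermined (R := polyFunctions K ι) hK (hQ.toFinset.image P)
    refine ⟨Subtype.val '' (S : Set (polyFunctions K ι)), S.finite_toSet.image _, ?_,
      fun x y hxy c => ?_⟩
    · rintro _ ⟨r, _, rfl⟩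
      exact r.2
    · obtain ⟨σ, hσ⟩ := hS (polyFunctionsEval x) (polyFunctionsEval y) fun r hr =>
        hxy r ⟨r, hr, rfl⟩
      -- The automorphism matching the sign patterns sends a value of the new coordinate to its
      -- counterpart.
      refine ⟨σ c, fun f hf => ?_⟩
      rw [hP f (hQT hf), hP f (hQT hf)]
      exact hσ _ (Finset.mem_image_of_mem _ (hQ.mem_toFinset.2 hf)) c
  exists_cells ι κ E hE f hf x := by
    classical
    obtain ⟨P, hP⟩ := exists_polynomial_of_mem_polyFunctions E hE f hf
    refine ⟨(P.map (polyFunctionsEval x)).roots.toFinset, Finset.finite_toSet _, fun c d h => ?_⟩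
    rw [hP, hP]
    by_cases h0 : P.map (polyFunctionsEval x) = 0
    · simp [h0]
    by_cases hcd : c = d
    · rw [hcd]
    refine sign_eval_eq_of_no_root hK _ _ _ fun z hz hz0 => hcd (eq_of_same_cell (h z ?_) hz)
    simp [h0, hz0]

end Field

section Group

variable {F : Type} [Field F]

/-- The vector space of linear functions of finitely many coordinates. -/
def linFunctions (F : Type) [Field F] (ι : Type) : Submodule F ((ι → F) → F) :=
  Submodule.span F (Set.range fun (i : ι) (x : ι → F) => x i)

theorem exists_affine_of_mem_linFunctions {ι κ : Type} (E : (ι → F) → F → κ → F)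
    (hE : IsAdjoin E) (f : (κ → F) → F) (hf : f ∈ linFunctions F κ) :
    ∃ g ∈ linFunctions F ι, ∃ k : F, ∀ x c, f (E x c) = g x + k * c := by
  induction hf using Submodule.span_induction with
  | mem f hf =>
    obtain ⟨k, rfl⟩ := hf
    rcases hE k with ⟨i, hi⟩ | hk
    · exact ⟨_, Submodule.subset_span ⟨i, rfl⟩, 0, fun x c => by simpa using hi x c⟩
    · exact ⟨0, Submodule.zero_mem _, 1, fun x c => by simpa using hk x c⟩
  | zero => exact ⟨0, Submodule.zero_mem _, 0, fun x c => by simp⟩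
  | add f₁ f₂ _ _ h₁ h₂ =>
    obtain ⟨g₁, hg₁, k₁, h₁⟩ := h₁
    obtain ⟨g₂, hg₂, k₂, h₂⟩ := h₂
    refine ⟨g₁ + g₂, Submodule.add_mem _ hg₁ hg₂, k₁ + k₂, fun x c => ?_⟩
    rw [Pi.add_apply, Pi.add_apply, h₁, h₂]; ring
  | smul a f _ h =>
    obtain ⟨g, hg, k, h⟩ := h
    refine ⟨a • g, Submodule.smul_mem _ _ hg, a * k, fun x c => ?_⟩
    rw [Pi.smul_apply, Pi.smul_apply, h, smul_eq_mul, smul_eq_mul]; ring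

variable [LinearOrder F]

theorem realize_mem_linFunctions {ι : Type} (t : orderedGroup.Term ι) :
    (fun x : ι → F => t.realize x) ∈ linFunctions F ι := by
  induction t with
  | var i => exact Submodule.subset_span ⟨i, rfl⟩
  | func f ts ih =>
    cases f with
    | zero => exact (linFunctions F ι).zero_mem
    | neg => exact (linFunctions F ι).neg_mem (ih 0)
    | add => exact (linFunctions F ι).add_mem (ih 0) (ih 1)

variable [IsStrictOrderedRing F]

/-- Either `c` is one of the `a i`, or it lies in an open gap whose counterpart is nonempty because
the order is dense without endpoints. -/
theorem exists_same_position {ι : Type} (s : Finset ι) (a b : ι → F)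
    (h : ∀ i ∈ s, ∀ j ∈ s, SignType.sign (a i - a j) = SignType.sign (b i - b j)) (c : F) :
    ∃ d, ∀ i ∈ s, SignType.sign (c - a i) = SignType.sign (d - b i) := by
  classical
  by_cases hc : ∃ j ∈ s, c = a j
  · obtain ⟨j, hj, rfl⟩ := hc
    exact ⟨b j, fun i hi => h j hj i hi⟩
  push Not at hc
  obtain ⟨d, h1, h2⟩ := Order.exists_between_finsets ((s.filter fun i => a i < c).image b)
    ((s.filter fun i => c < a i).image b) (by
      intro x hx y hy
      obtain ⟨i, hi, rfl⟩ := Finset.mem_image.1 hx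
      obtain ⟨j, hj, rfl⟩ := Finset.mem_image.1 hy
      rw [Finset.mem_filter] at hi hj
      exact (sign_sub_eq_iff (h i hi.1 j hj.1)).2.1 (hi.2.trans hj.2))
  refine ⟨d, fun i hi => ?_⟩
  rcases lt_or_gt_of_ne (hc i hi) with hlt | hlt
  · have := h2 (b i) (Finset.mem_image_of_mem _ (Finset.mem_filter.2 ⟨hi, hlt⟩))
    rw [sign_neg (sub_neg.2 hlt), sign_neg (sub_neg.2 this)]
  · have := h1 (b i) (Finset.mem_image_of_mem _ (Finset.mem_filter.2 ⟨hi, hlt⟩))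
    rw [sign_pos (sub_pos.2 hlt), sign_pos (sub_pos.2 this)]

/-- Tests are linear over all of `F`, more than group terms require, so that one can divide by the
coefficient of the eliminated coordinate. -/
theorem isSignElimination_orderedGroup :
    IsSignElimination orderedGroup (M := F) fun ι => (linFunctions F ι : Set ((ι → F) → F)) where
  equal ι s t := by
    refine ⟨{fun x => s.realize x - t.realize x}, Set.finite_singleton _,
      Set.singleton_subset_iff.2 ((linFunctions F ι).sub_mem (realize_mem_linFunctions s)
        (realize_mem_linFunctions t)), fun x y h => (sign_sub_eq_iff (h _ rfl)).1⟩
  rel ι n R ts := by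
    cases R
    refine ⟨{fun x => (ts 0).realize x - (ts 1).realize x}, Set.finite_singleton _,
      Set.singleton_subset_iff.2 ((linFunctions F ι).sub_mem (realize_mem_linFunctions _)
        (realize_mem_linFunctions _)), fun x y h => (sign_sub_eq_iff (h _ rfl)).2⟩
  exists_extend ι κ E hE Q hQ hQT := by
    classical
    choose! g hg k hgk using fun f hf => exists_affine_of_mem_linFunctions E hE f hf
    -- When `k f` is nonzero, `b f x` is the zero of the test in the new coordinate. The order of
    -- these zeros, together with the signs of the tests not involving that coordinate, is all that
    -- has to be matched.
    let b : ((κ → F) → F) → (ι → F) → F := fun f => -(k f)⁻¹ • g f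
    have hb : ∀ f ∈ Q, b f ∈ linFunctions F ι := fun f hf => Submodule.smul_mem _ _ (hg f (hQT hf))
    have hfb : ∀ f ∈ Q, k f ≠ 0 → ∀ x c, f (E x c) = k f * (c - b f x) := by
      intro f hf hk x c
      rw [hgk f (hQT hf)]
      simp only [b, Pi.smul_apply, smul_eq_mul]
      field_simp
      ring
    refine ⟨g '' Q ∪ (fun p : ((κ → F) → F) × ((κ → F) → F) => b p.1 - b p.2) '' (Q ×ˢ Q),
      (hQ.image _).union ((hQ.prod hQ).image _), ?_, fun x y hxy c => ?_⟩
    · rintro _ (⟨f, hf, rfl⟩ | ⟨⟨f₁, f₂⟩, ⟨h1, h2⟩, rfl⟩)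
      · exact hg f (hQT hf)
      · exact Submodule.sub_mem _ (hb _ h1) (hb _ h2)
    · obtain ⟨d, hd⟩ := exists_same_position hQ.toFinset (fun f => b f x) (fun f => b f y)
        (fun f₁ h₁ f₂ h₂ => hxy (b f₁ - b f₂) (Or.inr ⟨(f₁, f₂),
          ⟨hQ.mem_toFinset.1 h₁, hQ.mem_toFinset.1 h₂⟩, rfl⟩)) c
      refine ⟨d, fun f hf => ?_⟩
      by_cases hk : k f = 0
      · rw [hgk f (hQT hf), hgk f (hQT hf), hk, zero_mul, zero_mul, add_zero, add_zero]
        exact hxy _ (Or.inl ⟨f, hf, rfl⟩)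
      · rw [hfb f hf hk, hfb f hf hk, sign_mul, sign_mul, hd f (hQ.mem_toFinset.2 hf)]
  exists_cells ι κ E hE f hf x := by
    obtain ⟨g, -, k, hgk⟩ := exists_affine_of_mem_linFunctions E hE f hf
    refine ⟨{-k⁻¹ * g x}, Set.finite_singleton _, fun c d h => ?_⟩
    rw [hgk, hgk]
    by_cases hk : k = 0
    · rw [hk, zero_mul, zero_mul]
    have hcd := h _ rfl
    have key : ∀ w, g x + k * w = k * (w - -k⁻¹ * g x) := fun w => by
      field_simp
      ring
    rw [key, key, sign_mul, sign_mul]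
    congr 1
    rcases lt_trichotomy c (-k⁻¹ * g x) with hc | hc | hc
    · rw [sign_neg (sub_neg.2 hc), sign_neg (sub_neg.2 (hcd.2.1 hc))]
    · have : d = -k⁻¹ * g x := le_antisymm (not_lt.1 fun hd => (hcd.1.2 hd).ne hc.symm)
        (not_lt.1 fun hd => (hcd.2.2 hd).ne hc)
      rw [hc, this]
    · rw [sign_pos (sub_pos.2 hc), sign_pos (sub_pos.2 (hcd.1.1 hc))]

end Group

/-! ### Countable languages and the hyperreal exponent group -/

instance : Countable orderedRing.Symbols := by
  have h1 : ∀ n, Finite (RingFunc n) := fun n =>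
    Finite.of_injective (β := Fin 5) (fun f => match f with
      | .zero => 0 | .one => 1 | .neg => 2 | .add => 3 | .mul => 4) (by
        intro a b h; cases a <;> cases b <;> simp_all)
  have h2 : ∀ n, Finite (LtRel n) := fun n =>
    Finite.of_injective (β := Fin 1) (fun _ => 0) (by intro a b _; cases a; cases b; rfl)
  exact inferInstanceAs (Countable ((Σ n, RingFunc n) ⊕ Σ n, LtRel n))

instance : Countable orderedGroup.Symbols := by
  have h1 : ∀ n, Finite (GroupFunc n) := fun n =>
    Finite.of_injective (β := Fin 3) (fun f => match f with
      | .zero => 0 | .neg => 1 | .add => 2) (by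
        intro a b h; cases a <;> cases b <;> simp_all)
  have h2 : ∀ n, Finite (LtRel n) := fun n =>
    Finite.of_injective (β := Fin 1) (fun _ => 0) (by intro a b _; cases a; cases b; rfl)
  exact inferInstanceAs (Countable ((Σ n, GroupFunc n) ⊕ Σ n, LtRel n))

theorem isSaturated_orderedGroup_hyperreal : IsSaturated orderedGroup ℵ₁ Hyperreal :=
  isSignElimination_orderedGroup.isSaturated isEtaOne_hyperreal

theorem divisible_hyperreal (n : ℕ) (hn : n ≠ 0) (g : Hyperreal) :
    ∃ h : Hyperreal, n • h = g := by
  refine ⟨g / n, ?_⟩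
  have : (n : Hyperreal) ≠ 0 := Nat.cast_ne_zero.2 hn
  rw [nsmul_eq_mul]
  field_simp

end PAIntegerPart

theorem corollary1p4 :
    ∃ (G : Type) (_ : AddCommGroup G) (_ : LinearOrder G) (_ : IsOrderedAddMonoid G),
      Nontrivial G ∧
      (∀ n : ℕ, n ≠ 0 → ∀ g : G, ∃ h : G, n • h = g) ∧
      PAIntegerPart.IsSaturated PAIntegerPart.orderedGroup ℵ₁ G ∧
      IsRealClosed (Lex (HahnSeries G ℝ)) ∧
      PAIntegerPart.IsSaturated PAIntegerPart.orderedRing ℵ₁ (Lex (HahnSeries G ℝ)) ∧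
      ∀ M : Subring (Lex (HahnSeries G ℝ)),
        PAIntegerPart.IsIntegerPart M → ¬ PAIntegerPart.ModelsPA M :=
  ⟨Hyperreal, inferInstance, inferInstance, inferInstance, inferInstance,
    PAIntegerPart.divisible_hyperreal, PAIntegerPart.isSaturated_orderedGroup_hyperreal,
    PAIntegerPart.isRealClosed_hahnSeries PAIntegerPart.divisible_hyperreal,
    (PAIntegerPart.isSignElimination_orderedRing
      (PAIntegerPart.polynomialIVT_hahnSeries PAIntegerPart.divisible_hyperreal)).isSaturated
      PAIntegerPart.isEtaOne_hyperreal.hahnSeries,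
    fun M hM => PAIntegerPart.not_modelsPA_of_isIntegerPart M hM⟩
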